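/- Let $k$ be a field of characteristic $0$ and let $R$ be an associative unital $k$-algebra with a $k$-linear anti-involution $r\mapsto\bar r$. Let $J(R)$ be the associative algebra of matrices $(m_{i,j})_{i,j\in\mathbb Z}$ with entries in $R$ for which there is $N$ with $m_{i,j}=0$ whenever $|i-j|>N$; write $E_{i,j}(r)$ for the matrix with the single entry $r$ in position $(i,j)$ and ${}^tX=(\overline{m_{j,i}})_{i,j}$ for $X=(m_{i,j})_{i,j}$. For $l\in\mathbb Z$ put $$\tau_l(X)=(-1)^lJ_l\,{}^tX\,J_l,\quad J_l=\sum_{i\in\mathbb Z}(-1)^iE_{i,l-i},\qquad \tau_l^s(X)=J_l^s\,{}^tX\,J_l^s,\quad J_l^s=\sum_{i\in\mathbb Z}E_{i,l-i},$$ and define Lie subalgebras of $J(R)$ with the commutator bracket by $$\mathfrak o_J^{\mathrm{odd}}(R)=\{X\mid\tau_0^s(X)=-X\},\quad \mathfrak{sp}_J(R)=\{X\mid\tau_{-1}(X)=-X\},\quad \mathfrak o_J^{\mathrm{even}}(R)=\{X\mid\tau_{-1}^s(X)=-X\}.$$ For an associative unital $k$-algebra $A$ with a $k$-linear anti-involution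 $*$, let $I_{2n+1}=\{-n,\dots,n\}$ and $I_{2n}=\{-n,\dots,n-1\}$, and let ${}^tX=(x_{j,i}^*)_{i,j}$ for a finite matrix $X=(x_{i,j})$ over $A$. Let $\mathfrak o_{2n+1}(A)$ be the Lie algebra of matrices $X$ over $A$ indexed by $I_{2n+1}$ with ${}^tX\,F+F\,X=0$ for $F=\sum_{i\in I_{2n+1}}e_{i,-i}$; let $\mathfrak{sp}_{2n}(A)$ and $\mathfrak o_{2n}(A)$ be the Lie algebras of matrices indexed by $I_{2n}$ defined by the same equation for $F=\sum_{i\in I_{2n}}(-1)^ie_{i,-i-1}$ and for $F=\sum_{i\in I_{2n}}e_{i,-i-1}$, respectively. Let $\mathfrak o_{\mathrm{odd}}(A)$, $\mathfrak{sp}(A)$ and $\mathfrak o_{\mathrm{even}}(A)$ be the unions over $n$ of $\mathfrak o_{2n+1}(A)$, $\mathfrak{sp}_{2n}(A)$ and $\mathfrak o_{2n}(A)$ along the inclusions (extension by zero) induced by $I_{2n+1}\subset I_{2n+3}$ and $I_{2n}\subset I_{2n+2}$. Equip $A=J(R)$ with the anti-involution $*$ given by $(X^*)_{i,j}=\overline{m_{-j,-i}}$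 for $X=(m_{i,j})$, so that $E_{i,j}(r)^*=E_{-j,-i}(\bar r)$. For a Lie algebra $\mathfrak g$ over $k$, let $H_\bullet(\mathfrak g)$ be its homology with coefficients in the trivial module $k$, that is, the homology of the Chevalley–Eilenberg complex $(\bigwedge^\bullet\mathfrak g,d)$. Then there are isomorphisms of graded $k$-vector spaces $$H_\bullet(\mathfrak o_J^{\mathrm{odd}}(R))\cong H_\bullet(\mathfrak o_{\mathrm{odd}}(J(R))),\quad H_\bullet(\mathfrak{sp}_J(R))\cong H_\bullet(\mathfrak{sp}(J(R))),\quad H_\bullet(\mathfrak o_J^{\mathrm{even}}(R))\cong H_\bullet(\mathfrak o_{\mathrm{even}}(J(R))).$$ -/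

import Mathlib

namespace JacobiLie

/-! ## Homology of Lie algebras with trivial coefficients -/

section Homology

open ExteriorAlgebra CliffordAlgebra

variable (k : Type*) [CommRing k] (L : Type*) [LieRing L] [LieAlgebra k L]

/-- Recursion step for `adExt`: `x ↦ (y ↦ ((w, v) ↦ [x, y] ∧ w + y ∧ v))`. -/
noncomputable def adStep (x : L) :
    L →ₗ[k] ExteriorAlgebra k L × ExteriorAlgebra k L →ₗ[k] ExteriorAlgebra k L :=
  LinearMap.mk₂ k (fun y p => ExteriorAlgebra.ι k ⁅x, y⁆ * p.1 + ExteriorAlgebra.ι k y * p.2)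
    (by intro a b p; simp only [lie_add, map_add, add_mul]; abel)
    (by intro c a p; simp only [lie_smul, map_smul, smul_mul_assoc, smul_add])
    (by intro a p q; simp only [Prod.fst_add, Prod.snd_add, mul_add]; abel)
    (by intro c a p; simp only [Prod.smul_fst, Prod.smul_snd, mul_smul_comm, smul_add])

/-- The derivation of the exterior algebra extending `ad x`:
`x · (y₁ ∧ ⋯ ∧ yₙ) = ∑ j, y₁ ∧ ⋯ ∧ [x, yⱼ] ∧ ⋯ ∧ yₙ`. -/
noncomputable def adExt (x : L) : ExteriorAlgebra k L →ₗ[k] ExteriorAlgebra k L :=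
  CliffordAlgebra.foldr' (0 : QuadraticForm k L) (adStep k L x)
    (by
      intro m w v
      have h := ExteriorAlgebra.ι_add_mul_swap (R := k) ⁅x, m⁆ m
      have h2 : ExteriorAlgebra.ι k m * ExteriorAlgebra.ι k m = 0 := ExteriorAlgebra.ι_sq_zero m
      change ExteriorAlgebra.ι k ⁅x, m⁆ * (ExteriorAlgebra.ι k m * w)
        + ExteriorAlgebra.ι k m * (ExteriorAlgebra.ι k ⁅x, m⁆ * w + ExteriorAlgebra.ι k m * v) = _
      rw [mul_add, ← mul_assoc, ← mul_assoc, ← mul_assoc, h2, ← add_assoc, ← add_mul, h]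
      simp) 0

@[simp] theorem adExt_one (x : L) : adExt k L x 1 = 0 := by
  have := CliffordAlgebra.foldr'_algebraMap (0 : QuadraticForm k L) (adStep k L x)
    (by
      intro m w v
      have h := ExteriorAlgebra.ι_add_mul_swap (R := k) ⁅x, m⁆ m
      have h2 : ExteriorAlgebra.ι k m * ExteriorAlgebra.ι k m = 0 := ExteriorAlgebra.ι_sq_zero m
      change ExteriorAlgebra.ι k ⁅x, m⁆ * (ExteriorAlgebra.ι k m * w)
        + ExteriorAlgebra.ι k m * (ExteriorAlgebra.ι k ⁅x, m⁆ * w + ExteriorAlgebra.ι k m * v) = _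
      rw [mul_add, ← mul_assoc, ← mul_assoc, ← mul_assoc, h2, ← add_assoc, ← add_mul, h]
      simp) 0 1
  simpa [adExt] using this

theorem adExt_ι_mul (x y : L) (w : ExteriorAlgebra k L) :
    adExt k L x (ExteriorAlgebra.ι k y * w)
      = ExteriorAlgebra.ι k ⁅x, y⁆ * w + ExteriorAlgebra.ι k y * adExt k L x w :=
  CliffordAlgebra.foldr'_ι_mul (0 : QuadraticForm k L) (adStep k L x) _ 0 y w

/-- Induction on the exterior algebra by left multiplication with vectors. -/
@[elab_as_elim]
theorem ext_induction {P : ExteriorAlgebra k L → Prop} (w : ExteriorAlgebra k L)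
    (h1 : P 1) (hs : ∀ (c : k) w, P w → P (c • w)) (ha : ∀ v w, P v → P w → P (v + w))
    (hm : ∀ x w, P w → P (ExteriorAlgebra.ι k x * w)) : P w := by
  induction w using CliffordAlgebra.left_induction with
  | algebraMap r => rw [Algebra.algebraMap_eq_smul_one]; exact hs _ _ h1
  | add x y hx hy => exact ha _ _ hx hy
  | ι_mul x m hx => exact hm _ _ hx

theorem adExt_add (x y : L) : adExt k L (x + y) = adExt k L x + adExt k L y := by
  refine LinearMap.ext fun w => ?_
  induction w using ext_induction k L with
  | h1 => simp
  | hs c w h => simp [h]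
  | ha v w h1 h2 => rw [map_add, map_add, h1, h2]
  | hm z w h =>
    simp only [LinearMap.add_apply] at h ⊢
    simp only [adExt_ι_mul, h, add_lie, map_add, add_mul, mul_add]; abel

theorem adExt_smul (c : k) (x : L) : adExt k L (c • x) = c • adExt k L x := by
  refine LinearMap.ext fun w => ?_
  induction w using ext_induction k L with
  | h1 => simp
  | hs c w h => simp [h]
  | ha v w h1 h2 => rw [map_add, map_add, h1, h2]
  | hm z w h =>
    simp only [LinearMap.smul_apply] at h ⊢
    simp only [adExt_ι_mul, h, smul_lie, map_smul, smul_add, smul_mul_assoc, mul_smul_comm]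

theorem adExt_lie (x y : L) (w : ExteriorAlgebra k L) :
    adExt k L ⁅x, y⁆ w = adExt k L x (adExt k L y w) - adExt k L y (adExt k L x w) := by
  induction w using ext_induction k L with
  | h1 => simp
  | hs c w h => simp [h, smul_sub]
  | ha v w h1 h2 => simp only [map_add, h1, h2]; abel
  | hm z w h =>
    simp only [adExt_ι_mul, map_add, h, lie_lie, map_sub, sub_mul, mul_sub]; abel

/-- Recursion step for `ceD`: `x ↦ ((w, v) ↦ x · w - x ∧ v)`. -/
noncomputable def ceStep :
    L →ₗ[k] ExteriorAlgebra k L × ExteriorAlgebra k L →ₗ[k] ExteriorAlgebra k L :=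
  LinearMap.mk₂ k (fun x p => adExt k L x p.1 - ExteriorAlgebra.ι k x * p.2)
    (by intro a b p; simp only [adExt_add, LinearMap.add_apply, map_add, add_mul]; abel)
    (by intro c a p; simp only [adExt_smul, LinearMap.smul_apply, map_smul, smul_mul_assoc,
          smul_sub])
    (by intro a p q; simp only [Prod.fst_add, Prod.snd_add, map_add, mul_add]; abel)
    (by intro c a p; simp only [Prod.smul_fst, Prod.smul_snd, map_smul, mul_smul_comm, smul_sub])

theorem ceStep_ceStep (m : L) (w v : ExteriorAlgebra k L) :
    ceStep k L m (ExteriorAlgebra.ι k m * w, ceStep k L m (w, v))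
      = (0 : QuadraticForm k L) m • v := by
  have h2 : ExteriorAlgebra.ι k m * ExteriorAlgebra.ι k m = 0 := ExteriorAlgebra.ι_sq_zero m
  change adExt k L m (ExteriorAlgebra.ι k m * w)
    - ExteriorAlgebra.ι k m * (adExt k L m w - ExteriorAlgebra.ι k m * v) = _
  rw [adExt_ι_mul, mul_sub, ← mul_assoc, h2]
  simp

/-- The Chevalley-Eilenberg differential on the exterior algebra of a Lie algebra, given by
`d 1 = 0` and `d (x ∧ w) = x · w - x ∧ d w`; the usual closed formula is `ceD_ιMulti` below. -/
noncomputable def ceD : ExteriorAlgebra k L →ₗ[k] ExteriorAlgebra k L :=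
  CliffordAlgebra.foldr' (0 : QuadraticForm k L) (ceStep k L) (ceStep_ceStep k L) 0

@[simp] theorem ceD_one : ceD k L 1 = 0 := by
  have := CliffordAlgebra.foldr'_algebraMap (0 : QuadraticForm k L) (ceStep k L)
    (ceStep_ceStep k L) 0 1
  simpa [ceD] using this

theorem ceD_ι_mul (x : L) (w : ExteriorAlgebra k L) :
    ceD k L (ExteriorAlgebra.ι k x * w) = adExt k L x w - ExteriorAlgebra.ι k x * ceD k L w :=
  CliffordAlgebra.foldr'_ι_mul (0 : QuadraticForm k L) (ceStep k L) (ceStep_ceStep k L) 0 x w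

theorem ceD_adExt (x : L) (w : ExteriorAlgebra k L) :
    ceD k L (adExt k L x w) = adExt k L x (ceD k L w) := by
  induction w using ext_induction k L with
  | h1 => simp
  | hs c w h => simp [h]
  | ha v w h1 h2 => simp only [map_add, h1, h2]
  | hm z w h =>
    simp only [adExt_ι_mul, ceD_ι_mul, map_add, map_sub, h, adExt_lie]; abel

/-- `d ∘ d = 0`. -/
theorem ceD_ceD (w : ExteriorAlgebra k L) : ceD k L (ceD k L w) = 0 := by
  induction w using ext_induction k L with
  | h1 => simp
  | hs c w h => simp [h]
  | ha v w h1 h2 => simp only [map_add, h1, h2, add_zero]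
  | hm z w h =>
    simp only [ceD_ι_mul, map_sub, ceD_adExt, h]; simp

theorem ιMulti_cons {n : ℕ} (v : Fin (n + 1) → L) :
    ιMulti k (n + 1) v = ExteriorAlgebra.ι k (v 0) * ιMulti k n (fun i => v i.succ) :=
  ιMulti_succ_apply v

theorem adExt_ιMulti (x : L) (n : ℕ) (v : Fin (n + 1) → L) :
    adExt k L x (ιMulti k (n + 1) v) = ∑ j : Fin (n + 1),
      (-1 : k) ^ (j : ℕ) • (ExteriorAlgebra.ι k ⁅x, v j⁆ * ιMulti k n (fun m => v (j.succAbove m))) := by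
  induction n with
  | zero => rw [ιMulti_cons, adExt_ι_mul]; simp
  | succ n ih =>
    rw [ιMulti_cons, adExt_ι_mul, ih, Fin.sum_univ_succ (n := n + 1), Finset.mul_sum]
    congr 1
    · simp
    · refine Finset.sum_congr rfl fun j _ => ?_
      rw [ιMulti_cons k L (fun m => v (j.succ.succAbove m))]
      have h := ExteriorAlgebra.ι_add_mul_swap (R := k) (v 0) ⁅x, v j.succ⁆
      rw [add_eq_zero_iff_eq_neg] at h
      simp only [Fin.succ_succAbove_zero, Fin.succ_succAbove_succ, mul_smul_comm, Fin.val_succ]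
      rw [← mul_assoc, h, pow_succ, ← mul_assoc]
      simp

/-- The closed formula for the differential. The pairs `i < j` of indices in `{0, …, n + 1}` are
parametrized by `j : Fin (n + 2)` and `i : Fin (n + 1)` with `i < j`; the factors `xᵢ` and `xⱼ`
are removed by the two maps `succAbove`. -/
theorem ceD_ιMulti (n : ℕ) (v : Fin (n + 2) → L) :
    ceD k L (ιMulti k (n + 2) v) = ∑ j : Fin (n + 2), ∑ i : Fin (n + 1),
      if i.castSucc < j then (-1 : k) ^ ((i : ℕ) + (j : ℕ) + 1) •
        (ExteriorAlgebra.ι k ⁅v i.castSucc, v j⁆ *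
          ιMulti k n (fun m => v (j.succAbove (i.succAbove m)))) else 0 := by
  induction n with
  | zero =>
    rw [ιMulti_cons, ceD_ι_mul, adExt_ιMulti, ιMulti_cons, ceD_ι_mul]
    simp [Fin.sum_univ_succ]
  | succ n ih =>
    rw [ιMulti_cons, ceD_ι_mul, adExt_ιMulti, ih, Fin.sum_univ_succ (n := n + 2)]
    simp only [Fin.not_lt_zero, if_false, Finset.sum_const_zero, zero_add]
    rw [Finset.mul_sum, ← Finset.sum_sub_distrib]
    refine Finset.sum_congr rfl fun j _ => ?_
    rw [Fin.sum_univ_succ (n := n + 1), sub_eq_add_neg]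
    congr 1
    · simp [pow_add]
    · rw [Finset.mul_sum, ← Finset.sum_neg_distrib]
      refine Finset.sum_congr rfl fun i _ => ?_
      simp only [Fin.castSucc_succ, Fin.succ_lt_succ_iff]
      split_ifs with hij
      · rw [ιMulti_cons k L (fun m => v (j.succ.succAbove (i.succ.succAbove m)))]
        have h := ExteriorAlgebra.ι_add_mul_swap (R := k) (v 0) ⁅v i.castSucc.succ, v j.succ⁆
        rw [add_eq_zero_iff_eq_neg] at h
        simp only [Fin.succ_succAbove_zero, Fin.succ_succAbove_succ, mul_smul_comm, Fin.val_succ]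
        rw [← mul_assoc, h, ← mul_assoc]
        have : (-1 : k) ^ ((i : ℕ) + 1 + ((j : ℕ) + 1) + 1) = (-1) ^ ((i : ℕ) + (j : ℕ) + 1) := by
          ring
        rw [this]; simp
      · simp

/-- The differential lowers the degree by one. -/
theorem ceD_mem (n : ℕ) (w : ExteriorAlgebra k L) (hw : w ∈ ⋀[k]^(n + 1) L) :
    ceD k L w ∈ ⋀[k]^n L := by
  rw [← ιMulti_span_fixedDegree] at hw
  induction hw using Submodule.span_induction with
  | zero => simp
  | add x y _ _ hx hy => rw [map_add]; exact add_mem hx hy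
  | smul c x _ hx => rw [map_smul]; exact Submodule.smul_mem _ _ hx
  | mem x hx =>
    obtain ⟨v, rfl⟩ := hx
    cases n with
    | zero => rw [ιMulti_cons, ceD_ι_mul]; simp
    | succ n =>
      rw [ceD_ιMulti]
      refine Submodule.sum_mem _ fun j _ => Submodule.sum_mem _ fun i _ => ?_
      split_ifs
      · refine Submodule.smul_mem _ _ ?_
        have : ExteriorAlgebra.ι k ⁅v i.castSucc, v j⁆ *
            ιMulti k n (fun m => v (j.succAbove (i.succAbove m)))
            = ιMulti k (n + 1) (Fin.cons ⁅v i.castSucc, v j⁆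
                (fun m => v (j.succAbove (i.succAbove m)))) := by
          rw [ιMulti_cons]; simp
        rw [this]
        exact ιMulti_range k (n + 1) ⟨_, rfl⟩
      · exact zero_mem _

/-- The cycles of degree `n` in the complex `(⋀^• L, d)`. -/
noncomputable def ceCycles (n : ℕ) : Submodule k (ExteriorAlgebra k L) :=
  ⋀[k]^n L ⊓ LinearMap.ker (ceD k L)

/-- The boundaries of degree `n` in the complex `(⋀^• L, d)`. -/
noncomputable def ceBoundaries (n : ℕ) : Submodule k (ExteriorAlgebra k L) :=
  (⋀[k]^(n + 1) L).map (ceD k L)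

theorem ceBoundaries_le_ceCycles (n : ℕ) : ceBoundaries k L n ≤ ceCycles k L n := by
  rintro _ ⟨w, hw, rfl⟩
  exact ⟨ceD_mem k L n w hw, ceD_ceD k L w⟩

/-- The homology `Hₙ(L)` of the Lie algebra `L` with coefficients in the trivial module `k`. -/
abbrev LieHomology (n : ℕ) : Type _ :=
  ceCycles k L n ⧸ (ceBoundaries k L n).submoduleOf (ceCycles k L n)

end Homology

attribute [local instance 100] LieRing.ofAssociativeRing

/-! ## Anti-involutions and their `-1`-eigenspaces -/

/-- A `k`-linear anti-involution of an associative `k`-algebra `A`. -/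
structure AntiInvolution (k A : Type*) [CommRing k] [Ring A] [Algebra k A] extends A →ₗ[k] A where
  map_mul' : ∀ a b : A, toFun (a * b) = toFun b * toFun a
  invol' : ∀ a : A, toFun (toFun a) = a

namespace AntiInvolution

variable {k A : Type*} [CommRing k] [Ring A] [Algebra k A]

instance : CoeFun (AntiInvolution k A) (fun _ => A → A) := ⟨fun σ => σ.toLinearMap⟩

theorem map_mul (σ : AntiInvolution k A) (a b : A) : σ (a * b) = σ b * σ a := σ.map_mul' a b

@[simp] theorem invol (σ : AntiInvolution k A) (a : A) : σ (σ a) = a := σ.invol' a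

@[simp] theorem map_one (σ : AntiInvolution k A) : σ 1 = 1 := by
  have h : σ (1 * σ 1) = σ (σ 1) * σ 1 := σ.map_mul _ _
  simpa using h.symm

@[simp] theorem map_zero (σ : AntiInvolution k A) : σ 0 = 0 := σ.toLinearMap.map_zero

theorem map_finsum {ι : Type*} (σ : AntiInvolution k A) (f : ι → A) :
    σ (∑ᶠ i, f i) = ∑ᶠ i, σ (f i) :=
  σ.toLinearMap.toAddMonoidHom.map_finsum_of_injective
    (Function.LeftInverse.injective (g := σ) σ.invol) f

/-- The Lie subalgebra `{X ∈ A | σ(X) = -X}` of `A` with the commutator bracket. -/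
def skew (σ : AntiInvolution k A) : LieSubalgebra k A where
  carrier := {X | σ X = -X}
  add_mem' := by
    intro a b (ha : σ a = -a) (hb : σ b = -b)
    change σ (a + b) = -(a + b)
    rw [LinearMap.map_add, ha, hb, neg_add]
  zero_mem' := by simp
  smul_mem' := by
    intro c a (ha : σ a = -a)
    change σ (c • a) = -(c • a)
    rw [LinearMap.map_smul, ha, smul_neg]
  lie_mem' := by
    intro a b (ha : σ a = -a) (hb : σ b = -b)
    change σ ⁅a, b⁆ = -⁅a, b⁆
    rw [Ring.lie_def, LinearMap.map_sub, σ.map_mul, σ.map_mul, ha, hb]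
    noncomm_ring

theorem mem_skew (σ : AntiInvolution k A) (X : A) : X ∈ σ.skew ↔ σ X = -X := Iff.rfl

end AntiInvolution

/-! ## Matrices indexed by the integers and generalized Jacobi matrices -/

section Matrices

variable {R : Type*} [Ring R]

/-- Matrices indexed by `ℤ × ℤ` with entries in `R`. -/
abbrev ZMat (R : Type*) : Type _ := ℤ → ℤ → R

/-- The product of two matrices indexed by `ℤ`; it is used only where, for all `i` and `j`, the
sum has finitely many nonzero terms. -/
noncomputable def zmul (a b : ZMat R) : ZMat R := fun i j => ∑ᶠ l, a i l * b l j

/-- The matrix `∑ i, s(i) E_{i, l - i}` for a sequence of signs `s`. -/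
def antidiag (R : Type*) [Ring R] (l : ℤ) (s : ℤ → ℤˣ) : ZMat R :=
  fun i j => if j = l - i then ((s i : ℤ) : R) else 0

theorem zmul_antidiag_left (l : ℤ) (s : ℤ → ℤˣ) (b : ZMat R) (i j : ℤ) :
    zmul (antidiag R l s) b i j = ((s i : ℤ) : R) * b (l - i) j := by
  rw [zmul, finsum_eq_single _ (l - i)]
  · simp [antidiag]
  · intro x hx; simp [antidiag, hx]

theorem zmul_antidiag_right (l : ℤ) (s : ℤ → ℤˣ) (a : ZMat R) (i j : ℤ) :
    zmul a (antidiag R l s) i j = a i (l - j) * ((s (l - j) : ℤ) : R) := by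
  rw [zmul, finsum_eq_single _ (l - j)]
  · simp [antidiag]
  · intro x hx
    have : ¬ j = l - x := by omega
    simp [antidiag, this]

/-- The matrices `(m i j)` indexed by `ℤ` with `m i j = 0` for `|i - j| > N`, for some `N`. -/
def banded (R : Type*) [Ring R] : AddSubgroup (ZMat R) where
  carrier := {m | ∃ N : ℕ, ∀ i j : ℤ, (N : ℤ) < |i - j| → m i j = 0}
  zero_mem' := ⟨0, fun _ _ _ => rfl⟩
  add_mem' := by
    rintro a b ⟨N, hN⟩ ⟨M, hM⟩
    refine ⟨max N M, fun i j h => ?_⟩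
    rw [Pi.add_apply, Pi.add_apply, hN i j (lt_of_le_of_lt (by simp) h),
      hM i j (lt_of_le_of_lt (by simp) h), add_zero]
  neg_mem' := by
    rintro a ⟨N, hN⟩
    exact ⟨N, fun i j h => by rw [Pi.neg_apply, Pi.neg_apply, hN i j h, neg_zero]⟩

/-- The algebra `J(R)` of generalized Jacobi matrices over `R`. -/
def Jac (R : Type*) [Ring R] : Type _ := banded R

namespace Jac

instance : AddCommGroup (Jac R) := inferInstanceAs (AddCommGroup (banded R))

/-- The underlying matrix of an element of `J(R)`. -/
def mat (X : Jac R) : ZMat R := X.1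

@[ext] theorem ext {X Y : Jac R} (h : ∀ i j, X.mat i j = Y.mat i j) : X = Y :=
  Subtype.ext (funext fun i => funext fun j => h i j)

theorem band (X : Jac R) : ∃ N : ℕ, ∀ i j : ℤ, (N : ℤ) < |i - j| → X.mat i j = 0 := X.2

/-- The element of `J(R)` with a given banded matrix. -/
def mk (m : ZMat R) (h : ∃ N : ℕ, ∀ i j : ℤ, (N : ℤ) < |i - j| → m i j = 0) : Jac R := ⟨m, h⟩

@[simp] theorem mat_mk (m : ZMat R) (h) : (mk m h).mat = m := rfl
@[simp] theorem mat_zero : (0 : Jac R).mat = 0 := rfl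
@[simp] theorem mat_add (X Y : Jac R) : (X + Y).mat = X.mat + Y.mat := rfl
@[simp] theorem mat_neg (X : Jac R) : (-X).mat = -X.mat := rfl
@[simp] theorem mat_sub (X Y : Jac R) : (X - Y).mat = X.mat - Y.mat := rfl

theorem zmul_eq_sum (a b : ZMat R) (i j : ℤ) (s : Finset ℤ)
    (h : ∀ l, l ∉ s → a i l * b l j = 0) : zmul a b i j = ∑ l ∈ s, a i l * b l j := by
  refine finsum_eq_sum_of_support_subset _ fun l hl => ?_
  by_contra hs
  exact hl (h l hs)

noncomputable instance : Mul (Jac R) where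
  mul X Y := mk (zmul X.mat Y.mat) (by
    obtain ⟨N, hN⟩ := X.band
    obtain ⟨M, hM⟩ := Y.band
    refine ⟨N + M, fun i j h => ?_⟩
    rw [zmul_eq_sum _ _ i j ∅ fun l _ => ?_, Finset.sum_empty]
    by_cases h1 : (N : ℤ) < |i - l|
    · rw [hN i l h1, zero_mul]
    · rw [hM l j, mul_zero]
      push_cast at h
      have := abs_sub_le i l j
      omega)

instance : One (Jac R) where
  one := mk (fun i j => if i = j then 1 else 0) ⟨0, fun i j h => if_neg (by rintro rfl; simp at h)⟩

@[simp] theorem mat_mul (X Y : Jac R) : (X * Y).mat = zmul X.mat Y.mat := rfl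
@[simp] theorem mat_one : (1 : Jac R).mat = fun i j => if i = j then 1 else 0 := rfl

theorem mat_mul_apply (X Y : Jac R) (i j : ℤ) :
    (X * Y).mat i j = ∑ᶠ l, X.mat i l * Y.mat l j := rfl

theorem exists_sum (X Y : Jac R) (i j : ℤ) : ∃ s : Finset ℤ, ∀ t, s ⊆ t →
    (X * Y).mat i j = ∑ l ∈ t, X.mat i l * Y.mat l j := by
  obtain ⟨N, hN⟩ := X.band
  refine ⟨Finset.Icc (i - N) (i + N), fun t ht => zmul_eq_sum _ _ _ _ _ fun l hl => ?_⟩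
  rw [hN i l, zero_mul]
  by_contra h
  rw [not_lt, abs_le] at h
  exact hl (ht (Finset.mem_Icc.2 ⟨by omega, by omega⟩))

noncomputable instance : Ring (Jac R) :=
  { (inferInstance : AddCommGroup (Jac R)), (inferInstance : Mul (Jac R)),
    (inferInstance : One (Jac R)) with
    left_distrib := by
      intro X Y Z
      ext i j
      obtain ⟨s1, h1⟩ := exists_sum X (Y + Z) i j
      obtain ⟨s2, h2⟩ := exists_sum X Y i j
      obtain ⟨s3, h3⟩ := exists_sum X Z i j
      rw [h1 (s1 ∪ s2 ∪ s3) (by grind), mat_add (_ * _), Pi.add_apply, Pi.add_apply,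
        h2 (s1 ∪ s2 ∪ s3) (by grind), h3 (s1 ∪ s2 ∪ s3) (by grind), ← Finset.sum_add_distrib]
      simp [mul_add]
    right_distrib := by
      intro X Y Z
      ext i j
      obtain ⟨s1, h1⟩ := exists_sum (X + Y) Z i j
      obtain ⟨s2, h2⟩ := exists_sum X Z i j
      obtain ⟨s3, h3⟩ := exists_sum Y Z i j
      rw [h1 (s1 ∪ s2 ∪ s3) (by grind), mat_add (_ * _), Pi.add_apply, Pi.add_apply,
        h2 (s1 ∪ s2 ∪ s3) (by grind), h3 (s1 ∪ s2 ∪ s3) (by grind), ← Finset.sum_add_distrib]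
      simp [add_mul]
    zero_mul := by intro X; ext i j; simp [mat_mul_apply]
    mul_zero := by intro X; ext i j; simp [mat_mul_apply]
    one_mul := by
      intro X; ext i j
      rw [mat_mul_apply, finsum_eq_single _ i]
      · simp
      · intro l hl; simp [hl.symm]
    mul_one := by
      intro X; ext i j
      rw [mat_mul_apply, finsum_eq_single _ j]
      · simp
      · intro l hl; simp [hl]
    mul_assoc := by
      intro X Y Z
      ext i j
      obtain ⟨N, hN⟩ := X.band
      obtain ⟨M, hM⟩ := Y.band
      set s := Finset.Icc (i - N) (i + N) with hs
      set t := Finset.Icc (i - N - M) (i + N + M) with ht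
      have hX : ∀ m, m ∉ s → X.mat i m = 0 := by
        intro m hm
        refine hN i m ?_
        by_contra h
        rw [not_lt, abs_le] at h
        exact hm (Finset.mem_Icc.2 ⟨by omega, by omega⟩)
      have hY : ∀ m ∈ s, ∀ l, l ∉ t → Y.mat m l = 0 := by
        intro m hm l hl
        refine hM m l ?_
        by_contra h
        rw [not_lt, abs_le] at h
        rw [hs, Finset.mem_Icc] at hm
        exact hl (Finset.mem_Icc.2 ⟨by omega, by omega⟩)
      have hXY : ∀ l, (X * Y).mat i l = ∑ m ∈ s, X.mat i m * Y.mat m l := fun l =>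
        zmul_eq_sum _ _ _ _ _ fun m hm => by rw [hX m hm, zero_mul]
      have e1 : (X * Y * Z).mat i j = ∑ l ∈ t, (X * Y).mat i l * Z.mat l j := by
        refine zmul_eq_sum _ _ _ _ _ fun l hl => ?_
        rw [hXY, Finset.sum_eq_zero, zero_mul]
        intro m hm
        rw [hY m hm l hl, mul_zero]
      have e2 : (X * (Y * Z)).mat i j = ∑ m ∈ s, X.mat i m * (Y * Z).mat m j :=
        zmul_eq_sum _ _ _ _ _ fun m hm => by rw [hX m hm, zero_mul]
      have e3 : ∀ m ∈ s, (Y * Z).mat m j = ∑ l ∈ t, Y.mat m l * Z.mat l j := fun m hm =>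
        zmul_eq_sum _ _ _ _ _ fun l hl => by rw [hY m hm l hl, zero_mul]
      have e4 : (X * (Y * Z)).mat i j
          = ∑ m ∈ s, X.mat i m * ∑ l ∈ t, Y.mat m l * Z.mat l j := by
        rw [e2]; exact Finset.sum_congr rfl fun m hm => by rw [e3 m hm]
      rw [e1, e4]
      simp_rw [hXY, Finset.sum_mul, Finset.mul_sum, mul_assoc]
      exact Finset.sum_comm }

variable {k : Type*} [CommRing k] [Algebra k R]

instance : SMul k (Jac R) where
  smul c X := mk (c • X.mat) (by
    obtain ⟨N, hN⟩ := X.band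
    exact ⟨N, fun i j h => by rw [Pi.smul_apply, Pi.smul_apply, hN i j h, smul_zero]⟩)

@[simp] theorem mat_smul (c : k) (X : Jac R) : (c • X).mat = c • X.mat := rfl

instance : Module k (Jac R) where
  one_smul X := by ext i j; simp
  mul_smul a b X := by ext i j; simp [mul_smul]
  smul_zero a := by ext i j; simp
  smul_add a X Y := by ext i j; simp
  add_smul a b X := by ext i j; simp [add_smul]
  zero_smul X := by ext i j; simp

noncomputable instance : Algebra k (Jac R) :=
  Algebra.ofModule
    (by
      intro c X Y; ext i j
      obtain ⟨s1, h1⟩ := exists_sum (c • X) Y i j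
      obtain ⟨s2, h2⟩ := exists_sum X Y i j
      rw [h1 (s1 ∪ s2) (by grind), mat_smul c (_ * _), Pi.smul_apply, Pi.smul_apply, h2 (s1 ∪ s2) (by grind),
        Finset.smul_sum]
      simp)
    (by
      intro c X Y; ext i j
      obtain ⟨s1, h1⟩ := exists_sum X (c • Y) i j
      obtain ⟨s2, h2⟩ := exists_sum X Y i j
      rw [h1 (s1 ∪ s2) (by grind), mat_smul c (_ * _), Pi.smul_apply, Pi.smul_apply, h2 (s1 ∪ s2) (by grind),
        Finset.smul_sum]
      simp)

/-- The matrix `E_{i,j}(r)`. -/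
def single (i j : ℤ) (r : R) : Jac R :=
  mk (fun a b => if a = i ∧ b = j then r else 0) ⟨(|i - j|).toNat, fun a b h => if_neg (by
    rintro ⟨rfl, rfl⟩
    simp at h)⟩

end Jac

end Matrices

/-! ## The Lie algebras `𝔬_J^odd(R)`, `𝔰𝔭_J(R)`, `𝔬_J^even(R)` -/

section Involutions

variable {k R : Type*} [CommRing k] [Ring R] [Algebra k R]

/-- The transpose `ᵗX` of a matrix over an algebra with anti-involution, `ᵗ(E_{i,j}(r)) =
E_{j,i}(r̄)`. -/
def btranspose (bar : AntiInvolution k R) (X : ZMat R) : ZMat R := fun i j => bar (X j i)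

/-- `X ↦ ε J ᵗX J` with `J = ∑ i, s(i) E_{i, l - i}`. -/
noncomputable def tauMat (bar : AntiInvolution k R) (ε : ℤˣ) (l : ℤ) (s : ℤ → ℤˣ)
    (X : ZMat R) : ZMat R :=
  (ε : ℤ) • zmul (zmul (antidiag R l s) (btranspose bar X)) (antidiag R l s)

theorem tauMat_apply (bar : AntiInvolution k R) (ε : ℤˣ) (l : ℤ) (s : ℤ → ℤˣ)
    (X : ZMat R) (i j : ℤ) :
    tauMat bar ε l s X i j = ((ε * s i * s (l - j) : ℤˣ) : ℤ) • bar (X (l - j) (l - i)) := by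
  rw [tauMat, Pi.smul_apply, Pi.smul_apply, zmul_antidiag_right, zmul_antidiag_left, btranspose]
  rw [(Int.cast_commute ((s (l - j) : ℤˣ) : ℤ) _).symm.eq, zsmul_eq_mul, zsmul_eq_mul]
  push_cast
  simp only [← mul_assoc]
  rw [mul_assoc (((ε : ℤˣ) : ℤ) : R), (Int.cast_commute ((s (l - j) : ℤˣ) : ℤ) _).eq, ← mul_assoc]

/-- The map `X ↦ ε J ᵗX J` as an anti-involution of `J(R)`, under the condition `h` on the signs. -/
noncomputable def tauOf (bar : AntiInvolution k R) (ε : ℤˣ) (l : ℤ) (s : ℤ → ℤˣ)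
    (h : ∀ i, ε * s (l - i) = s i) : AntiInvolution k (Jac R) where
  toFun X := Jac.mk (tauMat bar ε l s X.mat) (by
    obtain ⟨N, hN⟩ := X.band
    refine ⟨N, fun i j hij => ?_⟩
    rw [tauMat_apply, hN, AntiInvolution.map_zero, smul_zero]
    have : l - j - (l - i) = i - j := by ring
    rwa [this])
  map_add' X Y := by ext i j; simp [tauMat_apply]
  map_smul' c X := by
    ext i j
    simp [tauMat_apply, smul_comm]
  map_mul' X Y := by
    ext i j
    simp only [Jac.mat_mk, tauMat_apply, Jac.mat_mul_apply, AntiInvolution.map_finsum]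
    have key : ∀ (u : ℤˣ) (f : ℤ → R), (u : ℤ) • (∑ᶠ m, f m) = ∑ᶠ m, (u : ℤ) • f m := by
      intro u f
      rcases Int.units_eq_one_or u with hu | hu <;> simp [hu, finsum_neg_distrib]
    rw [← finsum_comp_equiv (Equiv.subLeft l), key]
    refine finsum_congr fun m => ?_
    simp only [Equiv.subLeft_apply, AntiInvolution.map_mul]
    rw [smul_mul_smul_comm, ← Units.val_mul]
    have e : ε * s i * s (l - m) * (ε * s m * s (l - j)) = ε * s i * s (l - j) := by
      have h2 : ε * s (l - m) * s m = 1 := by rw [h m, Int.units_mul_self]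
      calc _ = (ε * s i * s (l - j)) * (ε * s (l - m) * s m) := by ac_rfl
        _ = _ := by rw [h2, mul_one]
    rw [e]
  invol' X := by
    ext i j
    simp only [Jac.mat_mk, tauMat_apply]
    have e : ε * s i * s (l - j) * (ε * s (l - j) * s (l - (l - i))) = 1 := by
      have : l - (l - i) = i := by ring
      rw [this]
      calc _ = (ε * ε) * (s i * s i) * (s (l - j) * s (l - j)) := by ac_rfl
        _ = _ := by simp [Int.units_mul_self]
    rw [LinearMap.map_smul_of_tower, AntiInvolution.invol, smul_smul, ← Units.val_mul, e]
    simp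

/-- The anti-involution `τ_l(X) = (-1)^l J_l ᵗX J_l` of `J(R)`, where
`J_l = ∑ i, (-1)^i E_{i, l - i}`. -/
noncomputable def tau (bar : AntiInvolution k R) (l : ℤ) : AntiInvolution k (Jac R) :=
  tauOf bar l.negOnePow l Int.negOnePow (fun i => by
    rw [← Int.negOnePow_add, show l + (l - i) = 2 * l - i by ring, Int.negOnePow_sub,
      Int.negOnePow_two_mul, one_mul])

/-- The anti-involution `τ_l^s(X) = J_l^s ᵗX J_l^s` of `J(R)`, where
`J_l^s = ∑ i, E_{i, l - i}`. -/
noncomputable def tauS (bar : AntiInvolution k R) (l : ℤ) : AntiInvolution k (Jac R) :=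
  tauOf bar 1 l (fun _ => 1) (fun _ => rfl)

theorem tau_apply (bar : AntiInvolution k R) (l : ℤ) (X : Jac R) (i j : ℤ) :
    (tau bar l X).mat i j = ((i + j).negOnePow : ℤ) • bar (X.mat (l - j) (l - i)) := by
  change tauMat bar l.negOnePow l Int.negOnePow X.mat i j = _
  rw [tauMat_apply, ← Int.negOnePow_add, ← Int.negOnePow_add,
    show l + i + (l - j) = 2 * (l - j) + (i + j) by ring, Int.negOnePow_add,
    Int.negOnePow_two_mul, one_mul]

theorem tauS_apply (bar : AntiInvolution k R) (l : ℤ) (X : Jac R) (i j : ℤ) :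
    (tauS bar l X).mat i j = bar (X.mat (l - j) (l - i)) := by
  change tauMat bar 1 l (fun _ => 1) X.mat i j = _
  rw [tauMat_apply]; simp

/-- `𝔬_J^odd(R) = {X ∈ 𝔤J(R) | τ_0^s(X) = -X}`. -/
noncomputable def oJOdd (bar : AntiInvolution k R) : LieSubalgebra k (Jac R) := (tauS bar 0).skew

/-- `𝔰𝔭_J(R) = {X ∈ 𝔤J(R) | τ_{-1}(X) = -X}`. -/
noncomputable def spJ (bar : AntiInvolution k R) : LieSubalgebra k (Jac R) := (tau bar (-1)).skew

/-- `𝔬_J^even(R) = {X ∈ 𝔤J(R) | τ_{-1}^s(X) = -X}`. -/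
noncomputable def oJEven (bar : AntiInvolution k R) : LieSubalgebra k (Jac R) :=
  (tauS bar (-1)).skew

/-- The anti-involution `*` of `J(R)` with `E_{i,j}(r)^* = E_{-j,-i}(r̄)`; it coincides with
`τ_0^s`. -/
noncomputable def starJ (bar : AntiInvolution k R) : AntiInvolution k (Jac R) := tauS bar 0

theorem starJ_apply (bar : AntiInvolution k R) (X : Jac R) (i j : ℤ) :
    (starJ bar X).mat i j = bar (X.mat (-j) (-i)) := by
  rw [starJ, tauS_apply, zero_sub, zero_sub]

theorem starJ_single (bar : AntiInvolution k R) (i j : ℤ) (r : R) :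
    starJ bar (Jac.single i j r) = Jac.single (-j) (-i) (bar r) := by
  ext a b
  rw [starJ_apply]
  simp only [Jac.single, Jac.mat_mk]
  have : (-b = i ∧ -a = j) ↔ (a = -j ∧ b = -i) := by omega
  by_cases h : a = -j ∧ b = -i
  · rw [if_pos h, if_pos (this.2 h)]
  · rw [if_neg h, if_neg (this.not.2 h), AntiInvolution.map_zero]

end Involutions

/-! ## The Lie algebras `𝔬_{2n+1}(A)`, `𝔰𝔭_{2n}(A)`, `𝔬_{2n}(A)` and their stable limits -/

section Classical

variable {k A : Type*} [CommRing k] [Ring A] [Algebra k A]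

/-- The Lie subalgebra `{X | ᵗX F + F X = 0}` of the Lie algebra of matrices with rows and columns
indexed by `I` and entries in `A`, where `ᵗX` is the transpose of `X` with `bar` applied to all
entries. -/
def formSkew (bar : AntiInvolution k A) (I : Finset ℤ) (F : Matrix I I A) :
    LieSubalgebra k (Matrix I I A) where
  carrier := {X | (X.map bar).transpose * F + F * X = 0}
  add_mem' := by
    intro X Y (hX : (X.map bar).transpose * F + F * X = 0)
      (hY : (Y.map bar).transpose * F + F * Y = 0)
    change ((X + Y).map bar).transpose * F + F * (X + Y) = 0
    have e : ((X + Y).map bar).transpose = (X.map bar).transpose + (Y.map bar).transpose := by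
      ext i j; simp
    rw [e, add_mul, mul_add, add_add_add_comm, hX, hY, add_zero]
  zero_mem' := by
    change ((0 : Matrix I I A).map bar).transpose * F + F * 0 = 0
    have e : ((0 : Matrix I I A).map bar).transpose = 0 := by ext i j; simp
    rw [e]; simp
  smul_mem' := by
    intro c X (hX : (X.map bar).transpose * F + F * X = 0)
    change ((c • X).map bar).transpose * F + F * (c • X) = 0
    have e : ((c • X).map bar).transpose = c • (X.map bar).transpose := by ext i j; simp
    rw [e, smul_mul_assoc, mul_smul_comm, ← smul_add, hX, smul_zero]
  lie_mem' := by
    intro X Y (hX : (X.map bar).transpose * F + F * X = 0)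
      (hY : (Y.map bar).transpose * F + F * Y = 0)
    change (⁅X, Y⁆.map bar).transpose * F + F * ⁅X, Y⁆ = 0
    have e : (⁅X, Y⁆.map bar).transpose = (Y.map bar).transpose * (X.map bar).transpose
        - (X.map bar).transpose * (Y.map bar).transpose := by
      ext i j
      simp [Ring.lie_def, Matrix.mul_apply, AntiInvolution.map_mul]
    rw [add_eq_zero_iff_eq_neg] at hX hY
    rw [e, Ring.lie_def, sub_mul, mul_assoc, mul_assoc, hX, hY, mul_neg, mul_neg, ← mul_assoc,
      ← mul_assoc, hX, hY]
    noncomm_ring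

/-- The restriction of the matrix `∑ i, s(i) e_{i, l - i}` to the index set `I`. -/
def formMat (A : Type*) [Ring A] (I : Finset ℤ) (l : ℤ) (s : ℤ → ℤˣ) : Matrix I I A :=
  Matrix.of fun i j => antidiag A l s i j

/-- `I_{2n+1} = {-n, …, n}`. -/
noncomputable def idxOdd (n : ℕ) : Finset ℤ := Finset.Icc (-(n : ℤ)) n

/-- `I_{2n} = {-n, …, n - 1}`. -/
noncomputable def idxEven (n : ℕ) : Finset ℤ := Finset.Ico (-(n : ℤ)) n

/-- `𝔬_{2n+1}(A)`, for the form `J_n^B = ∑ i, e_{i, -i}`. -/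
noncomputable def oFinOdd (bar : AntiInvolution k A) (n : ℕ) :
    LieSubalgebra k (Matrix (idxOdd n) (idxOdd n) A) :=
  formSkew bar (idxOdd n) (formMat A (idxOdd n) 0 (fun _ => 1))

/-- `𝔰𝔭_{2n}(A)`, for the form `J_n^C = ∑ i, (-1)^i e_{i, -i-1}`. -/
noncomputable def spFin (bar : AntiInvolution k A) (n : ℕ) :
    LieSubalgebra k (Matrix (idxEven n) (idxEven n) A) :=
  formSkew bar (idxEven n) (formMat A (idxEven n) (-1) Int.negOnePow)

/-- `𝔬_{2n}(A)`, for the form `J_n^D = ∑ i, e_{i, -i-1}`. -/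
noncomputable def oFinEven (bar : AntiInvolution k A) (n : ℕ) :
    LieSubalgebra k (Matrix (idxEven n) (idxEven n) A) :=
  formSkew bar (idxEven n) (formMat A (idxEven n) (-1) (fun _ => 1))

/-- The matrix indexed by `ℤ` that extends a matrix indexed by `I` by zero. -/
def zeroExt (I : Finset ℤ) (X : Matrix I I A) : ZMat A :=
  fun i j => if h : i ∈ I ∧ j ∈ I then X ⟨i, h.1⟩ ⟨j, h.2⟩ else 0

theorem zeroExt_coe (I : Finset ℤ) (X : Matrix I I A) (i j : I) : zeroExt I X i j = X i j := by
  simp [zeroExt]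

theorem zeroExt_of_not (I : Finset ℤ) (X : Matrix I I A) {i j : ℤ} (h : ¬ (i ∈ I ∧ j ∈ I)) :
    zeroExt I X i j = 0 := dif_neg h

theorem zeroExt_band (I : Finset ℤ) (X : Matrix I I A) :
    ∃ N : ℕ, ∀ i j : ℤ, (N : ℤ) < |i - j| → zeroExt I X i j = 0 := by
  refine ⟨(∑ i ∈ I, |i|).toNat + (∑ i ∈ I, |i|).toNat, fun i j h => zeroExt_of_not I X ?_⟩
  rintro ⟨hi, hj⟩
  have h1 := Finset.single_le_sum (f := fun i : ℤ => |i|) (fun i _ => abs_nonneg i) hi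
  have h2 := Finset.single_le_sum (f := fun i : ℤ => |i|) (fun i _ => abs_nonneg i) hj
  have h3 := abs_sub i j
  have h4 := Int.self_le_toNat (∑ i ∈ I, |i|)
  push_cast at h
  linarith

/-- The inclusion of the Lie algebra of matrices indexed by `I` into the Lie algebra of banded
matrices indexed by `ℤ`, by extension by zero. The images of these inclusions are contained in, and
exhaust, the Lie algebra `𝔤𝔩(A)` of matrices indexed by `ℤ` with finitely many nonzero entries. -/
def incl (k : Type*) [CommRing k] [Algebra k A] (I : Finset ℤ) : Matrix I I A →ₗ⁅k⁆ Jac A where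
  toFun X := Jac.mk (zeroExt I X) (zeroExt_band I X)
  map_add' X Y := by
    ext i j
    by_cases h : i ∈ I ∧ j ∈ I <;> simp [zeroExt, h]
  map_smul' c X := by
    ext i j
    by_cases h : i ∈ I ∧ j ∈ I <;> simp [zeroExt, h]
  map_lie' := by
    intro X Y
    have key : ∀ X Y : Matrix I I A, Jac.mk (zeroExt I (X * Y)) (zeroExt_band I _)
        = Jac.mk (zeroExt I X) (zeroExt_band I X) * Jac.mk (zeroExt I Y) (zeroExt_band I Y) := by
      intro X Y
      ext i j
      rw [Jac.mat_mul, Jac.zmul_eq_sum _ _ i j I]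
      · by_cases h : i ∈ I ∧ j ∈ I
        · simp only [Jac.mat_mk]
          rw [← Finset.sum_coe_sort]
          simp only [zeroExt, h, and_self, and_true, true_and, Finset.coe_mem, dite_true,
            Matrix.mul_apply]
        · rw [Jac.mat_mk, zeroExt_of_not I _ h]
          symm
          refine Finset.sum_eq_zero fun l hl => ?_
          rw [not_and_or] at h
          rcases h with h | h
          · rw [Jac.mat_mk, zeroExt_of_not I X (by tauto), zero_mul]
          · rw [Jac.mat_mk, Jac.mat_mk, zeroExt_of_not I Y (by tauto), mul_zero]
      · intro l hl
        rw [Jac.mat_mk, zeroExt_of_not I X (by tauto), zero_mul]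
    have sub : ∀ X Y : Matrix I I A, Jac.mk (zeroExt I (X - Y)) (zeroExt_band I _)
        = Jac.mk (zeroExt I X) (zeroExt_band I X) - Jac.mk (zeroExt I Y) (zeroExt_band I Y) := by
      intro X Y
      ext i j
      by_cases h : i ∈ I ∧ j ∈ I <;> simp [zeroExt, h]
    change Jac.mk (zeroExt I ⁅X, Y⁆) (zeroExt_band I _) = _
    simp only [Ring.lie_def]
    rw [sub, key, key]

theorem incl_mat (I : Finset ℤ) (X : Matrix I I A) : (incl k I X).mat = zeroExt I X := rfl

theorem mem_formSkew_iff (bar : AntiInvolution k A) (I : Finset ℤ) (l : ℤ) (s : ℤ → ℤˣ)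
    (hI : ∀ i ∈ I, l - i ∈ I) (X : Matrix I I A) :
    X ∈ formSkew bar I (formMat A I l s) ↔ ∀ i j : ℤ,
      bar (zeroExt I X (l - j) i) * ((s (l - j) : ℤ) : A)
        + ((s i : ℤ) : A) * zeroExt I X (l - i) j = 0 := by
  have hI' : ∀ i, l - i ∈ I ↔ i ∈ I := fun i =>
    ⟨fun h => by simpa using hI _ h, hI i⟩
  have entry : ∀ i j : I, ((X.map bar).transpose * formMat A I l s + formMat A I l s * X) i j
      = bar (zeroExt I X (l - j) i) * ((s (l - j) : ℤ) : A)
        + ((s i : ℤ) : A) * zeroExt I X (l - i) j := by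
    intro i j
    rw [Matrix.add_apply, Matrix.mul_apply, Matrix.mul_apply]
    congr 1
    · rw [Finset.sum_eq_single ⟨l - j, hI j j.2⟩]
      · simp [formMat, antidiag, zeroExt, hI j j.2]
      · intro b _ hb
        have : ¬ ((j : ℤ) = l - b) := fun h => hb (Subtype.ext (by simp [h]))
        simp [formMat, antidiag, this]
      · simp
    · rw [Finset.sum_eq_single ⟨l - i, hI i i.2⟩]
      · simp [formMat, antidiag, zeroExt, hI i i.2]
      · intro b _ hb
        have : ¬ ((b : ℤ) = l - i) := fun h => hb (Subtype.ext h)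
        simp [formMat, antidiag, this]
      · simp
  constructor
  · intro (hX : (X.map bar).transpose * formMat A I l s + formMat A I l s * X = 0) i j
    by_cases h : i ∈ I ∧ j ∈ I
    · rw [← entry ⟨i, h.1⟩ ⟨j, h.2⟩, hX]; rfl
    · rw [zeroExt_of_not I X (by rw [hI']; tauto), zeroExt_of_not I X (by rw [hI']; tauto)]
      simp
  · intro h
    change (X.map bar).transpose * formMat A I l s + formMat A I l s * X = 0
    ext i j
    rw [entry]; exact h i j

/-- The inclusion of a smaller index set maps the smaller Lie algebra into the larger one. -/
theorem map_formSkew_le (bar : AntiInvolution k A) (l : ℤ) (s : ℤ → ℤˣ) {I I' : Finset ℤ}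
    (hI : ∀ i ∈ I, l - i ∈ I) (hI' : ∀ i ∈ I', l - i ∈ I') (hII' : I ⊆ I') :
    (formSkew bar I (formMat A I l s)).map (incl k I)
      ≤ (formSkew bar I' (formMat A I' l s)).map (incl k I') := by
  intro Z hZ
  rw [LieSubalgebra.mem_map] at hZ ⊢
  obtain ⟨X, hX, rfl⟩ := hZ
  have e : zeroExt I' (Matrix.of fun i j : I' => zeroExt I X i j) = zeroExt I X := by
    funext i j
    by_cases h : i ∈ I' ∧ j ∈ I'
    · simp [zeroExt, h]
    · rw [zeroExt_of_not _ _ h, zeroExt_of_not]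
      exact fun h' => h ⟨hII' h'.1, hII' h'.2⟩
  refine ⟨Matrix.of fun i j : I' => zeroExt I X i j, ?_, ?_⟩
  · rw [mem_formSkew_iff bar I' l s hI', e]
    exact (mem_formSkew_iff bar I l s hI X).1 hX
  · ext i j
    rw [incl_mat, e, incl_mat]

/-- The union of an increasing sequence of Lie subalgebras. -/
def unionLie {L : Type*} [LieRing L] [LieAlgebra k L] (S : ℕ → LieSubalgebra k L)
    (hS : Monotone S) : LieSubalgebra k L where
  carrier := {x | ∃ n, x ∈ S n}
  add_mem' := by
    rintro x y ⟨n, hn⟩ ⟨m, hm⟩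
    exact ⟨max n m, (S _).add_mem (hS (le_max_left _ _) hn) (hS (le_max_right _ _) hm)⟩
  zero_mem' := ⟨0, (S 0).zero_mem⟩
  smul_mem' := by
    rintro c x ⟨n, hn⟩
    exact ⟨n, (S n).smul_mem c hn⟩
  lie_mem' := by
    rintro x y ⟨n, hn⟩ ⟨m, hm⟩
    exact ⟨max n m, (S _).lie_mem (hS (le_max_left _ _) hn) (hS (le_max_right _ _) hm)⟩

/-- The stable limit `𝔬_odd(A)`: the union of the Lie algebras `𝔬_{2n+1}(A)` along the inclusions
induced by `I_{2n+1} ⊆ I_{2n+3}`. -/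
noncomputable def oOdd (bar : AntiInvolution k A) : LieSubalgebra k (Jac A) :=
  unionLie (fun n => (oFinOdd bar n).map (incl k (idxOdd n))) (fun n m h =>
    map_formSkew_le bar 0 _ (by intro i; simp only [idxOdd, Finset.mem_Icc]; omega)
      (by intro i; simp only [idxOdd, Finset.mem_Icc]; omega)
      (by intro i; simp only [idxOdd, Finset.mem_Icc]; omega))

/-- The stable limit `𝔰𝔭(A)`: the union of the Lie algebras `𝔰𝔭_{2n}(A)` along the inclusions
induced by `I_{2n} ⊆ I_{2n+2}`. -/
noncomputable def spStable (bar : AntiInvolution k A) : LieSubalgebra k (Jac A) :=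
  unionLie (fun n => (spFin bar n).map (incl k (idxEven n))) (fun n m h =>
    map_formSkew_le bar (-1) _ (by intro i; simp only [idxEven, Finset.mem_Ico]; omega)
      (by intro i; simp only [idxEven, Finset.mem_Ico]; omega)
      (by intro i; simp only [idxEven, Finset.mem_Ico]; omega))

/-- The stable limit `𝔬_even(A)`: the union of the Lie algebras `𝔬_{2n}(A)` along the inclusions
induced by `I_{2n} ⊆ I_{2n+2}`. -/
noncomputable def oEven (bar : AntiInvolution k A) : LieSubalgebra k (Jac A) :=
  unionLie (fun n => (oFinEven bar n).map (incl k (idxEven n))) (fun n m h =>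
    map_formSkew_le bar (-1) _ (by intro i; simp only [idxEven, Finset.mem_Ico]; omega)
      (by intro i; simp only [idxEven, Finset.mem_Ico]; omega)
      (by intro i; simp only [idxEven, Finset.mem_Ico]; omega))

end Classical

end JacobiLie

namespace JacobiLie

attribute [local instance 100] LieRing.ofAssociativeRing

/-! ## Functoriality of Lie algebra homology -/

section Functoriality

variable {k : Type*} [CommRing k] {L L' : Type*} [LieRing L] [LieAlgebra k L]
  [LieRing L'] [LieAlgebra k L']

/-! Two facts are combined. The first is that a banded matrix over `R` is the same thing as a finite
matrix over `J(R)`. Fix a level `N`, put `d = 2N + 1 + l`, and write each integer as `d * a + i`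
with `-N ≤ i ≤ N + l`; the residue `i` indexes blocks and `a` indexes entries of a block. The
reflection `v ↦ l - v` becomes `i ↦ l - i` on blocks and `a ↦ -a` inside them, and the latter is the
anti-involution `*` of `J(R)`. Hence the skew banded matrices over `R` are isomorphic, as a Lie
algebra, to the level `N` classical Lie algebra over `J(R)`, for every `N`
(`nonempty_skew_lieEquiv_levelLie`).

The second fact is homological stability (`nonempty_lieHomology_levelLie_equiv`): over any algebra
`A` with anti-involution, the homology in degree `q` of level `q + 1` is already that of the stable
limit. The isomorphism of the theorem is therefore built separately in each degree `q`, with `N = q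
+ 1`.

Stability rests on the finite group of signed permutations of the index set. It is generated by
reflections `w = 1 - 2 (e + σ e)` with `e`, `σ e` orthogonal idempotents. Conjugation by `w` is
`(-1)^{ad x}` for the skew element `x = e - σ e`, and it acts trivially on homology because `ad x`
does (`actsTrivially_reflection`). In characteristic zero every cycle is thus homologous to its
average over the group.

It remains to compare invariant chains at levels `n` and `n + 1` by means of the larger average.
This comparison is injective in all degrees: deleting the top row and column with their mirror
images turns the vanishing of an average into a relation `y + ∑ p y = 0` with commuting idempotents
`p` (`eq_zero_of_avg_succ_eq_zero`). It is surjective in degrees `q ≤ n`: among `n + 1` index pairs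
some pair is used at most once by `q` homogeneous factors; if once, a sign change kills the average,
and if never, a transposition moves the chain down to level `n` (`exists_avg_succ_eq`). -/

theorem map_adExt (f : L →ₗ⁅k⁆ L') (x : L) (w : ExteriorAlgebra k L) :
    ExteriorAlgebra.map (f : L →ₗ[k] L') (adExt k L x w)
      = adExt k L' (f x) (ExteriorAlgebra.map (f : L →ₗ[k] L') w) := by
  induction w using ext_induction k L with
  | h1 => simp
  | hs c w h => simp [h]
  | ha v w h1 h2 => simp only [map_add, h1, h2]
  | hm y w h => simp [adExt_ι_mul, h]

theorem map_ceD (f : L →ₗ⁅k⁆ L') (w : ExteriorAlgebra k L) :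
    ExteriorAlgebra.map (f : L →ₗ[k] L') (ceD k L w)
      = ceD k L' (ExteriorAlgebra.map (f : L →ₗ[k] L') w) := by
  induction w using ext_induction k L with
  | h1 => simp
  | hs c w h => simp [h]
  | ha v w h1 h2 => simp only [map_add, h1, h2]
  | hm y w h => simp [ceD_ι_mul, map_adExt, h]

theorem map_mem_exteriorPower (f : L →ₗ[k] L') (n : ℕ) {w : ExteriorAlgebra k L}
    (hw : w ∈ ⋀[k]^n L) : ExteriorAlgebra.map f w ∈ ⋀[k]^n L' := by
  rw [← ExteriorAlgebra.ιMulti_span_fixedDegree] at hw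
  induction hw using Submodule.span_induction with
  | zero => simp
  | add x y _ _ hx hy => rw [map_add]; exact add_mem hx hy
  | smul c x _ hx => rw [map_smul]; exact Submodule.smul_mem _ _ hx
  | mem x hx =>
    obtain ⟨v, rfl⟩ := hx
    rw [ExteriorAlgebra.map_apply_ιMulti]
    exact ExteriorAlgebra.ιMulti_range k n ⟨_, rfl⟩

/-- The map of cycles induced by a homomorphism of Lie algebras. -/
noncomputable def ceCyclesMap (f : L →ₗ⁅k⁆ L') (n : ℕ) : ceCycles k L n →ₗ[k] ceCycles k L' n :=
  (ExteriorAlgebra.map (f : L →ₗ[k] L')).toLinearMap.restrict (by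
    rintro w ⟨h1, h2⟩
    refine ⟨map_mem_exteriorPower _ n h1, ?_⟩
    change ceD k L w = 0 at h2
    change ceD k L' (ExteriorAlgebra.map (f : L →ₗ[k] L') w) = 0
    rw [← map_ceD, h2, map_zero])

@[simp] theorem coe_ceCyclesMap (f : L →ₗ⁅k⁆ L') (n : ℕ) (z : ceCycles k L n) :
    (ceCyclesMap f n z : ExteriorAlgebra k L') = ExteriorAlgebra.map (f : L →ₗ[k] L') z := rfl

theorem map_mem_ceBoundaries (f : L →ₗ⁅k⁆ L') (n : ℕ) {z : ExteriorAlgebra k L}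
    (hz : z ∈ ceBoundaries k L n) :
    ExteriorAlgebra.map (f : L →ₗ[k] L') z ∈ ceBoundaries k L' n := by
  obtain ⟨w, hw, rfl⟩ := hz
  exact ⟨_, map_mem_exteriorPower _ _ hw, (map_ceD f w).symm⟩

theorem ceBoundaries_le_comap (f : L →ₗ⁅k⁆ L') (n : ℕ) :
    (ceBoundaries k L n).submoduleOf (ceCycles k L n) ≤
      ((ceBoundaries k L' n).submoduleOf (ceCycles k L' n)).comap (ceCyclesMap f n) :=
  fun z hz => map_mem_ceBoundaries f n (z := z) hz

/-- The map on homology induced by a homomorphism of Lie algebras. -/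
noncomputable def lieHomologyMap (f : L →ₗ⁅k⁆ L') (n : ℕ) :
    LieHomology k L n →ₗ[k] LieHomology k L' n :=
  Submodule.mapQ _ _ (ceCyclesMap f n) (ceBoundaries_le_comap f n)

/-- Bijectivity on homology is spelled out on representatives, so that the stability argument can be
carried out with chains and never with classes. -/
theorem nonempty_lieHomology_equiv (f : L →ₗ⁅k⁆ L') (n : ℕ)
    (hinj : ∀ y ∈ ceCycles k L n, ExteriorAlgebra.map (f : L →ₗ[k] L') y ∈ ceBoundaries k L' n →
      y ∈ ceBoundaries k L n)
    (hsurj : ∀ z ∈ ceCycles k L' n, ∃ y ∈ ceCycles k L n,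
      z - ExteriorAlgebra.map (f : L →ₗ[k] L') y ∈ ceBoundaries k L' n) :
    Nonempty (LieHomology k L n ≃ₗ[k] LieHomology k L' n) := by
  refine ⟨LinearEquiv.ofBijective (lieHomologyMap f n) ⟨?_, ?_⟩⟩
  · rw [← LinearMap.ker_eq_bot, LinearMap.ker_eq_bot']
    intro q hq
    obtain ⟨y, rfl⟩ := Submodule.Quotient.mk_surjective _ q
    rw [lieHomologyMap, Submodule.mapQ_apply, Submodule.Quotient.mk_eq_zero] at hq
    rw [Submodule.Quotient.mk_eq_zero]
    exact hinj y y.2 hq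
  · intro q
    obtain ⟨z, rfl⟩ := Submodule.Quotient.mk_surjective _ q
    obtain ⟨y, hy, h⟩ := hsurj z z.2
    refine ⟨Submodule.Quotient.mk ⟨y, hy⟩, ?_⟩
    rw [lieHomologyMap, Submodule.mapQ_apply, eq_comm, Submodule.Quotient.eq]
    exact h

theorem nonempty_lieHomology_equiv_of_lieEquiv (f : L ≃ₗ⁅k⁆ L') (n : ℕ) :
    Nonempty (LieHomology k L n ≃ₗ[k] LieHomology k L' n) := by
  have e1 : ∀ y, ExteriorAlgebra.map (f.symm.toLieHom : L' →ₗ[k] L)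
      (ExteriorAlgebra.map (f.toLieHom : L →ₗ[k] L') y) = y := by
    intro y
    rw [← AlgHom.comp_apply, ExteriorAlgebra.map_comp_map]
    have : (f.symm.toLieHom : L' →ₗ[k] L) ∘ₗ (f.toLieHom : L →ₗ[k] L') = LinearMap.id := by
      ext x; exact f.symm_apply_apply x
    rw [this, ExteriorAlgebra.map_id]; rfl
  have e2 : ∀ y, ExteriorAlgebra.map (f.toLieHom : L →ₗ[k] L')
      (ExteriorAlgebra.map (f.symm.toLieHom : L' →ₗ[k] L) y) = y := by
    intro y
    rw [← AlgHom.comp_apply, ExteriorAlgebra.map_comp_map]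
    have : (f.toLieHom : L →ₗ[k] L') ∘ₗ (f.symm.toLieHom : L' →ₗ[k] L) = LinearMap.id := by
      ext x; exact f.apply_symm_apply x
    rw [this, ExteriorAlgebra.map_id]; rfl
  refine nonempty_lieHomology_equiv f.toLieHom n ?_ ?_
  · intro y _ hy
    rw [← e1 y]
    exact map_mem_ceBoundaries f.symm.toLieHom n hy
  · intro z hz
    refine ⟨_, (ceCyclesMap f.symm.toLieHom n ⟨z, hz⟩).2, ?_⟩
    rw [coe_ceCyclesMap, e2, sub_self]
    exact zero_mem _

end Functoriality

/-! ## The exterior powers of a subspace inside the exterior algebra -/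

section ExtSub

variable {k : Type*} [CommRing k] {M N : Type*} [AddCommGroup M] [Module k M]
  [AddCommGroup N] [Module k N]

/-- The span of the products `v₁ ∧ ⋯ ∧ vₙ` of elements of a submodule. -/
noncomputable def extSub (V : Submodule k M) (n : ℕ) : Submodule k (ExteriorAlgebra k M) :=
  (V.map (ExteriorAlgebra.ι k)) ^ n

theorem extSub_mono {V W : Submodule k M} (h : V ≤ W) (n : ℕ) : extSub V n ≤ extSub W n :=
  pow_le_pow_left' (Submodule.map_mono h) n

theorem ι_mul_mem_extSub {V : Submodule k M} {x : M} (hx : x ∈ V) {n : ℕ}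
    {w : ExteriorAlgebra k M} (hw : w ∈ extSub V n) :
    ExteriorAlgebra.ι k x * w ∈ extSub V (n + 1) := by
  rw [extSub, pow_succ']
  exact Submodule.mul_mem_mul ⟨x, hx, rfl⟩ hw

theorem ιMulti_mem_extSub {V : Submodule k M} {n : ℕ} {v : Fin n → M} (hv : ∀ i, v i ∈ V) :
    ExteriorAlgebra.ιMulti k n v ∈ extSub V n := by
  induction n with
  | zero =>
    rw [ExteriorAlgebra.ιMulti_zero_apply, extSub, pow_zero]
    exact Submodule.one_le.1 le_rfl
  | succ n ih =>
    rw [ExteriorAlgebra.ιMulti_succ_apply]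
    exact ι_mul_mem_extSub (hv 0) (ih fun i => hv i.succ)

theorem extSub_le_span {V : Submodule k M} {S : Set M} (h : V ≤ Submodule.span k S) (n : ℕ) :
    extSub V n ≤ Submodule.span k {w | ∃ v : Fin n → M, (∀ i, v i ∈ S) ∧
      ExteriorAlgebra.ιMulti k n v = w} := by
  refine (extSub_mono h n).trans ?_
  rw [extSub, Submodule.map_span, Submodule.span_pow]
  refine Submodule.span_mono ?_
  intro w hw
  obtain ⟨f, rfl⟩ := Set.mem_pow.1 hw
  choose v hv hvf using fun i => (f i).2
  refine ⟨v, hv, ?_⟩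
  rw [ExteriorAlgebra.ιMulti_apply]
  simp_rw [hvf]

/-- The degree is fixed, so the predicate may depend on it. The spanning set `S` is chosen to suit
each use: eigenvectors, homogeneous matrices, or all of `V`. -/
theorem extSub_induction {V : Submodule k M} {S : Set M} (h : V ≤ Submodule.span k S) {n : ℕ}
    {P : ExteriorAlgebra k M → Prop} (zero : P 0) (add : ∀ x y, P x → P y → P (x + y))
    (smul : ∀ (c : k) x, P x → P (c • x))
    (mem : ∀ v : Fin n → M, (∀ i, v i ∈ S) → P (ExteriorAlgebra.ιMulti k n v))
    {w : ExteriorAlgebra k M} (hw : w ∈ extSub V n) : P w := by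
  replace hw := extSub_le_span h n hw
  induction hw using Submodule.span_induction with
  | zero => exact zero
  | add x y _ _ hx hy => exact add x y hx hy
  | smul c x _ hx => exact smul c x hx
  | mem x hx =>
    obtain ⟨v, hv, rfl⟩ := hx
    exact mem v hv

theorem extSub_map (f : M →ₗ[k] N) (V : Submodule k M) (n : ℕ) :
    extSub (V.map f) n = (extSub V n).map (ExteriorAlgebra.map f).toLinearMap := by
  rw [extSub, extSub, Submodule.map_pow, ← Submodule.map_comp, ← Submodule.map_comp,
    ExteriorAlgebra.map_comp_ι]

theorem map_mem_extSub (f : M →ₗ[k] N) {V : Submodule k M} {W : Submodule k N}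
    (h : ∀ x ∈ V, f x ∈ W) {n : ℕ} {w : ExteriorAlgebra k M} (hw : w ∈ extSub V n) :
    ExteriorAlgebra.map f w ∈ extSub W n := by
  refine extSub_mono (Submodule.map_le_iff_le_comap.2 h) n ?_
  rw [extSub_map]
  exact ⟨w, hw, rfl⟩

theorem map_eq_self_of_mem_extSub (f : M →ₗ[k] M) {V : Submodule k M} (h : ∀ x ∈ V, f x = x)
    {n : ℕ} {w : ExteriorAlgebra k M} (hw : w ∈ extSub V n) : ExteriorAlgebra.map f w = w := by
  refine extSub_induction (V := V) (S := V)
    (P := fun w => ExteriorAlgebra.map f w = w) (by simp) (map_zero _) ?_ ?_ ?_ hw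
  · intro x y hx hy
    rw [map_add, hx, hy]
  · intro c x hx
    rw [map_smul, hx]
  · intro v hv
    rw [ExteriorAlgebra.map_apply_ιMulti]
    congr 1
    ext i
    exact h _ (hv i)

theorem map_map (f : M →ₗ[k] M) (g : M →ₗ[k] M) (w : ExteriorAlgebra k M) :
    ExteriorAlgebra.map f (ExteriorAlgebra.map g w) = ExteriorAlgebra.map (f ∘ₗ g) w := by
  rw [← ExteriorAlgebra.map_comp_map]; rfl

/-- This links the intrinsic exterior power of `V` with its copy in the ambient exterior algebra,
where chains of different levels can be compared directly. -/
theorem map_subtype_top (V : Submodule k M) (n : ℕ) :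
    (⋀[k]^n V).map (ExteriorAlgebra.map V.subtype).toLinearMap = extSub V n := by
  have h : ⋀[k]^n V = extSub (⊤ : Submodule k V) n := by
    rw [extSub, Submodule.map_top]
  rw [h, ← extSub_map, Submodule.map_top, Submodule.range_subtype]

/-- An element of the exterior power of a directed union comes from one of the subspaces. -/
theorem exists_mem_extSub_of_iUnion {V : ℕ → Submodule k M} (hV : Monotone V)
    {W : Submodule k M} (hW : ∀ x ∈ W, ∃ n, x ∈ V n) {q : ℕ} {w : ExteriorAlgebra k M}
    (hw : w ∈ extSub W q) : ∃ n, w ∈ extSub (V n) q := by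
  refine extSub_induction (V := W) (S := W) (P := fun w => ∃ n, w ∈ extSub (V n) q)
    (by simp) ⟨0, zero_mem _⟩ ?_ ?_ ?_ hw
  · rintro x y ⟨n, hn⟩ ⟨m, hm⟩
    exact ⟨max n m, add_mem (extSub_mono (hV (le_max_left _ _)) _ hn)
      (extSub_mono (hV (le_max_right _ _)) _ hm)⟩
  · rintro c x ⟨n, hn⟩
    exact ⟨n, Submodule.smul_mem _ _ hn⟩
  · intro v hv
    choose n hn using fun i => hW _ (hv i)
    refine ⟨Finset.univ.sup n, ιMulti_mem_extSub fun i => ?_⟩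
    exact hV (Finset.le_sup (Finset.mem_univ i)) (hn i)

end ExtSub

/-! ### The subcomplex of a Lie subalgebra -/

section SubComplex

variable {k : Type*} [CommRing k] {L : Type*} [LieRing L] [LieAlgebra k L]

theorem adExt_mem_extSub (K : LieSubalgebra k L) {x : L} (hx : x ∈ K) {n : ℕ}
    {w : ExteriorAlgebra k L} (hw : w ∈ extSub K.toSubmodule n) :
    adExt k L x w ∈ extSub K.toSubmodule n := by
  refine Submodule.pow_induction_on_left' (M := K.toSubmodule.map (ExteriorAlgebra.ι k))
    (C := fun n w _ => adExt k L x w ∈ extSub K.toSubmodule n) ?_ ?_ ?_ hw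
  · intro r
    rw [Algebra.algebraMap_eq_smul_one, map_smul, adExt_one, smul_zero]
    exact zero_mem _
  · intro a b i _ _ h1 h2
    rw [map_add]
    exact add_mem h1 h2
  · rintro _ ⟨y, hy, rfl⟩ i w hw ih
    rw [adExt_ι_mul]
    exact add_mem (ι_mul_mem_extSub (K.lie_mem hx hy) hw) (ι_mul_mem_extSub hy ih)

/-- By functoriality for the inclusion, the ambient differential restricts to the differential of
`K`, which lowers the degree. -/
theorem ceD_mem_extSub (K : LieSubalgebra k L) {n : ℕ}
    {w : ExteriorAlgebra k L} (hw : w ∈ extSub K.toSubmodule (n + 1)) :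
    ceD k L w ∈ extSub K.toSubmodule n := by
  rw [← map_subtype_top] at hw ⊢
  obtain ⟨v, hv, rfl⟩ := hw
  refine ⟨ceD k K v, ceD_mem k K n v hv, ?_⟩
  exact map_ceD K.incl v

end SubComplex

/-! ### Inclusions of Lie subalgebras inside a common ambient algebra -/

section Inclusion

variable {k : Type*} [Field k] {L : Type*} [LieRing L] [LieAlgebra k L]

/-- A criterion, inside the exterior algebra of an ambient Lie algebra, for an inclusion of Lie
subalgebras to be an isomorphism on homology. -/
theorem nonempty_lieHomology_equiv_of_le {K K' : LieSubalgebra k L} (hK : K ≤ K') (n : ℕ)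
    (hinj : ∀ y ∈ extSub K.toSubmodule n, ∀ z ∈ extSub K'.toSubmodule (n + 1), ceD k L z = y →
      ∃ u ∈ extSub K.toSubmodule (n + 1), ceD k L u = y)
    (hsurj : ∀ z ∈ extSub K'.toSubmodule n, ceD k L z = 0 →
      ∃ y ∈ extSub K.toSubmodule n, ceD k L y = 0 ∧
        ∃ u ∈ extSub K'.toSubmodule (n + 1), ceD k L u = z - y) :
    Nonempty (LieHomology k K n ≃ₗ[k] LieHomology k K' n) := by
  -- Over a field an injective linear map stays injective on exterior algebras, so identities
  -- between chains of `K` may be checked in the ambient algebra.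
  have inj : ∀ K : LieSubalgebra k L,
      Function.Injective (ExteriorAlgebra.map ((K.incl : K →ₗ⁅k⁆ L) : K →ₗ[k] L)) := fun K =>
    ExteriorAlgebra.map_injective_field (Submodule.ker_subtype _)
  have hcomp : ∀ y, ExteriorAlgebra.map ((K'.incl : K' →ₗ⁅k⁆ L) : K' →ₗ[k] L)
      (ExteriorAlgebra.map ((LieSubalgebra.inclusion hK : K →ₗ⁅k⁆ K') : K →ₗ[k] K') y)
      = ExteriorAlgebra.map ((K.incl : K →ₗ⁅k⁆ L) : K →ₗ[k] L) y := by
    intro y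
    rw [← AlgHom.comp_apply, ExteriorAlgebra.map_comp_map]
    rfl
  have mem : ∀ (K : LieSubalgebra k L) (m : ℕ), ∀ y ∈ ⋀[k]^m K,
      ExteriorAlgebra.map ((K.incl : K →ₗ⁅k⁆ L) : K →ₗ[k] L) y ∈ extSub K.toSubmodule m := by
    intro K m y hy
    rw [← map_subtype_top]
    exact ⟨y, hy, rfl⟩
  have ex : ∀ (K : LieSubalgebra k L) (m : ℕ), ∀ w ∈ extSub K.toSubmodule m, ∃ y ∈ ⋀[k]^m K,
      ExteriorAlgebra.map ((K.incl : K →ₗ⁅k⁆ L) : K →ₗ[k] L) y = w := by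
    intro K m w hw
    rw [← map_subtype_top] at hw
    exact hw
  refine nonempty_lieHomology_equiv (LieSubalgebra.inclusion hK) n ?_ ?_
  · rintro y ⟨hy, _⟩ ⟨z, hz, hzy⟩
    obtain ⟨u, hu, huy⟩ := hinj _ (mem K n y hy) _ (mem K' (n + 1) z hz) (by
      rw [← map_ceD, hzy, hcomp])
    obtain ⟨u', hu', rfl⟩ := ex K _ u hu
    refine ⟨u', hu', inj K ?_⟩
    rw [map_ceD, huy]
  · rintro z ⟨hz, hz0⟩
    obtain ⟨y, hy, hy0, u, hu, huz⟩ := hsurj _ (mem K' n z hz) (by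
      rw [← map_ceD, LinearMap.mem_ker.1 hz0, map_zero])
    obtain ⟨y', hy', rfl⟩ := ex K _ y hy
    obtain ⟨u', hu', rfl⟩ := ex K' _ u hu
    refine ⟨y', ⟨hy', LinearMap.mem_ker.2 (inj K ?_)⟩, u', hu', inj K' ?_⟩
    · rw [map_ceD, hy0, map_zero]
    · rw [map_ceD, huz, map_sub, hcomp]

end Inclusion

/-! ## Automorphisms that act trivially on homology -/

section Eigen

variable {k : Type*} [Field k] {L : Type*} [LieRing L] [LieAlgebra k L]

/-- `φ` maps every cycle in the exterior powers of `K` to a homologous cycle. -/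
def ActsTrivially (K : LieSubalgebra k L) (φ : L →ₗ[k] L) : Prop :=
  ∀ (q : ℕ) (z : ExteriorAlgebra k L), z ∈ extSub K.toSubmodule q → ceD k L z = 0 →
    ∃ u ∈ extSub K.toSubmodule (q + 1), ceD k L u = ExteriorAlgebra.map φ z - z

/-- Eigenvalues add up because `adExt` is a derivation. -/
theorem adExt_ιMulti_of_eigen {x : L} {n : ℕ} (v : Fin n → L) (m : Fin n → ℤ)
    (h : ∀ i, ⁅x, v i⁆ = (m i : k) • v i) :
    adExt k L x (ExteriorAlgebra.ιMulti k n v)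
      = ((∑ i, m i : ℤ) : k) • ExteriorAlgebra.ιMulti k n v := by
  induction n with
  | zero => simp [ExteriorAlgebra.ιMulti_zero_apply]
  | succ n ih =>
    rw [ιMulti_cons, adExt_ι_mul, ih _ (fun i => m i.succ) (fun i => h i.succ), h 0,
      Fin.sum_univ_succ, map_smul, smul_mul_assoc, mul_smul_comm, ← add_smul]
    push_cast
    rfl

/-- Eigenvalues multiply because the induced map is an algebra homomorphism. -/
theorem map_ιMulti_of_eigen {φ : L →ₗ[k] L} {n : ℕ} (v : Fin n → L) (c : Fin n → k)
    (h : ∀ i, φ (v i) = c i • v i) :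
    ExteriorAlgebra.map φ (ExteriorAlgebra.ιMulti k n v)
      = (∏ i, c i) • ExteriorAlgebra.ιMulti k n v := by
  rw [ExteriorAlgebra.map_apply_ιMulti, ← AlternatingMap.map_smul_univ]
  congr 1
  ext i
  exact h i

theorem prod_negOnePow {n : ℕ} (m : Fin n → ℤ) :
    ∏ i, (((m i).negOnePow : ℤ) : k) = (((∑ i, m i).negOnePow : ℤ) : k) := by
  induction n with
  | zero => simp
  | succ n ih => rw [Fin.prod_univ_succ, Fin.sum_univ_succ, Int.negOnePow_add, ih]; simp

/-- The composition of the operators `T - m` for `m` in a list. -/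
noncomputable def shiftProd {V : Type*} [AddCommGroup V] [Module k V] (T : Module.End k V)
    (ms : List ℤ) : Module.End k V :=
  (ms.map fun m : ℤ => T - (m : k) • 1).prod

theorem shiftProd_cons_apply {V : Type*} [AddCommGroup V] [Module k V] (T : Module.End k V)
    (m : ℤ) (ms : List ℤ) (v : V) :
    shiftProd T (m :: ms) v = T (shiftProd T ms v) - (m : k) • shiftProd T ms v := by
  simp [shiftProd]

theorem shiftProd_apply_of_eigen {V : Type*} [AddCommGroup V] [Module k V] (T : Module.End k V)
    (ms : List ℤ) {v : V} {a : ℤ} (h : T v = (a : k) • v) :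
    shiftProd T ms v = (ms.map fun m : ℤ => ((a : k) - m)).prod • v := by
  induction ms with
  | nil => simp [shiftProd]
  | cons m ms ih =>
    rw [shiftProd_cons_apply, ih, map_smul, h, smul_comm, ← sub_smul, smul_smul]
    simp

/-- If `x ∈ K` acts on `K` with integral eigenvalues, then `(-1)^{ad x}` acts trivially on the
homology of `K`. -/
theorem actsTrivially_of_eigen [CharZero k] (K : LieSubalgebra k L) {x : L} (hx : x ∈ K)
    (φ : L →ₗ⁅k⁆ L)
    (hK : K.toSubmodule ≤ Submodule.span k {y | y ∈ K ∧ ∃ m : ℤ, |m| ≤ 2 ∧ ⁅x, y⁆ = (m : k) • y ∧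
      φ y = ((m.negOnePow : ℤ) : k) • y}) :
    ActsTrivially K (φ : L →ₗ[k] L) := by
  intro q z hz hz0
  have hφ : ∀ y ∈ K.toSubmodule, φ y ∈ K.toSubmodule := by
    intro y hy
    have := hK hy
    induction this using Submodule.span_induction with
    | zero => rw [map_zero]; exact zero_mem _
    | add a b ha hb h1 h2 =>
      have aux : ∀ a, a ∈ Submodule.span k {y | y ∈ K ∧ ∃ m : ℤ, |m| ≤ 2 ∧
          ⁅x, y⁆ = (m : k) • y ∧ φ y = ((m.negOnePow : ℤ) : k) • y} → a ∈ K.toSubmodule :=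
        fun a ha => Submodule.span_le.2 (fun y hy => hy.1) ha
      rw [map_add]
      exact add_mem (h1 (aux a ha)) (h2 (aux b hb))
    | smul c a ha h1 =>
      rw [map_smul]
      exact Submodule.smul_mem _ _ (h1 (Submodule.span_le.2 (fun y hy => hy.1) ha))
    | mem y hy' =>
      obtain ⟨h, m, -, -, hm⟩ := hy'
      rw [hm]
      exact Submodule.smul_mem _ _ h
  set T : Module.End k (ExteriorAlgebra k L) := adExt k L x with hT
  -- On cycles `d (x ∧ z) = x · z`, so `T` is zero on homology and each factor `T - m` acts there as
  -- `-m`. A product with all `m ≠ 0` therefore acts as a nonzero scalar `c`.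
  have cyc : ∀ ms : List ℤ, (∀ m ∈ ms, m ≠ 0) → ∃ c : k, c ≠ 0 ∧
      shiftProd T ms z ∈ extSub K.toSubmodule q ∧ ceD k L (shiftProd T ms z) = 0 ∧
      ∃ u ∈ extSub K.toSubmodule (q + 1), ceD k L u = shiftProd T ms z - c • z := by
    intro ms
    induction ms with
    | nil => exact fun _ => ⟨1, one_ne_zero, hz, hz0, 0, zero_mem _, by simp [shiftProd]⟩
    | cons m ms ih =>
      intro hm
      obtain ⟨c, hc, h1, h2, u, hu, hu2⟩ := ih fun m' hm' => hm m' (List.mem_cons_of_mem _ hm')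
      refine ⟨-(m * c), ?_, ?_, ?_, ExteriorAlgebra.ι k x * shiftProd T ms z - (m : k) • u, ?_, ?_⟩
      · exact neg_ne_zero.2 (mul_ne_zero (Int.cast_ne_zero.2 (hm m List.mem_cons_self)) hc)
      · rw [shiftProd_cons_apply]
        exact sub_mem (adExt_mem_extSub K hx h1) (Submodule.smul_mem _ _ h1)
      · rw [shiftProd_cons_apply, map_sub, map_smul, h2, hT, ceD_adExt, h2]
        simp
      · exact sub_mem (ι_mul_mem_extSub hx h1) (Submodule.smul_mem _ _ hu)
      · rw [shiftProd_cons_apply, map_sub, map_smul, hu2, ceD_ι_mul, h2, mul_zero, sub_zero, ← hT,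
          smul_sub, neg_smul, mul_smul]
        abel
  -- Each of the `q` factors has weight at most `2` in absolute value, so weights in degree `q` lie
  -- in `[-2q, 2q]`. The product over all nonzero integers in this range annihilates every nonzero
  -- weight space.
  obtain ⟨c, hc, -, -, u, hu, hu2⟩ := cyc ((Finset.Icc (-(2 * q : ℤ)) (2 * q)).erase 0).toList (by
    intro m hm
    exact (Finset.mem_erase.1 (Finset.mem_toList.1 hm)).1)
  set ms := ((Finset.Icc (-(2 * q : ℤ)) (2 * q)).erase 0).toList with hms
  -- What survives the product has weight `0`, where `φ` acts as `(-1)^0`.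
  have hP : ExteriorAlgebra.map (φ : L →ₗ[k] L) (shiftProd T ms z) = shiftProd T ms z := by
    refine extSub_induction hK (P := fun z => ExteriorAlgebra.map (φ : L →ₗ[k] L)
      (shiftProd T ms z) = shiftProd T ms z) (by simp) ?_ ?_ ?_ hz
    · intro a b ha hb
      rw [map_add, map_add, ha, hb]
    · intro c a ha
      rw [map_smul, map_smul, ha]
    · intro v hv
      choose _ m hm1 hm2 hm3 using hv
      have h1 := adExt_ιMulti_of_eigen v m hm2
      have h2 := map_ιMulti_of_eigen (φ := (φ : L →ₗ[k] L)) v _ hm3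
      rw [prod_negOnePow] at h2
      rw [shiftProd_apply_of_eigen T ms h1, map_smul, h2]
      by_cases h0 : ∑ i, m i = 0
      · rw [h0]; simp
      · have : (ms.map fun m' : ℤ => (((∑ i, m i : ℤ) : k) - m')).prod = 0 := by
          refine List.prod_eq_zero (List.mem_map.2 ⟨∑ i, m i, ?_, sub_self _⟩)
          rw [hms, Finset.mem_toList, Finset.mem_erase, Finset.mem_Icc, ← abs_le]
          refine ⟨h0, (Finset.abs_sum_le_sum_abs _ _).trans ?_⟩
          refine (Finset.sum_le_card_nsmul _ _ 2 fun i _ => hm1 i).trans ?_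
          simp [mul_comm]
        rw [this, zero_smul, zero_smul]
  -- With `P` the product of shifts and `d u = P z - c z`, the `φ`-invariance of `P z` gives `d (u -
  -- φ u) = c (φ z - z)`.
  refine ⟨c⁻¹ • (u - ExteriorAlgebra.map (φ : L →ₗ[k] L) u), ?_, ?_⟩
  · exact Submodule.smul_mem _ _ (sub_mem hu (map_mem_extSub _ hφ hu))
  · rw [map_smul, map_sub, ← map_ceD, hu2, map_sub, hP, map_smul]
    rw [sub_sub_sub_cancel_left, ← smul_sub, smul_smul, inv_mul_cancel₀ hc, one_smul]

theorem ActsTrivially.comp {K : LieSubalgebra k L} {φ ψ : L →ₗ⁅k⁆ L}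
    (hφ : ActsTrivially K (φ : L →ₗ[k] L)) (hψ : ActsTrivially K (ψ : L →ₗ[k] L))
    (hψK : ∀ y ∈ K, ψ y ∈ K) :
    ActsTrivially K ((φ : L →ₗ[k] L) ∘ₗ (ψ : L →ₗ[k] L)) := by
  intro q z hz hz0
  obtain ⟨u, hu, hu2⟩ := hψ q z hz hz0
  obtain ⟨v, hv, hv2⟩ := hφ q (ExteriorAlgebra.map (ψ : L →ₗ[k] L) z) (map_mem_extSub _ hψK hz)
    (by rw [← map_ceD, hz0, map_zero])
  refine ⟨v + u, add_mem hv hu, ?_⟩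
  rw [map_add, hu2, hv2, ← map_map]
  abel

theorem actsTrivially_id (K : LieSubalgebra k L) : ActsTrivially K LinearMap.id :=
  fun q z _ _ => ⟨0, zero_mem _, by rw [ExteriorAlgebra.map_id]; simp⟩

end Eigen

/-! ## Reflections in algebras with anti-involution -/

section Reflection

variable {k : Type*} [Field k] {B : Type*} [Ring B] [Algebra k B]

/-- The Lie algebra of skew elements `X` with `q X = X`. -/
def cornerSkew (σ : AntiInvolution k B) (p : B) : LieSubalgebra k B where
  carrier := {X | σ X = -X ∧ p * X = X}
  add_mem' := by
    rintro a b ⟨h1, h2⟩ ⟨h3, h4⟩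
    exact ⟨σ.skew.add_mem h1 h3, by rw [mul_add, h2, h4]⟩
  zero_mem' := ⟨σ.skew.zero_mem, mul_zero _⟩
  smul_mem' := by
    rintro c a ⟨h1, h2⟩
    exact ⟨σ.skew.smul_mem c h1, by rw [mul_smul_comm, h2]⟩
  lie_mem' := by
    rintro a b ⟨h1, h2⟩ ⟨h3, h4⟩
    exact ⟨σ.skew.lie_mem h1 h3, by rw [Ring.lie_def, mul_sub, ← mul_assoc, ← mul_assoc, h2, h4]⟩

theorem mem_cornerSkew {σ : AntiInvolution k B} {p X : B} :
    X ∈ cornerSkew σ p ↔ σ X = -X ∧ p * X = X := Iff.rfl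

/-- Conjugation by an element of square `1`. -/
def conjOf (k : Type*) [Field k] {B : Type*} [Ring B] [Algebra k B] (w : B) (h : w * w = 1) :
    B ≃ₐ[k] B where
  toFun X := w * X * w
  invFun X := w * X * w
  left_inv X := by
    change w * (w * X * w) * w = X
    rw [mul_assoc w X w, ← mul_assoc w w, h, one_mul, mul_assoc, h, mul_one]
  right_inv X := by
    change w * (w * X * w) * w = X
    rw [mul_assoc w X w, ← mul_assoc w w, h, one_mul, mul_assoc, h, mul_one]
  map_mul' X Y := by
    rw [mul_assoc (w * X) w, mul_assoc w Y w, ← mul_assoc w w, h, one_mul]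
    simp only [mul_assoc]
  map_add' X Y := by
    rw [mul_add, add_mul]
  commutes' c := by
    rw [← Algebra.commutes, mul_assoc, h, mul_one]

theorem conjOf_apply (w : B) (h : w * w = 1) (X : B) : conjOf k w h X = w * X * w := rfl

theorem reflection_mul_self {e e' : B} (he : e * e = e) (he' : e' * e' = e') (h1 : e * e' = 0)
    (h2 : e' * e = 0) : (1 - 2 * (e + e')) * (1 - 2 * (e + e')) = 1 := by
  have h : (e + e') * (e + e') = e + e' := by
    rw [mul_add, add_mul, add_mul, he, he', h1, h2]; abel
  generalize e + e' = g at h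
  have : (1 - 2 * g) * (1 - 2 * g) = 1 - 4 * g + 4 * (g * g) := by noncomm_ring
  rw [this, h]; noncomm_ring

/-- In the Peirce decomposition for `e`, `e' = σ e` and `f = 1 - e - e'`, the element `e - e'` acts
on the left with weights `1`, `-1`, `0`. So `ad (e - e')` has integral weights between `-2` and `2`,
and conjugation by `w = f - e - e'` multiplies a component by the parity sign of its weight. Since
`e - e'` is itself skew and lies in the corner, `actsTrivially_of_eigen` applies. -/
theorem actsTrivially_reflection [CharZero k] (σ : AntiInvolution k B) {p e : B}
    (he : e * e = e) (h1 : e * σ e = 0) (h2 : σ e * e = 0) (hpe : p * e = e)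
    (hpe' : p * σ e = σ e) (w : B) (hw : w = 1 - 2 * (e + σ e)) (hww : w * w = 1) :
    ActsTrivially (cornerSkew σ p)
      ((conjOf k w hww : B →ₐ[k] B).toLieHom : B →ₗ[k] B) := by
  obtain ⟨e', he'⟩ : ∃ e', e' = σ e := ⟨_, rfl⟩
  have hσ : σ e' = e := by rw [he', σ.invol]
  have hσ2 : σ e = e' := he'.symm
  rw [← he'] at h1 h2 hw hpe'
  have hee : e' * e' = e' := by rw [he', ← σ.map_mul, he]
  obtain ⟨f, hf⟩ : ∃ f, f = 1 - e - e' := ⟨_, rfl⟩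
  have hσf : σ f = f := by
    rw [hf, LinearMap.map_sub, LinearMap.map_sub, σ.map_one, hσ, hσ2]; abel
  have ef : e * f = 0 := by rw [hf, mul_sub, mul_sub, he, h1]; simp
  have fe : f * e = 0 := by rw [hf, sub_mul, sub_mul, he, h2]; simp
  have e'f : e' * f = 0 := by rw [hf, mul_sub, mul_sub, hee, h2]; simp
  have fe' : f * e' = 0 := by rw [hf, sub_mul, sub_mul, hee, h1]; simp
  have ff : f * f = f := by
    nth_rw 1 [hf]
    rw [sub_mul, sub_mul, ef, e'f]; simp
  have hw' : w = f - e - e' := by rw [hw, hf]; noncomm_ring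
  have hsum : e + e' + f = 1 := by rw [hf]; abel
  have pf : ∀ X, p * X = X → p * (f * X) = f * X := by
    intro X hX
    rw [hf, sub_mul, sub_mul, mul_sub, mul_sub, one_mul, hX, ← mul_assoc, ← mul_assoc, hpe, hpe']
  have ass := fun a b c : B => mul_assoc a b c
  have z : ∀ {a b : B}, a * b = 0 → ∀ X, a * (b * X) = 0 := by
    intro a b h X; rw [← mul_assoc, h, zero_mul]
  have idem : ∀ {a : B}, a * a = a → ∀ X, a * (a * X) = a * X := by
    intro a h X; rw [← mul_assoc, h]
  refine actsTrivially_of_eigen _ (x := e - e') ?_ _ ?_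
  · refine ⟨?_, ?_⟩
    · rw [LinearMap.map_sub, hσ, hσ2]; abel
    · rw [mul_sub, hpe, hpe']
  · rintro X ⟨hX1, hX2⟩
    -- The nine Peirce components are grouped by weight `0, 1, -1, 2, -2`. As `σ` exchanges `e` and
    -- `e'` and fixes `f`, it preserves each weight, so every group is skew although single
    -- components need not be.
    have dec : X = (e * X * e + e' * X * e' + f * X * f) + (e * X * f + f * X * e')
        + (f * X * e + e' * X * f) + e * X * e' + e' * X * e := by
      have : X = (e + e' + f) * X * (e + e' + f) := by rw [hsum, one_mul, mul_one]
      nth_rw 1 [this]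
      noncomm_ring
    have pe : ∀ Y, p * (e * Y) = e * Y := fun Y => by rw [← mul_assoc, hpe]
    have pe' : ∀ Y, p * (e' * Y) = e' * Y := fun Y => by rw [← mul_assoc, hpe']
    have pfX : ∀ Y, p * (f * (X * Y)) = f * (X * Y) := fun Y =>
      pf _ (by rw [← mul_assoc, hX2])
    have mem : ∀ Y, Y ∈ cornerSkew σ p → ∀ m : ℤ, |m| ≤ 2 → ⁅e - e', Y⁆ = (m : k) • Y →
        w * Y * w = ((m.negOnePow : ℤ) : k) • Y → Y ∈ Submodule.span k {y | y ∈ cornerSkew σ p ∧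
          ∃ m : ℤ, |m| ≤ 2 ∧ ⁅e - e', y⁆ = (m : k) • y ∧
          (conjOf k w hww : B →ₐ[k] B).toLieHom y = ((m.negOnePow : ℤ) : k) • y} :=
      fun Y hY m hm h3 h4 => Submodule.subset_span ⟨hY, m, hm, h3, h4⟩
    rw [dec]
    refine add_mem (add_mem (add_mem (add_mem (mem _ ⟨?_, ?_⟩ 0 (by norm_num) ?_ ?_)
      (mem _ ⟨?_, ?_⟩ 1 (by norm_num) ?_ ?_)) (mem _ ⟨?_, ?_⟩ (-1) (by norm_num) ?_ ?_))
      (mem _ ⟨?_, ?_⟩ 2 (by norm_num) ?_ ?_)) (mem _ ⟨?_, ?_⟩ (-2) (by norm_num) ?_ ?_)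
    all_goals
      simp only [hw', Ring.lie_def, LinearMap.map_add, σ.map_mul, hσ, hσ2, hσf, hX1, mul_add,
        add_mul, mul_sub, sub_mul, ass, mul_neg, neg_mul, pe, pe', pfX, z h1, z h2, z ef, z fe,
        z e'f, z fe', idem he, idem hee, idem ff, he, hee, h1, h2, ef, fe, e'f, fe', ff, mul_zero,
        sub_zero, zero_sub, add_zero, zero_add, neg_neg, neg_zero, Int.negOnePow_zero,
        Int.negOnePow_neg, Int.negOnePow_one, Int.negOnePow_even 2 even_two, Int.cast_zero,
        Int.cast_one, Int.cast_neg, Units.val_one, Units.val_neg, one_smul, zero_smul, neg_smul,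
        Int.cast_ofNat, two_smul]
    all_goals abel

end Reflection

/-! ## Matrix units in the algebra of banded matrices -/

namespace Jac

section Single

variable {A : Type*} [Ring A]

theorem single_mul_mat (i j : ℤ) (r : A) (X : Jac A) (a b : ℤ) :
    (single i j r * X).mat a b = if a = i then r * X.mat j b else 0 := by
  rw [mat_mul_apply, finsum_eq_single _ j]
  · by_cases h : a = i <;> simp [single, h]
  · intro x hx; simp [single, hx]

theorem mul_single_mat (i j : ℤ) (r : A) (X : Jac A) (a b : ℤ) :
    (X * single i j r).mat a b = if b = j then X.mat a i * r else 0 := by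
  rw [mat_mul_apply, finsum_eq_single _ i]
  · by_cases h : b = j <;> simp [single, h]
  · intro x hx; simp [single, hx]

theorem single_mul_single (i j c d : ℤ) :
    single i j (1 : A) * single c d 1 = if j = c then single i d 1 else 0 := by
  ext a b
  rw [single_mul_mat]
  by_cases h1 : a = i <;> by_cases h2 : j = c <;> by_cases h3 : b = d <;> simp [single, h1, h2, h3]

/-- The diagonal matrix with entries `1` on a set of indices. -/
noncomputable def diagOn (A : Type*) [Ring A] (S : Set ℤ) : Jac A :=
  open Classical in
  mk (fun i j => if i = j ∧ i ∈ S then 1 else 0) ⟨0, fun i j h => if_neg (by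
    rintro ⟨rfl, -⟩
    simp at h)⟩

theorem diagOn_mul_mat (S : Set ℤ) (X : Jac A) (a b : ℤ) :
    open Classical in (diagOn A S * X).mat a b = if a ∈ S then X.mat a b else 0 := by
  rw [mat_mul_apply, finsum_eq_single _ a]
  · by_cases h : a ∈ S <;> simp [diagOn, h]
  · intro x hx; simp [diagOn, hx.symm]

theorem diagOn_mul_eq_self_iff (S : Set ℤ) (X : Jac A) :
    diagOn A S * X = X ↔ ∀ a b, X.mat a b ≠ 0 → a ∈ S := by
  constructor
  · intro h a b hab
    by_contra ha
    rw [← h, diagOn_mul_mat, if_neg ha] at hab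
    exact hab rfl
  · intro h
    ext a b
    rw [diagOn_mul_mat]
    split_ifs with ha
    · rfl
    · by_contra hab
      exact ha (h a b (Ne.symm hab))

end Single

end Jac

/-! ### The anti-involutions on matrix units -/

section Tau

variable {k A : Type*} [CommRing k] [Ring A] [Algebra k A] (bar : AntiInvolution k A) (ε : ℤˣ)
  (l : ℤ) (s : ℤ → ℤˣ) (h : ∀ i, ε * s (l - i) = s i)

theorem tauOf_mat (X : Jac A) (i j : ℤ) :
    (tauOf bar ε l s h X).mat i j = ((ε * s i * s (l - j) : ℤˣ) : ℤ) • bar (X.mat (l - j) (l - i)) :=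
  tauMat_apply bar ε l s X.mat i j

theorem tauOf_single (i j : ℤ) :
    tauOf bar ε l s h (Jac.single i j 1)
      = ((s i * s j : ℤˣ) : ℤ) • Jac.single (l - j) (l - i) (1 : A) := by
  ext a b
  rw [tauOf_mat]
  have e : (((s i * s j : ℤˣ) : ℤ) • Jac.single (l - j) (l - i) (1 : A)).mat a b
      = ((s i * s j : ℤˣ) : ℤ) • (Jac.single (l - j) (l - i) (1 : A)).mat a b := by
    rcases Int.units_eq_one_or (s i * s j) with hu | hu <;> simp [hu]
  rw [e]
  simp only [Jac.single, Jac.mat_mk]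
  by_cases hab : a = l - j ∧ b = l - i
  · obtain ⟨rfl, rfl⟩ := hab
    simp only [sub_sub_cancel, and_self, if_true, AntiInvolution.map_one]
    rw [h j, mul_comm]
  · rw [if_neg hab, if_neg (by omega), AntiInvolution.map_zero, smul_zero, smul_zero]

end Tau

/-! ## Signed permutations of the index set -/

/-- The index set `{-n, …, n + l}`. -/
def levelSet (l : ℤ) (n : ℕ) : Set ℤ := {i | -(n : ℤ) ≤ i ∧ i ≤ n + l}

theorem mem_levelSet {l : ℤ} {n : ℕ} {i : ℤ} : i ∈ levelSet l n ↔ -(n : ℤ) ≤ i ∧ i ≤ n + l := Iff.rfl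

/-! ### Skew matrices supported on a finite index set -/

section Level

variable {k A : Type*} [Field k] [Ring A] [Algebra k A] (bar : AntiInvolution k A) (ε : ℤˣ)
  (l : ℤ) (s : ℤ → ℤˣ) (h : ∀ i, ε * s (l - i) = s i)

/-- The skew matrices supported on `{-n, …, n + l}`. -/
noncomputable def levelLie (n : ℕ) : LieSubalgebra k (Jac A) :=
  cornerSkew (tauOf bar ε l s h) (Jac.diagOn A (levelSet l n))

variable {bar ε l s h}

theorem mem_levelLie {n : ℕ} {X : Jac A} : X ∈ levelLie bar ε l s h n ↔
    tauOf bar ε l s h X = -X ∧ ∀ a b, X.mat a b ≠ 0 → a ∈ levelSet l n := by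
  rw [levelLie, mem_cornerSkew, Jac.diagOn_mul_eq_self_iff]

/-- Membership bounds only the row index. Skewness pairs the entry `(a, b)` with `(l - b, l - a)`,
and the index set is stable under `i ↦ l - i`, so the column index is bounded too. -/
theorem mat_eq_zero_of_mem_levelLie {n : ℕ} {X : Jac A} (hX : X ∈ levelLie bar ε l s h n)
    {a b : ℤ} (hab : ¬ (a ∈ levelSet l n ∧ b ∈ levelSet l n)) : X.mat a b = 0 := by
  rw [mem_levelLie] at hX
  by_contra h0
  have ha := hX.2 a b h0
  refine hab ⟨ha, ?_⟩
  have h1 : (tauOf bar ε l s h X).mat (l - b) (l - a) ≠ 0 ∨ X.mat (l - b) (l - a) = 0 := by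
    rw [hX.1, Jac.mat_neg]
    by_cases hh : X.mat (l - b) (l - a) = 0
    · exact Or.inr hh
    · exact Or.inl (by simpa using hh)
  have h2 : X.mat (l - b) (l - a) ≠ 0 := by
    intro hh
    have h3 := congrArg (fun Z : Jac A => Z.mat (l - b) (l - a)) hX.1
    simp only [tauOf_mat, Jac.mat_neg, Pi.neg_apply, hh, neg_zero, sub_sub_cancel] at h3
    refine h0 ?_
    rw [← bar.invol (X.mat a b)]
    rcases Int.units_eq_one_or (ε * s (l - b) * s a) with hu | hu
    · rw [hu] at h3
      simp only [Units.val_one, one_smul] at h3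
      rw [h3, bar.map_zero]
    · rw [hu] at h3
      simp only [Units.val_neg, Units.val_one, neg_smul, one_smul, neg_eq_zero] at h3
      rw [h3, bar.map_zero]
  have h3 := hX.2 _ _ h2
  rw [mem_levelSet] at h3 ⊢
  omega

theorem levelLie_mono : Monotone (levelLie bar ε l s h) := by
  intro n m hnm X hX
  rw [mem_levelLie] at hX ⊢
  refine ⟨hX.1, fun a b hab => ?_⟩
  have := hX.2 a b hab
  rw [mem_levelSet] at this ⊢
  omega

theorem tauOf_diagOn (n : ℕ) : tauOf bar ε l s h (Jac.diagOn A (levelSet l n))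
    = Jac.diagOn A (levelSet l n) := by
  classical
  ext a b
  rw [tauOf_mat]
  simp only [Jac.diagOn, Jac.mat_mk]
  by_cases hab : a = b
  · subst hab
    have e : l - a ∈ levelSet l n ↔ a ∈ levelSet l n := by
      rw [mem_levelSet, mem_levelSet]; omega
    have e2 : ε * s a * s (l - a) = 1 := by
      rw [mul_right_comm, h, Int.units_mul_self]
    rw [e2]
    by_cases ha : a ∈ levelSet l n <;> simp [e, ha]
  · rw [if_neg (by omega), if_neg (by tauto), AntiInvolution.map_zero, smul_zero]

/-- The element `w` is fixed by the anti-involution and commutes with the diagonal projection, so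
conjugation by it preserves skewness and support. -/
theorem conj_mem_levelLie {n : ℕ} {e w : Jac A}
    (hpe : Jac.diagOn A (levelSet l n) * e = e)
    (hpe' : Jac.diagOn A (levelSet l n) * tauOf bar ε l s h e = tauOf bar ε l s h e)
    (hw : w = 1 - 2 * (e + tauOf bar ε l s h e)) {X : Jac A} (hX : X ∈ levelLie bar ε l s h n) :
    w * X * w ∈ levelLie bar ε l s h n := by
  set σ := tauOf bar ε l s h
  set p := Jac.diagOn A (levelSet l n)
  have hp : σ p = p := tauOf_diagOn n
  have ep : e * p = e := by
    rw [← σ.invol (e * p), σ.map_mul, hp, hpe', σ.invol]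
  have ep' : σ e * p = σ e := by
    rw [← hp, ← σ.map_mul, hpe]
  have hσw : σ w = w := by
    have : w = 1 - (e + σ e) - (e + σ e) := by rw [hw]; noncomm_ring
    rw [this, LinearMap.map_sub, LinearMap.map_sub, LinearMap.map_add, σ.map_one, σ.invol,
      add_comm (σ e)]
  have hpw : p * w = w * p := by
    rw [hw, mul_sub, sub_mul, mul_one, one_mul, mul_assoc 2, add_mul, ep, ep', two_mul,
      mul_add, mul_add, hpe, hpe']
  obtain ⟨h1, h2⟩ := mem_cornerSkew.1 hX
  refine mem_cornerSkew.2 ⟨?_, ?_⟩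
  · rw [σ.map_mul, σ.map_mul, hσw, h1]; noncomm_ring
  · change p * (w * X * w) = w * X * w
    rw [← mul_assoc, ← mul_assoc, hpw, mul_assoc w, h2]

end Level

/-! ### Sign changes and transpositions as reflections -/

section Generators

variable {k A : Type*} [Field k] [Ring A] [Algebra k A] (bar : AntiInvolution k A) (ε : ℤˣ)
  (l : ℤ) (s : ℤ → ℤˣ) (h : ∀ i, ε * s (l - i) = s i)

theorem diagOn_mul_single {n : ℕ} {i : ℤ} (hi : i ∈ levelSet l n) (j : ℤ) :
    Jac.diagOn A (levelSet l n) * Jac.single i j 1 = Jac.single i j (1 : A) := by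
  rw [Jac.diagOn_mul_eq_self_iff]
  intro a b hab
  simp only [Jac.single, Jac.mat_mk] at hab
  have : a = i := by by_contra hh; exact hab (by simp [hh])
  rwa [this]

/-- The diagonal matrix with entry `-1` at `i` and `l - i` and `1` elsewhere. -/
noncomputable def signElt (A : Type*) [Ring A] (l i : ℤ) : Jac A :=
  1 - 2 * (Jac.single i i 1 + Jac.single (l - i) (l - i) 1)

variable {l} in
theorem signElt_mul_self {i : ℤ} (hi : l < 2 * i) : signElt A l i * signElt A l i = 1 := by
  refine reflection_mul_self ?_ ?_ ?_ ?_ <;> rw [Jac.single_mul_single]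
  · simp
  · simp
  · rw [if_neg (by omega)]
  · rw [if_neg (by omega)]

variable {l} in
/-- Conjugation by `signElt`. -/
noncomputable def signConj (k : Type*) [Field k] (A : Type*) [Ring A] [Algebra k A] {i : ℤ}
    (hi : l < 2 * i) : Jac A ≃ₐ[k] Jac A := conjOf k (signElt A l i) (signElt_mul_self hi)

/-- The signs of `signElt`. -/
def signAt (l i a : ℤ) : ℤˣ := if a = i ∨ a = l - i then -1 else 1

variable {l} in
theorem signConj_mat {i : ℤ} (hi : l < 2 * i) (X : Jac A) (a b : ℤ) :
    (signConj k A hi X).mat a b = ((signAt l i a * signAt l i b : ℤˣ) : ℤ) • X.mat a b := by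
  have h1 : ∀ X : Jac A, ∀ a b, (signElt A l i * X).mat a b = (signAt l i a : ℤ) • X.mat a b := by
    intro X a b
    rw [signElt, sub_mul, one_mul, mul_assoc, two_mul, add_mul]
    simp only [Jac.mat_sub, Jac.mat_add, Pi.sub_apply, Pi.add_apply, Jac.single_mul_mat, one_mul]
    rw [signAt]
    by_cases h1 : a = i
    · subst h1
      rw [if_neg (show ¬ a = l - a by omega)]; simp
    · by_cases h2 : a = l - i
      · subst h2; simp [h1]
      · simp [h1, h2]
  have h2 : ∀ X : Jac A, ∀ a b, (X * signElt A l i).mat a b = (signAt l i b : ℤ) • X.mat a b := by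
    intro X a b
    rw [signElt, mul_sub, mul_one, two_mul, mul_add, mul_add]
    simp only [Jac.mat_sub, Jac.mat_add, Pi.sub_apply, Pi.add_apply, Jac.mul_single_mat, mul_one]
    rw [signAt]
    by_cases h1 : b = i
    · subst h1
      rw [if_neg (show ¬ b = l - b by omega)]; simp
    · by_cases h2 : b = l - i
      · subst h2; simp [h1]
      · simp [h1, h2]
  rw [signConj, conjOf_apply, h2, h1, smul_smul, Units.val_mul, mul_comm]

theorem tauOf_single_self (i : ℤ) :
    tauOf bar ε l s h (Jac.single i i 1) = Jac.single (l - i) (l - i) (1 : A) := by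
  rw [tauOf_single, Int.units_mul_self]; simp

variable {l} in
-- The idempotent is `E_{i,i}`; the condition `l < 2 * i` makes `i` and `l - i` distinct, hence
-- `E_{i,i}` orthogonal to its image.
theorem actsTrivially_signConj [CharZero k] {n : ℕ} {i : ℤ} (hi : l < 2 * i)
    (hin : i ∈ levelSet l n) :
    ActsTrivially (levelLie bar ε l s h n)
      ((signConj k A hi : Jac A →ₐ[k] Jac A).toLieHom : Jac A →ₗ[k] Jac A) := by
  have hin' : l - i ∈ levelSet l n := by rw [mem_levelSet] at hin ⊢; omega
  refine actsTrivially_reflection (e := Jac.single i i 1) (tauOf bar ε l s h) ?_ ?_ ?_ ?_ ?_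
    (signElt A l i) ?_ (signElt_mul_self hi)
  · rw [Jac.single_mul_single]; simp
  · rw [tauOf_single_self, Jac.single_mul_single, if_neg (by omega)]
  · rw [tauOf_single_self, Jac.single_mul_single, if_neg (by omega)]
  · exact diagOn_mul_single l hin i
  · rw [tauOf_single_self]; exact diagOn_mul_single l hin' _
  · rw [tauOf_single_self, signElt]

variable {bar ε l s h} in
theorem signConj_mem {n : ℕ} {i : ℤ} (hi : l < 2 * i) (hin : i ∈ levelSet l n) {X : Jac A}
    (hX : X ∈ levelLie bar ε l s h n) : signConj k A hi X ∈ levelLie bar ε l s h n := by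
  have hin' : l - i ∈ levelSet l n := by rw [mem_levelSet] at hin ⊢; omega
  refine conj_mem_levelLie (e := Jac.single i i 1) ?_ ?_ ?_ hX
  · exact diagOn_mul_single l hin i
  · rw [tauOf_single_self]; exact diagOn_mul_single l hin' _
  · rw [tauOf_single_self, signElt]

/-- `e_{ii} + e_{cc} - e_{ic} - e_{ci}`. -/
noncomputable def swapIdem (A : Type*) [Ring A] (i c : ℤ) : Jac A :=
  Jac.single i i 1 + Jac.single c c 1 - Jac.single i c 1 - Jac.single c i 1

/-- The image of `swapIdem` under the anti-involution. -/
noncomputable def swapIdem' (A : Type*) [Ring A] (l : ℤ) (s : ℤ → ℤˣ) (i c : ℤ) : Jac A :=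
  Jac.single (l - i) (l - i) 1 + Jac.single (l - c) (l - c) 1
    - ((s i * s c : ℤˣ) : ℤ) • Jac.single (l - c) (l - i) 1
    - ((s i * s c : ℤˣ) : ℤ) • Jac.single (l - i) (l - c) 1

theorem tauOf_swapIdem (i c : ℤ) :
    tauOf bar ε l s h (swapIdem A i c) = swapIdem' A l s i c := by
  rw [swapIdem, swapIdem', LinearMap.map_sub, LinearMap.map_sub, LinearMap.map_add,
    tauOf_single_self, tauOf_single_self, tauOf_single, tauOf_single, mul_comm (s c)]

/-- The signed permutation matrix that exchanges `i`, `c` and `l - i`, `l - c`. -/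
noncomputable def swapElt (A : Type*) [Ring A] (l : ℤ) (s : ℤ → ℤˣ) (i c : ℤ) : Jac A :=
  1 - (swapIdem A i c + swapIdem' A l s i c)

theorem swapIdem_mul_self {i c : ℤ} (hic : i ≠ c) :
    swapIdem A i c * swapIdem A i c = 2 * swapIdem A i c := by
  simp only [swapIdem, mul_add, add_mul, mul_sub, sub_mul, Jac.single_mul_single, hic, hic.symm,
    if_true, if_false, two_mul]
  abel

variable {l} in
-- The indices `i`, `c` lie above `l / 2` and their mirror images below, so no matrix units can be
-- composed.
theorem swapIdem_mul_swapIdem' {i c : ℤ} (hi : l < 2 * i) (hc : l < 2 * c) :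
    swapIdem A i c * swapIdem' A l s i c = 0 := by
  have h1 : ¬ i = l - i := by omega
  have h2 : ¬ i = l - c := by omega
  have h3 : ¬ c = l - i := by omega
  have h4 : ¬ c = l - c := by omega
  simp only [swapIdem, swapIdem', mul_add, add_mul, mul_sub, sub_mul, mul_smul_comm,
    Jac.single_mul_single, h1, h2, h3, h4, if_false, smul_zero, add_zero, sub_zero]

variable {l} in
theorem swapIdem'_mul_swapIdem {i c : ℤ} (hi : l < 2 * i) (hc : l < 2 * c) :
    swapIdem' A l s i c * swapIdem A i c = 0 := by
  have h1 : ¬ l - i = i := by omega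
  have h2 : ¬ l - i = c := by omega
  have h3 : ¬ l - c = i := by omega
  have h4 : ¬ l - c = c := by omega
  simp only [swapIdem, swapIdem', mul_add, add_mul, mul_sub, sub_mul, smul_mul_assoc,
    Jac.single_mul_single, h1, h2, h3, h4, if_false, smul_zero, add_zero, sub_zero]

/-- Half of `swapIdem`, an idempotent. -/
noncomputable def halfSwap (k : Type*) [Field k] (A : Type*) [Ring A] [Algebra k A] (i c : ℤ) :
    Jac A := (2⁻¹ : k) • swapIdem A i c

theorem tauOf_halfSwap (i c : ℤ) :
    tauOf bar ε l s h (halfSwap k A i c) = (2⁻¹ : k) • swapIdem' A l s i c := by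
  rw [halfSwap, LinearMap.map_smul, tauOf_swapIdem]

theorem two_mul_half_smul [CharZero k] (X : Jac A) : 2 * ((2⁻¹ : k) • X) = X := by
  rw [mul_smul_comm, two_mul, ← two_smul k X, smul_smul, inv_mul_cancel₀ two_ne_zero, one_smul]

theorem halfSwap_mul_self [CharZero k] {i c : ℤ} (hic : i ≠ c) :
    halfSwap k A i c * halfSwap k A i c = halfSwap k A i c := by
  rw [halfSwap, smul_mul_assoc, mul_smul_comm, swapIdem_mul_self hic, ← mul_smul_comm,
    two_mul_half_smul]

theorem swapElt_eq [CharZero k] (i c : ℤ) :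
    swapElt A l s i c
      = 1 - 2 * (halfSwap k A i c + tauOf bar ε l s h (halfSwap k A i c)) := by
  rw [tauOf_halfSwap, mul_add, halfSwap, two_mul_half_smul, two_mul_half_smul, swapElt]

theorem swapIdem'_mul_self {i c : ℤ} (hic : i ≠ c) :
    swapIdem' A l s i c * swapIdem' A l s i c = 2 * swapIdem' A l s i c := by
  have h1 : ¬ l - i = l - c := by omega
  have h2 : ¬ l - c = l - i := by omega
  rw [swapIdem']
  rcases Int.units_eq_one_or (s i * s c) with hu | hu <;> rw [hu] <;>
  · simp only [mul_add, add_mul, mul_sub, sub_mul, Units.val_one, Units.val_neg, neg_smul, one_smul,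
      mul_neg, neg_mul, Jac.single_mul_single, h1, h2, if_true, if_false, two_mul]
    abel

variable {l} in
theorem swapElt_mul_self {i c : ℤ} (hi : l < 2 * i) (hc : l < 2 * c) (hic : i ≠ c) :
    swapElt A l s i c * swapElt A l s i c = 1 := by
  have e1 := swapIdem_mul_self (A := A) hic
  have e2 := swapIdem'_mul_self (A := A) l s hic
  have e3 := swapIdem_mul_swapIdem' (A := A) s hi hc
  have e4 := swapIdem'_mul_swapIdem (A := A) s hi hc
  rw [swapElt]
  generalize swapIdem A i c = M at *
  generalize swapIdem' A l s i c = M' at *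
  have : (1 - (M + M')) * (1 - (M + M'))
      = 1 - 2 * M - 2 * M' + M * M + M * M' + M' * M + M' * M' := by noncomm_ring
  rw [this, e1, e2, e3, e4]
  abel

variable {l} in
/-- Conjugation by `swapElt`. -/
noncomputable def swapConj (k : Type*) [Field k] (A : Type*) [Ring A] [Algebra k A] (s : ℤ → ℤˣ)
    {i c : ℤ} (hi : l < 2 * i) (hc : l < 2 * c) (hic : i ≠ c) : Jac A ≃ₐ[k] Jac A :=
  conjOf k (swapElt A l s i c) (swapElt_mul_self s hi hc hic)

/-- The signs of `swapElt`. -/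
def swapSign (l : ℤ) (s : ℤ → ℤˣ) (i c a : ℤ) : ℤˣ :=
  if a = l - i ∨ a = l - c then s i * s c else 1

/-- The permutation of `swapElt`. -/
def swapPerm (l i c : ℤ) : Equiv.Perm ℤ := Equiv.swap i c * Equiv.swap (l - i) (l - c)

variable {l} in
theorem swapPerm_apply {i c : ℤ} (hi : l < 2 * i) (hc : l < 2 * c) (a : ℤ) :
    swapPerm l i c a = if a = i then c else if a = c then i else if a = l - i then l - c else
      if a = l - c then l - i else a := by
  rw [swapPerm, Equiv.Perm.mul_apply, Equiv.swap_apply_def, Equiv.swap_apply_def]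
  split_ifs <;> omega

variable {l} in
theorem swapConj_mat {i c : ℤ} (hi : l < 2 * i) (hc : l < 2 * c) (hic : i ≠ c) (X : Jac A)
    (a b : ℤ) : (swapConj k A s hi hc hic X).mat a b
      = ((swapSign l s i c a * swapSign l s i c b : ℤˣ) : ℤ) •
        X.mat (swapPerm l i c a) (swapPerm l i c b) := by
  have zs : ∀ (u : ℤ) (X : Jac A) a b, (u • X).mat a b = u • X.mat a b := by
    intro u X a b
    exact map_zsmul (⟨⟨fun X : Jac A => X.mat a b, rfl⟩, fun _ _ => rfl⟩ : Jac A →+ A) u X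
  have d1 : ∀ a, a = i → a ≠ c ∧ a ≠ l - i ∧ a ≠ l - c := by intro a ha; omega
  have d2 : ∀ a, a = c → a ≠ i ∧ a ≠ l - i ∧ a ≠ l - c := by intro a ha; omega
  have d3 : ∀ a, a = l - i → a ≠ i ∧ a ≠ c ∧ a ≠ l - c := by intro a ha; omega
  have d4 : ∀ a, a = l - c → a ≠ i ∧ a ≠ c ∧ a ≠ l - i := by intro a ha; omega
  have h1 : ∀ X : Jac A, ∀ a b, (swapElt A l s i c * X).mat a b
      = (swapSign l s i c a : ℤ) • X.mat (swapPerm l i c a) b := by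
    intro X a b
    rw [swapElt, swapIdem, swapIdem', swapPerm_apply hi hc, swapSign]
    generalize hu : ((s i * s c : ℤˣ) : ℤˣ) = u
    simp only [sub_mul, add_mul, one_mul, smul_mul_assoc]
    simp only [Jac.mat_sub, Jac.mat_add, Pi.sub_apply, Pi.add_apply, zs, Jac.single_mul_mat,
      one_mul]
    by_cases a1 : a = i
    · obtain ⟨p, q, r⟩ := d1 a a1
      simp [a1 ▸ p, a1 ▸ q, a1 ▸ r, a1]
    by_cases a2 : a = c
    · obtain ⟨p, q, r⟩ := d2 a a2
      simp [a2 ▸ p, a2 ▸ q, a2 ▸ r, a2]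
    by_cases a3 : a = l - i
    · obtain ⟨p, q, r⟩ := d3 a a3
      simp [a3 ▸ p, a3 ▸ q, a3 ▸ r, a3]
    by_cases a4 : a = l - c
    · obtain ⟨p, q, r⟩ := d4 a a4
      simp [a4 ▸ p, a4 ▸ q, a4 ▸ r, a4]
    simp [a1, a2, a3, a4]
  have h2 : ∀ X : Jac A, ∀ a b, (X * swapElt A l s i c).mat a b
      = (swapSign l s i c b : ℤ) • X.mat a (swapPerm l i c b) := by
    intro X a b
    rw [swapElt, swapIdem, swapIdem', swapPerm_apply hi hc, swapSign]
    generalize hu : ((s i * s c : ℤˣ) : ℤˣ) = u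
    simp only [mul_sub, mul_add, mul_one, mul_smul_comm]
    simp only [Jac.mat_sub, Jac.mat_add, Pi.sub_apply, Pi.add_apply, zs, Jac.mul_single_mat,
      mul_one]
    by_cases a1 : b = i
    · obtain ⟨p, q, r⟩ := d1 b a1
      simp [a1 ▸ p, a1 ▸ q, a1 ▸ r, a1]
    by_cases a2 : b = c
    · obtain ⟨p, q, r⟩ := d2 b a2
      simp [a2 ▸ p, a2 ▸ q, a2 ▸ r, a2]
    by_cases a3 : b = l - i
    · obtain ⟨p, q, r⟩ := d3 b a3
      simp [a3 ▸ p, a3 ▸ q, a3 ▸ r, a3]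
    by_cases a4 : b = l - c
    · obtain ⟨p, q, r⟩ := d4 b a4
      simp [a4 ▸ p, a4 ▸ q, a4 ▸ r, a4]
    simp [a1, a2, a3, a4]
  rw [swapConj, conjOf_apply, h2, h1, smul_smul, Units.val_mul, mul_comm]

theorem swapIdem_levelSet {n : ℕ} {i c : ℤ} (hin : i ∈ levelSet l n) (hcn : c ∈ levelSet l n) :
    Jac.diagOn A (levelSet l n) * halfSwap k A i c = halfSwap k A i c := by
  rw [halfSwap, mul_smul_comm, swapIdem, mul_sub, mul_sub, mul_add, diagOn_mul_single l hin,
    diagOn_mul_single l hin, diagOn_mul_single l hcn, diagOn_mul_single l hcn]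

theorem tauOf_swapIdem_levelSet {n : ℕ} {i c : ℤ} (hin : i ∈ levelSet l n)
    (hcn : c ∈ levelSet l n) :
    Jac.diagOn A (levelSet l n) * tauOf bar ε l s h (halfSwap k A i c)
      = tauOf bar ε l s h (halfSwap k A i c) := by
  have hin' : l - i ∈ levelSet l n := by rw [mem_levelSet] at hin ⊢; omega
  have hcn' : l - c ∈ levelSet l n := by rw [mem_levelSet] at hcn ⊢; omega
  rw [tauOf_halfSwap, mul_smul_comm, swapIdem', mul_sub, mul_sub, mul_add, mul_smul_comm,
    mul_smul_comm, diagOn_mul_single l hin', diagOn_mul_single l hin', diagOn_mul_single l hcn',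
    diagOn_mul_single l hcn']

variable {l} in
-- Half of `swapIdem` is the idempotent projecting onto the difference of the basis vectors `i` and
-- `c`. Its reflection is their transposition, and the image under the anti-involution supplies the
-- mirrored transposition with sign `s i * s c`.
theorem actsTrivially_swapConj [CharZero k] {n : ℕ} {i c : ℤ} (hi : l < 2 * i) (hc : l < 2 * c)
    (hic : i ≠ c) (hin : i ∈ levelSet l n) (hcn : c ∈ levelSet l n) :
    ActsTrivially (levelLie bar ε l s h n)
      ((swapConj k A s hi hc hic : Jac A →ₐ[k] Jac A).toLieHom : Jac A →ₗ[k] Jac A) := by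
  refine actsTrivially_reflection (e := halfSwap k A i c) (tauOf bar ε l s h)
    (halfSwap_mul_self hic) ?_ ?_ (swapIdem_levelSet l hin hcn)
    (tauOf_swapIdem_levelSet bar ε l s h hin hcn) _ (swapElt_eq bar ε l s h i c) _
  · rw [tauOf_halfSwap, halfSwap, smul_mul_smul_comm, swapIdem_mul_swapIdem' s hi hc, smul_zero]
  · rw [tauOf_halfSwap, halfSwap, smul_mul_smul_comm, swapIdem'_mul_swapIdem s hi hc, smul_zero]

variable {bar ε l s h} in
theorem swapConj_mem [CharZero k] {n : ℕ} {i c : ℤ} (hi : l < 2 * i) (hc : l < 2 * c)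
    (hic : i ≠ c) (hin : i ∈ levelSet l n) (hcn : c ∈ levelSet l n) {X : Jac A}
    (hX : X ∈ levelLie bar ε l s h n) : swapConj k A s hi hc hic X ∈ levelLie bar ε l s h n :=
  conj_mem_levelLie (swapIdem_levelSet l hin hcn)
    (tauOf_swapIdem_levelSet bar ε l s h hin hcn) (swapElt_eq bar ε l s h i c) hX

end Generators

/-! ### Combinatorics of signed permutations -/

section SignedPerms

theorem perm_apply_inv (π : Equiv.Perm ℤ) (i : ℤ) : π (π⁻¹ i) = i := π.apply_symm_apply i

/-- A signed permutation of `{-n, …, n + l}` that respects the involution `i ↦ l - i`, maps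
positive indices to positive indices, and preserves the form with signs `s`. -/
structure IsSignedPerm (l : ℤ) (s : ℤ → ℤˣ) (n : ℕ) (π : Equiv.Perm ℤ) (δ : ℤ → ℤˣ) : Prop where
  comm : ∀ i, π (l - i) = l - π i
  pos : ∀ i, l < 2 * i → l < 2 * π i
  fix : ∀ i, (i < -(n : ℤ) ∨ n + l < i ∨ 2 * i = l) → π i = i ∧ δ i = 1
  sgn : ∀ i, δ i * δ (l - i) = s i * s (π i)

namespace IsSignedPerm

variable {l : ℤ} {s : ℤ → ℤˣ} {n : ℕ} {π π' : Equiv.Perm ℤ} {δ δ' : ℤ → ℤˣ}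

theorem one (l : ℤ) (s : ℤ → ℤˣ) (n : ℕ) : IsSignedPerm l s n 1 1 where
  comm _ := rfl
  pos _ h := h
  fix _ _ := ⟨rfl, rfl⟩
  sgn i := by simp [Int.units_mul_self]

theorem mul (h : IsSignedPerm l s n π δ) (h' : IsSignedPerm l s n π' δ') :
    IsSignedPerm l s n (π * π') (fun i => δ (π' i) * δ' i) where
  comm i := by simp [h.comm, h'.comm]
  pos i hi := h.pos _ (h'.pos _ hi)
  fix i hi := by
    obtain ⟨h1, h2⟩ := h.fix i hi
    obtain ⟨h3, h4⟩ := h'.fix i hi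
    simp [h1, h2, h3, h4]
  sgn i := by
    have h1 := h.sgn (π' i)
    have h2 := h'.sgn i
    rw [h'.comm, mul_mul_mul_comm, h1, h2]
    calc _ = s (π' i) * s (π' i) * (s i * s (π (π' i))) := by ac_rfl
      _ = _ := by rw [Int.units_mul_self, one_mul]; rfl

theorem inv (h : IsSignedPerm l s n π δ) : IsSignedPerm l s n π⁻¹ (fun i => δ (π⁻¹ i)) where
  comm i := by
    rw [Equiv.Perm.inv_eq_iff_eq, h.comm, perm_apply_inv]
  pos i hi := by
    -- If `π⁻¹ i` were below `l / 2`, then `π` would send its mirror image, which is above, to `l -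
    -- i`, which is below. If it were equal to `l / 2`, it would be fixed by `π`.
    by_contra hc
    have e := perm_apply_inv π i
    rcases lt_or_eq_of_le (not_lt.1 hc) with h1 | h1
    · have := h.pos (l - π⁻¹ i) (by omega)
      rw [h.comm, e] at this
      omega
    · have := (h.fix (π⁻¹ i) (by omega)).1
      omega
  fix i hi := by
    have h1 : π⁻¹ i = i := by rw [Equiv.Perm.inv_eq_iff_eq, (h.fix i hi).1]
    exact ⟨h1, by rw [h1, (h.fix i hi).2]⟩
  sgn i := by
    have e : π⁻¹ (l - i) = l - π⁻¹ i := by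
      rw [Equiv.Perm.inv_eq_iff_eq, h.comm, perm_apply_inv]
    have := h.sgn (π⁻¹ i)
    rw [perm_apply_inv] at this
    rw [e, this, mul_comm]

theorem mono {m : ℕ} (hnm : n ≤ m) (h : IsSignedPerm l s n π δ) : IsSignedPerm l s m π δ where
  comm := h.comm
  pos := h.pos
  fix i hi := h.fix i (by omega)
  sgn := h.sgn

end IsSignedPerm

/-- Outside a finite interval both the permutation and the signs are prescribed, so the pair is
determined by its restriction to that interval. -/
theorem finite_isSignedPerm (l : ℤ) (s : ℤ → ℤˣ) (n : ℕ) :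
    Finite {p : Equiv.Perm ℤ × (ℤ → ℤˣ) // IsSignedPerm l s n p.1 p.2} := by
  classical
  let I : Finset ℤ := Finset.Icc (-(n : ℤ)) (n + l)
  have hI : ∀ i, ¬ i ∈ I → (i < -(n : ℤ) ∨ n + l < i ∨ 2 * i = l) := by
    intro i hi
    rw [Finset.mem_Icc] at hi
    omega
  have f1 : Finite {f : Equiv.Perm ℤ // ∀ a, ¬ a ∈ I → f a = a} :=
    Finite.of_equiv _ (Equiv.Perm.subtypeEquivSubtypePerm (· ∈ I))
  refine Finite.of_injective
    (β := {f : Equiv.Perm ℤ // ∀ a, ¬ a ∈ I → f a = a} × (I → ℤˣ))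
    (fun p => (⟨p.1.1, fun a ha => (p.2.fix a (hI a ha)).1⟩, fun i => p.1.2 i)) ?_
  rintro ⟨⟨π, δ⟩, h⟩ ⟨⟨π', δ'⟩, h'⟩ hh
  simp only [Prod.mk.injEq, Subtype.mk.injEq] at hh
  obtain ⟨rfl, h2⟩ := hh
  congr 2
  funext i
  by_cases hi : i ∈ I
  · exact congrFun h2 ⟨i, hi⟩
  · exact (h.fix i (hI i hi)).2.trans (h'.fix i (hI i hi)).2.symm

theorem swapPerm_swapPerm {l i c : ℤ} (hi : l < 2 * i) (hc : l < 2 * c) (a : ℤ) :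
    swapPerm l i c (swapPerm l i c a) = a := by
  rw [swapPerm_apply hi hc, swapPerm_apply hi hc]
  split_ifs <;> omega

theorem swapSign_swapPerm {l i c : ℤ} (s : ℤ → ℤˣ) (hi : l < 2 * i) (hc : l < 2 * c) (a : ℤ) :
    swapSign l s i c (swapPerm l i c a) = swapSign l s i c a := by
  have : (swapPerm l i c a = l - i ∨ swapPerm l i c a = l - c) ↔ (a = l - i ∨ a = l - c) := by
    rw [swapPerm_apply hi hc]
    split_ifs <;> omega
  simp only [swapSign, this]

theorem isSignedPerm_sign (l : ℤ) (s : ℤ → ℤˣ) {n : ℕ} {i : ℤ} (hi : l < 2 * i)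
    (hin : i ∈ levelSet l n) : IsSignedPerm l s n 1 (signAt l i) where
  comm _ := rfl
  pos _ h := h
  fix a ha := by
    rw [mem_levelSet] at hin
    refine ⟨rfl, ?_⟩
    rw [signAt, if_neg]
    omega
  sgn a := by
    have : (l - a = i ∨ l - a = l - i) ↔ (a = i ∨ a = l - i) := by omega
    simp only [signAt, this, Equiv.Perm.coe_one, id, Int.units_mul_self]

theorem isSignedPerm_swap {l : ℤ} {s : ℤ → ℤˣ} {ε : ℤˣ} (h : ∀ i, ε * s (l - i) = s i) {n : ℕ}
    {i c : ℤ} (hi : l < 2 * i) (hc : l < 2 * c) (hin : i ∈ levelSet l n)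
    (hcn : c ∈ levelSet l n) : IsSignedPerm l s n (swapPerm l i c) (swapSign l s i c) where
  comm a := by
    rw [swapPerm_apply hi hc, swapPerm_apply hi hc]
    split_ifs <;> omega
  pos a ha := by
    rw [swapPerm_apply hi hc]
    split_ifs <;> omega
  fix a ha := by
    rw [mem_levelSet] at hin hcn
    constructor
    · rw [swapPerm_apply hi hc]
      split_ifs <;> omega
    · rw [swapSign, if_neg]
      omega
  sgn a := by
    have hs : s (l - i) * s (l - c) = s i * s c := by
      rw [← h i, ← h c, mul_mul_mul_comm, Int.units_mul_self, one_mul]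
    rw [swapSign, swapSign, swapPerm_apply hi hc]
    by_cases a1 : a = i
    · subst a1
      rw [if_neg (by omega), if_pos (by omega), if_pos rfl, one_mul]
    by_cases a2 : a = c
    · subst a2
      rw [if_neg (by omega), if_pos (by omega), if_neg a1, if_pos rfl, one_mul, mul_comm]
    by_cases a3 : a = l - i
    · subst a3
      rw [if_pos (by omega), if_neg (by omega), if_neg a1, if_neg a2, if_pos rfl, mul_one, hs]
    by_cases a4 : a = l - c
    · subst a4
      rw [if_pos (by omega), if_neg (by omega), if_neg a1, if_neg a2, if_neg a3, if_pos rfl,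
        mul_one, mul_comm (s (l - c)), hs]
    rw [if_neg (by omega), if_neg (by omega), if_neg a1, if_neg a2, if_neg a3, if_neg a4,
      Int.units_mul_self, Int.units_mul_self]

end SignedPerms

/-! ### The group of automorphisms given by signed permutations -/

section SignedGroup

variable (k A : Type*) [Field k] [Ring A] [Algebra k A] (l : ℤ) (s : ℤ → ℤˣ)

/-- `φ` acts on matrices by the permutation `π` with signs `δ`. -/
def ActsBy {k A : Type*} [Field k] [Ring A] [Algebra k A] (φ : Jac A ≃ₐ[k] Jac A)
    (π : Equiv.Perm ℤ) (δ : ℤ → ℤˣ) : Prop :=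
  ∀ X a b, (φ X).mat (π a) (π b) = ((δ a * δ b : ℤˣ) : ℤ) • X.mat a b

variable {k A} in
theorem ActsBy.mul {φ φ' : Jac A ≃ₐ[k] Jac A} {π π' : Equiv.Perm ℤ} {δ δ' : ℤ → ℤˣ}
    (h : ActsBy φ π δ) (h' : ActsBy φ' π' δ') :
    ActsBy (φ * φ') (π * π') (fun i => δ (π' i) * δ' i) := by
  intro X a b
  rw [AlgEquiv.mul_apply, Equiv.Perm.mul_apply, Equiv.Perm.mul_apply, h, h', smul_smul,
    ← Units.val_mul, mul_mul_mul_comm]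

variable {k A} in
theorem ActsBy.eq_one {φ : Jac A ≃ₐ[k] Jac A} (h : ActsBy φ 1 1) : φ = 1 := by
  ext X a b
  have := h X a b
  simpa using this

variable {k A} in
theorem ActsBy.unique {φ φ' : Jac A ≃ₐ[k] Jac A} {π : Equiv.Perm ℤ} {δ : ℤ → ℤˣ}
    (h : ActsBy φ π δ) (h' : ActsBy φ' π δ) : φ = φ' := by
  ext X a b
  have h1 := h X (π⁻¹ a) (π⁻¹ b)
  have h2 := h' X (π⁻¹ a) (π⁻¹ b)
  rw [← h2] at h1
  simpa using h1

/-- The group of automorphisms given by the signed permutations of `{-n, …, n + l}`. -/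
def signedGroup (n : ℕ) : Subgroup (Jac A ≃ₐ[k] Jac A) where
  carrier := {φ | ∃ π δ, IsSignedPerm l s n π δ ∧ ActsBy φ π δ}
  mul_mem' := by
    rintro φ φ' ⟨π, δ, h1, h2⟩ ⟨π', δ', h3, h4⟩
    exact ⟨_, _, h1.mul h3, h2.mul h4⟩
  one_mem' := ⟨1, 1, IsSignedPerm.one l s n, fun X a b => by simp⟩
  inv_mem' := by
    rintro φ ⟨π, δ, h1, h2⟩
    refine ⟨_, _, h1.inv, fun X a b => ?_⟩
    have := h2 (φ⁻¹ X) (π⁻¹ a) (π⁻¹ b)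
    rw [← AlgEquiv.mul_apply, mul_inv_cancel, AlgEquiv.one_apply, perm_apply_inv,
      perm_apply_inv] at this
    rw [this, smul_smul, ← Units.val_mul, Int.units_mul_self, Units.val_one, one_smul]

variable {k A l s} in
theorem mem_signedGroup {n : ℕ} {φ : Jac A ≃ₐ[k] Jac A} :
    φ ∈ signedGroup k A l s n ↔ ∃ π δ, IsSignedPerm l s n π δ ∧ ActsBy φ π δ := Iff.rfl

instance (n : ℕ) : Finite (signedGroup k A l s n) := by
  have := finite_isSignedPerm l s n
  choose π δ h1 h2 using fun φ : signedGroup k A l s n => mem_signedGroup.1 φ.2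
  refine Finite.of_injective
    (fun φ => (⟨(π φ, δ φ), h1 φ⟩ :
      {p : Equiv.Perm ℤ × (ℤ → ℤˣ) // IsSignedPerm l s n p.1 p.2})) ?_
  intro φ φ' hh
  simp only [Subtype.mk.injEq, Prod.mk.injEq] at hh
  have h3 := h2 φ'
  rw [← hh.1, ← hh.2] at h3
  exact Subtype.ext ((h2 φ).unique h3)

variable {l}

theorem actsBy_signConj {i : ℤ} (hi : l < 2 * i) : ActsBy (signConj k A hi) 1 (signAt l i) :=
  fun X a b => signConj_mat hi X a b

theorem actsBy_swapConj {i c : ℤ} (hi : l < 2 * i) (hc : l < 2 * c) (hic : i ≠ c) :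
    ActsBy (swapConj k A s hi hc hic) (swapPerm l i c) (swapSign l s i c) := by
  intro X a b
  rw [swapConj_mat, swapPerm_swapPerm hi hc, swapPerm_swapPerm hi hc, swapSign_swapPerm s hi hc,
    swapSign_swapPerm s hi hc]

theorem signConj_mem_signedGroup {n : ℕ} {i : ℤ} (hi : l < 2 * i) (hin : i ∈ levelSet l n) :
    signConj k A hi ∈ signedGroup k A l s n :=
  ⟨_, _, isSignedPerm_sign l s hi hin, actsBy_signConj k A hi⟩

variable {s} in
theorem swapConj_mem_signedGroup {ε : ℤˣ} (h : ∀ i, ε * s (l - i) = s i) {n : ℕ} {i c : ℤ}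
    (hi : l < 2 * i) (hc : l < 2 * c) (hic : i ≠ c) (hin : i ∈ levelSet l n)
    (hcn : c ∈ levelSet l n) : swapConj k A s hi hc hic ∈ signedGroup k A l s n :=
  ⟨_, _, isSignedPerm_swap h hi hc hin hcn, actsBy_swapConj k A s hi hc hic⟩

theorem signConj_mul_self {i : ℤ} (hi : l < 2 * i) : signConj k A hi * signConj k A hi = 1 := by
  ext1 X
  exact (signConj k A hi).left_inv X

theorem swapConj_mul_self {i c : ℤ} (hi : l < 2 * i) (hc : l < 2 * c) (hic : i ≠ c) :
    swapConj k A s hi hc hic * swapConj k A s hi hc hic = 1 := by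
  ext1 X
  exact (swapConj k A s hi hc hic).left_inv X

variable {k A s} in
/-- Every signed permutation of `{-(n + 1), …, n + 1 + l}` is the product of a transposition, a
sign change at the largest index, and a signed permutation of `{-n, …, n + l}`. -/
theorem exists_factorization {ε : ℤˣ} (h : ∀ i, ε * s (l - i) = s i) {n : ℕ}
    {i : ℤ} (hin : i = n + 1 + l) (hi : l < 2 * i)
    {φ : Jac A ≃ₐ[k] Jac A} (hφ : φ ∈ signedGroup k A l s (n + 1)) :
    ∃ W T ψ : Jac A ≃ₐ[k] Jac A, φ = W * (T * ψ) ∧ ψ ∈ signedGroup k A l s n ∧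
      (T = 1 ∨ T = signConj k A hi) ∧
      (W = 1 ∨ ∃ (c : ℤ) (hc : l < 2 * c) (hic : i ≠ c), c ∈ levelSet l (n + 1) ∧
        W = swapConj k A s hi hc hic) := by
  have hiS : i ∈ levelSet l (n + 1) := by rw [mem_levelSet]; push_cast; omega
  -- The transposition of the top index `i` with its image `π i` makes `i` a fixed point; `π i` is
  -- again above `l / 2` by the positivity condition.
  have step1 : ∃ W φ₁ : Jac A ≃ₐ[k] Jac A, φ = W * φ₁ ∧
      (∃ π δ, IsSignedPerm l s (n + 1) π δ ∧ ActsBy φ₁ π δ ∧ π i = i) ∧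
      (W = 1 ∨ ∃ (c : ℤ) (hc : l < 2 * c) (hic : i ≠ c), c ∈ levelSet l (n + 1) ∧
        W = swapConj k A s hi hc hic) := by
    obtain ⟨π, δ, h1, h2⟩ := hφ
    by_cases hic : i = π i
    · exact ⟨1, φ, (one_mul _).symm, ⟨π, δ, h1, h2, hic.symm⟩, Or.inl rfl⟩
    · have hc := h1.pos i hi
      have hcS : π i ∈ levelSet l (n + 1) := by
        by_contra hcS
        rw [mem_levelSet] at hcS
        have := (h1.fix (π i) (by omega)).1
        exact hic (π.injective this).symm
      refine ⟨swapConj k A s hi hc hic, swapConj k A s hi hc hic * φ, ?_,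
        ⟨_, _, (isSignedPerm_swap h hi hc hiS hcS).mul h1,
          (actsBy_swapConj k A s hi hc hic).mul h2, ?_⟩, Or.inr ⟨π i, hc, hic, hcS, rfl⟩⟩
      · rw [← mul_assoc, swapConj_mul_self, one_mul]
      · rw [Equiv.Perm.mul_apply, swapPerm_apply hi hc, if_neg (Ne.symm hic), if_pos rfl]
  obtain ⟨W, φ₁, rfl, ⟨π, δ, h1, h2, hπ⟩, hW⟩ := step1
  -- Once `i` is fixed with sign `1`, so is `l - i`: the position by compatibility with the
  -- reflection, the sign by compatibility with the form. Hence the support shrinks to level `n`.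
  have final : ∀ (ψ : Jac A ≃ₐ[k] Jac A) (δ : ℤ → ℤˣ), IsSignedPerm l s (n + 1) π δ →
      ActsBy ψ π δ → δ i = 1 → ψ ∈ signedGroup k A l s n := by
    intro ψ δ h1 h2 hδ
    refine ⟨π, δ, ⟨h1.comm, h1.pos, fun a ha => ?_, h1.sgn⟩, h2⟩
    by_cases e1 : a = i
    · rw [e1]; exact ⟨hπ, hδ⟩
    by_cases e2 : a = l - i
    · rw [e2, h1.comm, hπ]
      refine ⟨rfl, ?_⟩
      have := h1.sgn i
      rw [hδ, one_mul, hπ, Int.units_mul_self] at this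
      exact this
    · exact h1.fix a (by push_cast; omega)
  rcases Int.units_eq_one_or (δ i) with hδ | hδ
  · exact ⟨W, 1, φ₁, by rw [one_mul], final φ₁ δ h1 h2 hδ, Or.inl rfl, hW⟩
  · refine ⟨W, signConj k A hi, signConj k A hi * φ₁, ?_, ?_, Or.inr rfl, hW⟩
    · rw [← mul_assoc (signConj k A hi), signConj_mul_self, one_mul]
    · refine final _ _ ((isSignedPerm_sign l s hi hiS).mul h1) ((actsBy_signConj k A hi).mul h2) ?_
      simp [hπ, hδ, signAt]

variable {k A s} in
theorem signedGroup_mono {n m : ℕ} (hnm : n ≤ m) :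
    signedGroup k A l s n ≤ signedGroup k A l s m := by
  rintro φ ⟨π, δ, h1, h2⟩
  exact ⟨π, δ, h1.mono hnm, h2⟩

variable {k A s} in
-- The level `0` index set is `{0}` for `l = 0` and empty for `l = -1`; in the first case its only
-- element is the centre of the reflection, which is fixed by definition.
theorem eq_one_of_mem_signedGroup_zero (hl : l = 0 ∨ l = -1) {φ : Jac A ≃ₐ[k] Jac A}
    (hφ : φ ∈ signedGroup k A l s 0) : φ = 1 := by
  obtain ⟨π, δ, h1, h2⟩ := hφ
  have h3 : ∀ i, π i = i ∧ δ i = 1 := fun i => h1.fix i (by push_cast; omega)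
  have e1 : π = 1 := Equiv.ext fun i => (h3 i).1
  have e2 : δ = 1 := funext fun i => (h3 i).2
  rw [e1, e2] at h2
  exact h2.eq_one

variable {k A s} in
/-- The underlying homomorphism of Lie algebras of an automorphism of an associative algebra. -/
noncomputable abbrev lieOf (φ : Jac A ≃ₐ[k] Jac A) : Jac A →ₗ⁅k⁆ Jac A := (φ : Jac A →ₐ[k] Jac A).toLieHom

variable {k A} in
-- The factorization writes every signed permutation as a product of sign changes and
-- transpositions, all of which act trivially. The induction lowers `n` while the Lie algebra stays
-- at level `m`.
theorem signedGroup_mem_and_actsTrivially [CharZero k] (bar : AntiInvolution k A) {ε : ℤˣ}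
    {s : ℤ → ℤˣ} (hl : l = 0 ∨ l = -1)
    (h : ∀ i, ε * s (l - i) = s i) {n m : ℕ} (hnm : n ≤ m) {φ : Jac A ≃ₐ[k] Jac A}
    (hφ : φ ∈ signedGroup k A l s n) :
    (∀ X ∈ levelLie bar ε l s h m, φ X ∈ levelLie bar ε l s h m) ∧
      ActsTrivially (levelLie bar ε l s h m) (lieOf φ : Jac A →ₗ[k] Jac A) := by
  have comp : ∀ φ ψ : Jac A ≃ₐ[k] Jac A, ((∀ X ∈ levelLie bar ε l s h m,
      φ X ∈ levelLie bar ε l s h m) ∧ ActsTrivially (levelLie bar ε l s h m)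
        (lieOf φ : Jac A →ₗ[k] Jac A)) → ((∀ X ∈ levelLie bar ε l s h m,
      ψ X ∈ levelLie bar ε l s h m) ∧ ActsTrivially (levelLie bar ε l s h m)
        (lieOf ψ : Jac A →ₗ[k] Jac A)) → ((∀ X ∈ levelLie bar ε l s h m,
      (φ * ψ) X ∈ levelLie bar ε l s h m) ∧ ActsTrivially (levelLie bar ε l s h m)
        (lieOf (φ * ψ) : Jac A →ₗ[k] Jac A)) := by
    rintro φ ψ ⟨h1, h2⟩ ⟨h3, h4⟩
    have e : (lieOf (φ * ψ) : Jac A →ₗ[k] Jac A)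
        = (lieOf φ : Jac A →ₗ[k] Jac A) ∘ₗ (lieOf ψ : Jac A →ₗ[k] Jac A) :=
      LinearMap.ext fun X => rfl
    rw [e]
    exact ⟨fun X hX => h1 _ (h3 X hX), h2.comp h4 h3⟩
  have one : ((∀ X ∈ levelLie bar ε l s h m,
      (1 : Jac A ≃ₐ[k] Jac A) X ∈ levelLie bar ε l s h m) ∧ ActsTrivially (levelLie bar ε l s h m)
        (lieOf (1 : Jac A ≃ₐ[k] Jac A) : Jac A →ₗ[k] Jac A)) :=
    ⟨fun X hX => hX, actsTrivially_id _⟩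
  induction n generalizing φ with
  | zero =>
    rw [eq_one_of_mem_signedGroup_zero hl hφ]
    exact one
  | succ n ih =>
    have hi : l < 2 * (n + 1 + l) := by omega
    have hiS : (n + 1 + l) ∈ levelSet l m := by rw [mem_levelSet]; omega
    obtain ⟨W, T, ψ, rfl, hψ, hT, hW⟩ := exists_factorization h rfl hi hφ
    refine comp _ _ ?_ (comp _ _ ?_ (ih (by omega) hψ))
    · rcases hW with rfl | ⟨c, hc, hic, hcS, rfl⟩
      · exact one
      · have hcS' : c ∈ levelSet l m := by
          rw [mem_levelSet] at hcS ⊢; push_cast at hcS; omega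
        exact ⟨fun X hX => swapConj_mem hi hc hic hiS hcS' hX,
          actsTrivially_swapConj bar ε s h hi hc hic hiS hcS'⟩
    · rcases hT with rfl | rfl
      · exact one
      · exact ⟨fun X hX => signConj_mem hi hiS hX, actsTrivially_signConj bar ε s h hi hiS⟩

end SignedGroup

/-! ### Positive sums of commuting idempotents -/

section Idempotents

variable {k : Type*} [Field k] [CharZero k] {V : Type*} [AddCommGroup V] [Module k V]

/-- In characteristic zero, `c + ∑ i, p i` is injective for `c > 0` and commuting idempotents. -/
theorem eq_zero_of_sum_idempotents {ι κ : Type*} (p : κ → V →ₗ[k] V)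
    (idem : ∀ i v, p i (p i v) = p i v) (comm : ∀ i j v, p i (p j v) = p j (p i v))
    (f : ι → κ) (T : Finset ι) (c : ℕ) (hc : 0 < c) (v : V)
    (h : (c : k) • v + ∑ t ∈ T, p (f t) v = 0) : v = 0 := by
  classical
  induction T using Finset.induction_on generalizing c v with
  | empty =>
    rw [Finset.sum_empty, add_zero] at h
    exact (smul_eq_zero.1 h).resolve_left (Nat.cast_ne_zero.2 hc.ne')
  | insert t T ht ih =>
    rw [Finset.sum_insert ht] at h
    -- Applying `p (f t)` to the relation absorbs its own term into the scalar, which becomes `c +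
    -- 1`, and leaves the same kind of relation for `p (f t) v` with one idempotent fewer.
    have h0 : p (f t) v = 0 := by
      refine ih (c + 1) (Nat.succ_pos _) _ ?_
      have := congrArg (p (f t)) h
      rw [map_add, map_add, map_smul, map_sum, idem, map_zero] at this
      rw [← this, Nat.cast_add, Nat.cast_one, add_smul, one_smul, add_assoc]
      congr 2
      exact Finset.sum_congr rfl fun i _ => comm _ _ _
    rw [h0, zero_add] at h
    exact ih c hc v h

end Idempotents

theorem map_congr_of_mem_extSub {k M : Type*} [CommRing k] [AddCommGroup M] [Module k M]
    (f g : M →ₗ[k] M) {V : Submodule k M} (h : ∀ x ∈ V, f x = g x) {n : ℕ}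
    {w : ExteriorAlgebra k M} (hw : w ∈ extSub V n) :
    ExteriorAlgebra.map f w = ExteriorAlgebra.map g w := by
  refine extSub_induction (V := V) (S := V)
    (P := fun w => ExteriorAlgebra.map f w = ExteriorAlgebra.map g w)
    (by simp) (by simp) ?_ ?_ ?_ hw
  · intro x y hx hy
    rw [map_add, hx, hy, map_add]
  · intro c x hx
    rw [map_smul, hx, map_smul]
  · intro v hv
    rw [ExteriorAlgebra.map_apply_ιMulti, ExteriorAlgebra.map_apply_ιMulti]
    congr 1
    ext i
    exact h _ (hv i)

/-! ## Entrywise multiplication with scalars -/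

section Mask

variable {k A : Type*} [Field k] [Ring A] [Algebra k A]

/-- Entrywise multiplication of a matrix with scalars. -/
def mask (κ : ℤ → ℤ → k) : Jac A →ₗ[k] Jac A where
  toFun X := Jac.mk (fun a b => κ a b • X.mat a b) (by
    obtain ⟨N, hN⟩ := X.band
    exact ⟨N, fun i j h => by rw [hN i j h, smul_zero]⟩)
  map_add' X Y := by ext a b; simp
  map_smul' c X := by ext a b; exact smul_comm _ _ _

@[simp] theorem mask_mat (κ : ℤ → ℤ → k) (X : Jac A) (a b : ℤ) :
    (mask κ X).mat a b = κ a b • X.mat a b := rfl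

theorem mask_mem {bar : AntiInvolution k A} {ε : ℤˣ} {l : ℤ} {s : ℤ → ℤˣ}
    {h : ∀ i, ε * s (l - i) = s i} {κ : ℤ → ℤ → k} (hκ : ∀ a b, κ (l - b) (l - a) = κ a b) {n : ℕ}
    {X : Jac A} (hX : X ∈ levelLie bar ε l s h n) : mask κ X ∈ levelLie bar ε l s h n := by
  rw [mem_levelLie] at hX ⊢
  refine ⟨?_, fun a b hab => hX.2 a b fun h0 => hab (by rw [mask_mat, h0, smul_zero])⟩
  ext a b
  have := congrArg (fun Z : Jac A => Z.mat a b) hX.1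
  simp only [tauOf_mat, Jac.mat_neg, Pi.neg_apply] at this
  rw [tauOf_mat, mask_mat, LinearMap.map_smul, smul_comm, this, hκ]
  simp

/-- The coefficients of the map that deletes the rows and columns `c` and `l - c`. -/
def cutCoeff (k : Type*) [Field k] (l c a b : ℤ) : k :=
  if a = c ∨ a = l - c ∨ b = c ∨ b = l - c then 0 else 1

/-- The map that deletes the rows and columns `c` and `l - c`. -/
abbrev cut (k : Type*) [Field k] [Algebra k A] (l c : ℤ) : Jac A →ₗ[k] Jac A :=
  mask (cutCoeff k l c)

theorem cut_cut (l c : ℤ) (X : Jac A) : cut k l c (cut k l c X) = cut k l c X := by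
  ext a b
  simp only [mask_mat, cutCoeff]
  split_ifs <;> simp

theorem cut_comm (l c d : ℤ) (X : Jac A) :
    cut k l c (cut k l d X) = cut k l d (cut k l c X) := by
  ext a b
  exact smul_comm _ _ _

variable {bar : AntiInvolution k A} {ε : ℤˣ} {l : ℤ} {s : ℤ → ℤˣ} {h : ∀ i, ε * s (l - i) = s i}

theorem cut_eq_self {n : ℕ} {X : Jac A} (hX : X ∈ levelLie bar ε l s h n) {i : ℤ}
    (hi : i = n + 1 + l) : cut k l i X = X := by
  ext a b
  rw [mask_mat, cutCoeff]
  split_ifs with hab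
  · rw [zero_smul, mat_eq_zero_of_mem_levelLie hX]
    simp only [mem_levelSet]
    omega
  · rw [one_smul]

theorem signConj_eq_self {n : ℕ} {X : Jac A} (hX : X ∈ levelLie bar ε l s h n) {i : ℤ}
    (hin : i = n + 1 + l) (hi : l < 2 * i) : signConj k A hi X = X := by
  ext a b
  rw [signConj_mat]
  by_cases hab : a ∈ levelSet l n ∧ b ∈ levelSet l n
  · simp only [mem_levelSet] at hab
    rw [signAt, signAt, if_neg (by omega), if_neg (by omega)]
    simp
  · rw [mat_eq_zero_of_mem_levelLie hX hab, smul_zero]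

/-- A matrix of level `n` has no entries in the rows and columns `i`, `l - i`. After the
transposition those of `c` and `l - c` stand there and are deleted, so only the part of `X` away
from `c` remains; the signs affect only deleted or zero entries. -/
theorem cut_swapConj {n : ℕ} {X : Jac A} (hX : X ∈ levelLie bar ε l s h n) {i c : ℤ}
    (hin : i = n + 1 + l) (hi : l < 2 * i) (hc : l < 2 * c) (hic : i ≠ c) :
    cut k l i (swapConj k A s hi hc hic X) = cut k l c X := by
  ext a b
  rw [mask_mat, mask_mat, swapConj_mat, swapPerm_apply hi hc, swapPerm_apply hi hc]
  by_cases h1 : a = c ∨ a = l - c ∨ b = c ∨ b = l - c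
  · rw [cutCoeff, cutCoeff, if_pos h1, zero_smul]
    rw [mat_eq_zero_of_mem_levelLie hX, smul_zero, smul_zero]
    simp only [mem_levelSet]
    split_ifs <;> omega
  · by_cases h2 : a = i ∨ a = l - i ∨ b = i ∨ b = l - i
    · rw [cutCoeff, if_pos h2, zero_smul, mat_eq_zero_of_mem_levelLie hX, smul_zero]
      simp only [mem_levelSet]
      omega
    · rw [cutCoeff, cutCoeff, if_neg h1, if_neg h2, swapSign, swapSign, if_neg (by omega),
        if_neg (by omega), if_neg (by omega), if_neg (by omega), if_neg (by omega),
        if_neg (by omega), if_neg (by omega), if_neg (by omega), if_neg (by omega),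
        if_neg (by omega)]
      simp

end Mask

/-! ## Averaging over signed permutations -/

section Average

variable {k A : Type*} [Field k] [Ring A] [Algebra k A]

/-- The action of an automorphism on the exterior algebra. -/
noncomputable def extAct (φ : Jac A ≃ₐ[k] Jac A) :
    ExteriorAlgebra k (Jac A) →ₗ[k] ExteriorAlgebra k (Jac A) :=
  (ExteriorAlgebra.map (lieOf φ : Jac A →ₗ[k] Jac A)).toLinearMap

theorem extAct_apply (φ : Jac A ≃ₐ[k] Jac A) (w : ExteriorAlgebra k (Jac A)) :
    extAct φ w = ExteriorAlgebra.map (lieOf φ : Jac A →ₗ[k] Jac A) w := rfl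

theorem extAct_mul (φ ψ : Jac A ≃ₐ[k] Jac A) (w : ExteriorAlgebra k (Jac A)) :
    extAct (φ * ψ) w = extAct φ (extAct ψ w) := by
  rw [extAct_apply, extAct_apply, extAct_apply, map_map]
  rfl

theorem extAct_one (w : ExteriorAlgebra k (Jac A)) :
    extAct (1 : Jac A ≃ₐ[k] Jac A) w = w := by
  have : (lieOf (1 : Jac A ≃ₐ[k] Jac A) : Jac A →ₗ[k] Jac A) = LinearMap.id := rfl
  rw [extAct_apply, this, ExteriorAlgebra.map_id]
  rfl

theorem ceD_extAct (φ : Jac A ≃ₐ[k] Jac A) (w : ExteriorAlgebra k (Jac A)) :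
    ceD k (Jac A) (extAct φ w) = extAct φ (ceD k (Jac A) w) :=
  (map_ceD (lieOf φ) w).symm

noncomputable instance (l : ℤ) (s : ℤ → ℤˣ) (n : ℕ) : Fintype (signedGroup k A l s n) :=
  Fintype.ofFinite _

variable (l : ℤ) (s : ℤ → ℤˣ)

/-- The average over the group of signed permutations of `{-n, …, n + l}`. -/
noncomputable def avg (n : ℕ) :
    ExteriorAlgebra k (Jac A) →ₗ[k] ExteriorAlgebra k (Jac A) :=
  (Fintype.card (signedGroup k A l s n) : k)⁻¹ • ∑ φ : signedGroup k A l s n, extAct φ.1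

theorem avg_apply (n : ℕ) (w : ExteriorAlgebra k (Jac A)) :
    avg l s n w = (Fintype.card (signedGroup k A l s n) : k)⁻¹ •
      ∑ φ : signedGroup k A l s n, extAct φ.1 w := by
  rw [avg, LinearMap.smul_apply, LinearMap.sum_apply]

variable {l s}

theorem avg_extAct {n : ℕ} {φ : Jac A ≃ₐ[k] Jac A} (hφ : φ ∈ signedGroup k A l s n)
    (w : ExteriorAlgebra k (Jac A)) : avg l s n (extAct φ w) = avg l s n w := by
  rw [avg_apply, avg_apply]
  congr 1
  refine Fintype.sum_equiv (Equiv.mulRight (⟨φ, hφ⟩ : signedGroup k A l s n)) _ _ fun ψ => ?_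
  rw [← extAct_mul]
  rfl

theorem extAct_avg {n : ℕ} {φ : Jac A ≃ₐ[k] Jac A} (hφ : φ ∈ signedGroup k A l s n)
    (w : ExteriorAlgebra k (Jac A)) : extAct φ (avg l s n w) = avg l s n w := by
  rw [avg_apply, map_smul, map_sum]
  congr 1
  refine Fintype.sum_equiv (Equiv.mulLeft (⟨φ, hφ⟩ : signedGroup k A l s n)) _ _ fun ψ => ?_
  rw [← extAct_mul]
  rfl

theorem ceD_avg (n : ℕ) (w : ExteriorAlgebra k (Jac A)) :
    ceD k (Jac A) (avg l s n w) = avg l s n (ceD k (Jac A) w) := by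
  rw [avg_apply, avg_apply, map_smul, map_sum]
  simp_rw [ceD_extAct]

variable [CharZero k]

variable (l s) in
theorem card_signedGroup_ne_zero (n : ℕ) :
    (Fintype.card (signedGroup k A l s n) : k) ≠ 0 := Nat.cast_ne_zero.2 Fintype.card_ne_zero

theorem avg_eq_of_forall {n : ℕ} {w v : ExteriorAlgebra k (Jac A)}
    (h : ∀ φ ∈ signedGroup k A l s n, extAct φ w = v) : avg l s n w = v := by
  rw [avg_apply, Finset.sum_congr rfl fun (φ : signedGroup k A l s n) _ => h φ.1 φ.2,
    Finset.sum_const, Finset.card_univ, ← Nat.cast_smul_eq_nsmul k, smul_smul,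
    inv_mul_cancel₀ (card_signedGroup_ne_zero l s n), one_smul]

theorem avg_succ_avg (n : ℕ) (w : ExteriorAlgebra k (Jac A)) :
    avg l s (n + 1) (avg l s n w) = avg l s (n + 1) w := by
  nth_rw 2 [avg_apply]
  rw [map_smul, map_sum, Finset.sum_congr rfl fun (φ : signedGroup k A l s n) _ =>
    avg_extAct (signedGroup_mono (Nat.le_succ n) φ.2) w,
    Finset.sum_const, Finset.card_univ, ← Nat.cast_smul_eq_nsmul k, smul_smul,
    inv_mul_cancel₀ (card_signedGroup_ne_zero l s n), one_smul]

theorem avg_avg (n : ℕ) (w : ExteriorAlgebra k (Jac A)) :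
    avg l s n (avg l s n w) = avg l s n w :=
  avg_eq_of_forall fun _ hφ => extAct_avg hφ w

variable {bar : AntiInvolution k A} {ε : ℤˣ} {h : ∀ i, ε * s (l - i) = s i}

theorem avg_mem (hl : l = 0 ∨ l = -1) {n q : ℕ} {w : ExteriorAlgebra k (Jac A)}
    (hw : w ∈ extSub (levelLie bar ε l s h n).toSubmodule q) :
    avg l s n w ∈ extSub (levelLie bar ε l s h n).toSubmodule q := by
  rw [avg_apply]
  refine Submodule.smul_mem _ _ (Submodule.sum_mem _ fun φ _ => ?_)
  exact map_mem_extSub _ (signedGroup_mem_and_actsTrivially bar hl h le_rfl φ.2).1 hw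

/-- Each group element changes the cycle by a boundary, and these boundaries are averaged. -/
theorem exists_ceD_eq_avg_sub (hl : l = 0 ∨ l = -1) {n q : ℕ} {w : ExteriorAlgebra k (Jac A)}
    (hw : w ∈ extSub (levelLie bar ε l s h n).toSubmodule q) (hw0 : ceD k (Jac A) w = 0) :
    ∃ u ∈ extSub (levelLie bar ε l s h n).toSubmodule (q + 1),
      ceD k (Jac A) u = avg l s n w - w := by
  choose u hu hu2 using fun φ : signedGroup k A l s n =>
    (signedGroup_mem_and_actsTrivially bar hl h le_rfl φ.2).2 q w hw hw0
  refine ⟨(Fintype.card (signedGroup k A l s n) : k)⁻¹ • ∑ φ, u φ,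
    Submodule.smul_mem _ _ (Submodule.sum_mem _ fun φ _ => hu φ), ?_⟩
  rw [map_smul, map_sum, Finset.sum_congr rfl fun φ _ => hu2 φ, Finset.sum_sub_distrib,
    Finset.sum_const, Finset.card_univ, ← Nat.cast_smul_eq_nsmul k, smul_sub, smul_smul,
    inv_mul_cancel₀ (card_signedGroup_ne_zero l s n), one_smul, avg_apply]
  rfl

/-- The larger average is injective on the invariants of the smaller group. -/
theorem eq_zero_of_avg_succ_eq_zero (hl : l = 0 ∨ l = -1) {n q : ℕ}
    {y : ExteriorAlgebra k (Jac A)} (hy : y ∈ extSub (levelLie bar ε l s h n).toSubmodule q)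
    (hinv : avg l s n y = y) (h0 : avg l s (n + 1) y = 0) : y = 0 := by
  classical
  obtain ⟨i, hin⟩ : ∃ i : ℤ, i = n + 1 + l := ⟨_, rfl⟩
  have hi : l < 2 * i := by omega
  let C : ℤ → ExteriorAlgebra k (Jac A) →ₗ[k] ExteriorAlgebra k (Jac A) := fun c =>
    (ExteriorAlgebra.map (cut k l c)).toLinearMap
  have hC : ∀ c w, C c w = ExteriorAlgebra.map (cut k l c) w := fun _ _ => rfl
  have hone : C i y = y := map_eq_self_of_mem_extSub _ (fun X hX => cut_eq_self hX hin) hy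
  -- In `φ = W * (T * ψ)` the factor `ψ` fixes `y` by invariance and `T` fixes it because `y` has
  -- level `n`. Only the transposition `W` matters, and after the deletion at `i` it amounts to the
  -- deletion at some `c`.
  have key : ∀ φ : signedGroup k A l s (n + 1), ∃ c, C i (extAct φ.1 y) = C c y := by
    rintro ⟨φ, hφ⟩
    obtain ⟨W, T, ψ, rfl, hψ, hT, hW⟩ := exists_factorization h hin hi hφ
    have e1 : extAct ψ y = y := by rw [← hinv, extAct_avg hψ]
    have e2 : extAct T y = y := by
      rcases hT with rfl | rfl
      · exact extAct_one y
      · exact map_eq_self_of_mem_extSub _ (fun X hX => signConj_eq_self hX hin hi) hy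
    rw [extAct_mul, extAct_mul, e1, e2]
    rcases hW with rfl | ⟨c, hc, hic, -, rfl⟩
    · exact ⟨i, by rw [extAct_one]⟩
    · refine ⟨c, ?_⟩
      rw [hC, hC, extAct_apply, map_map]
      exact map_congr_of_mem_extSub _ _ (fun X hX => cut_swapConj hX hin hi hc hic) hy
  choose c hc using key
  have hsum : ∑ φ : signedGroup k A l s (n + 1), extAct φ.1 y = 0 := by
    rw [avg_apply] at h0
    exact (smul_eq_zero.1 h0).resolve_left (inv_ne_zero (card_signedGroup_ne_zero l s (n + 1)))
  -- The identity of the group contributes `y` itself with coefficient `1`, since `C i y = y`; every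
  -- other group element contributes one idempotent.
  refine eq_zero_of_sum_idempotents C ?_ ?_ c (Finset.univ.erase 1) 1 one_pos y ?_
  · intro j w
    rw [hC, hC, map_map]
    congr 2
    exact LinearMap.ext fun X => cut_cut l j X
  · intro j j' w
    rw [hC, hC, hC, hC, map_map, map_map]
    congr 2
    exact LinearMap.ext fun X => cut_comm l j j' X
  · have := congrArg (C i) hsum
    rw [map_sum, map_zero, ← Finset.add_sum_erase _ _ (Finset.mem_univ 1)] at this
    rw [← this, Nat.cast_one, one_smul, OneMemClass.coe_one, extAct_one, hone]
    congr 1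
    exact Finset.sum_congr rfl fun φ _ => (hc φ).symm

end Average

/-! ### Decomposition of skew matrices by unsigned indices -/

section Homogeneous

/-- The larger of `i` and `l - i`. -/
def absIdx (l i : ℤ) : ℤ := max i (l - i)

theorem absIdx_eq_iff {l c : ℤ} (hc : l < 2 * c) (i : ℤ) : absIdx l i = c ↔ i = c ∨ i = l - c := by
  rw [absIdx]; omega

theorem absIdx_sub (l i : ℤ) : absIdx l (l - i) = absIdx l i := by
  rw [absIdx, absIdx]; omega

theorem absIdx_mem {l : ℤ} (hl : l = 0 ∨ l = -1) {n : ℕ} {i : ℤ} (hi : i ∈ levelSet l n) :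
    absIdx l i ∈ Finset.Icc 0 (n + l) := by
  rw [mem_levelSet] at hi
  rw [Finset.mem_Icc, absIdx]
  omega

variable {k A : Type*} [Field k] [Ring A] [Algebra k A]

/-- The nonzero entries of `X` lie in positions `(±a, ±b)` or `(±b, ±a)`. -/
def IsHomog (l : ℤ) (X : Jac A) (a b : ℤ) : Prop := ∀ i j, X.mat i j ≠ 0 →
  (absIdx l i = a ∧ absIdx l j = b) ∨ (absIdx l i = b ∧ absIdx l j = a)

/-- Coefficients of the projection to the homogeneous matrices. -/
noncomputable def homogCoeff (k : Type*) [Field k] (l a b i j : ℤ) : k :=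
  2⁻¹ * ((if absIdx l i = a ∧ absIdx l j = b then 1 else 0)
    + (if absIdx l i = b ∧ absIdx l j = a then 1 else 0))

variable {bar : AntiInvolution k A} {ε : ℤˣ} {l : ℤ} {s : ℤ → ℤˣ} {h : ∀ i, ε * s (l - i) = s i}

/-- The anti-involution exchanges row and column indices up to reflection, so only the sum
symmetrized in `a` and `b` preserves skewness; this is why homogeneity allows both orders. -/
theorem homogCoeff_sub (a b i j : ℤ) :
    homogCoeff k l a b (l - j) (l - i) = homogCoeff k l a b i j := by
  rw [homogCoeff, homogCoeff, absIdx_sub, absIdx_sub, add_comm]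
  congr 3 <;> rw [and_comm]

/-- Summing over ordered pairs counts each position twice, which the factor `2⁻¹` corrects. -/
theorem sum_homogCoeff [CharZero k] {S : Finset ℤ} {i j : ℤ} (hi : absIdx l i ∈ S)
    (hj : absIdx l j ∈ S) : ∑ a ∈ S, ∑ b ∈ S, homogCoeff k l a b i j = 1 := by
  simp_rw [homogCoeff, ← Finset.mul_sum, Finset.sum_add_distrib, ite_and]
  have h1 : ∑ a ∈ S, ∑ b ∈ S, (if absIdx l i = a then if absIdx l j = b then (1 : k) else 0 else 0)
      = 1 := by simp [hi, hj]
  have h2 : ∑ a ∈ S, ∑ b ∈ S, (if absIdx l i = b then if absIdx l j = a then (1 : k) else 0 else 0)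
      = 1 := by simp [hi, hj]
  rw [h1, h2]
  norm_num

theorem levelLie_le_span_isHomog [CharZero k] (hl : l = 0 ∨ l = -1) (n : ℕ) :
    (levelLie bar ε l s h n).toSubmodule
      ≤ Submodule.span k {X | X ∈ levelLie bar ε l s h n ∧ ∃ a b, IsHomog l X a b} := by
  intro X hX
  have e : X = ∑ a ∈ Finset.Icc 0 (n + l), ∑ b ∈ Finset.Icc 0 (n + l),
      mask (homogCoeff k l a b) X := by
    ext i j
    let ev : Jac A →+ A := ⟨⟨fun X => X.mat i j, rfl⟩, fun _ _ => rfl⟩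
    change ev X = ev _
    simp only [map_sum]
    change X.mat i j = ∑ a ∈ Finset.Icc 0 (n + l), ∑ b ∈ Finset.Icc 0 (n + l),
      homogCoeff k l a b i j • X.mat i j
    by_cases hij : i ∈ levelSet l n ∧ j ∈ levelSet l n
    · simp_rw [← Finset.sum_smul]
      rw [sum_homogCoeff (absIdx_mem hl hij.1) (absIdx_mem hl hij.2), one_smul]
    · rw [mat_eq_zero_of_mem_levelLie hX hij]
      simp
  rw [e]
  refine Submodule.sum_mem _ fun a _ => Submodule.sum_mem _ fun b _ =>
    Submodule.subset_span ⟨mask_mem (homogCoeff_sub a b) hX, a, b, ?_⟩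
  intro i j hij
  by_contra hc
  rw [not_or] at hc
  rw [mask_mat, homogCoeff, if_neg hc.1, if_neg hc.2] at hij
  simp at hij

/-- The sign at an index depends only on its unsigned value, so it is constant on the support of a
homogeneous matrix. -/
theorem signConj_of_isHomog {X : Jac A} {a b : ℤ} (hX : IsHomog l X a b) {c : ℤ}
    (hc : l < 2 * c) :
    signConj k A hc X = ((if a = c then -1 else 1) * (if b = c then -1 else 1) : k) • X := by
  have hs : ∀ i, signAt l c i = if absIdx l i = c then -1 else 1 := by
    intro i
    simp only [signAt, absIdx_eq_iff hc]
  ext i j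
  rw [signConj_mat, hs, hs, Jac.mat_smul, Pi.smul_apply, Pi.smul_apply]
  by_cases h0 : X.mat i j = 0
  · rw [h0, smul_zero, smul_zero]
  · rcases hX i j h0 with ⟨h1, h2⟩ | ⟨h1, h2⟩ <;> rw [h1, h2] <;> split_ifs <;> simp

end Homogeneous

/-- Among `n + 1` values one is taken at most once in two lists of length `q ≤ n`. -/
theorem exists_card_add_card_le_one {q n : ℕ} (hq : q ≤ n) (a b : Fin q → ℤ) {S : Finset ℤ}
    (hS : S.card = n + 1) : ∃ c ∈ S, (Finset.univ.filter fun t => a t = c).card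
      + (Finset.univ.filter fun t => b t = c).card ≤ 1 := by
  by_contra! hcon
  have aux : ∀ a : Fin q → ℤ, ∑ c ∈ S, (Finset.univ.filter fun t => a t = c).card ≤ q := by
    intro a
    simp_rw [Finset.card_filter]
    rw [Finset.sum_comm]
    refine (Finset.sum_le_card_nsmul _ _ 1 fun t _ => ?_).trans (by simp)
    rw [Finset.sum_ite_eq]
    split_ifs <;> simp
  have h1 := Finset.card_nsmul_le_sum S _ 2 fun c hc => hcon c hc
  rw [Finset.sum_add_distrib, hS, smul_eq_mul] at h1
  have h2 := aux a
  have h3 := aux b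
  omega

/-! ### Stability from one level to the next and in the limit -/

section Stability

variable {k A : Type*} [Field k] [Ring A] [Algebra k A] {bar : AntiInvolution k A}
  {ε : ℤˣ} {l : ℤ} {s : ℤ → ℤˣ} {h : ∀ i, ε * s (l - i) = s i}

theorem mem_levelLie_of_succ {n : ℕ} {i : ℤ} (hin : i = n + 1 + l) {X : Jac A}
    (hX : X ∈ levelLie bar ε l s h (n + 1))
    (h0 : ∀ a b, X.mat a b ≠ 0 → a ≠ i ∧ a ≠ l - i) : X ∈ levelLie bar ε l s h n := by
  rw [mem_levelLie] at hX ⊢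
  refine ⟨hX.1, fun a b hab => ?_⟩
  have h1 := hX.2 a b hab
  have h2 := h0 a b hab
  rw [mem_levelSet] at h1 ⊢
  push_cast at h1
  omega

variable [CharZero k]

/-- In degree `q ≤ n`, the larger average is determined on the smaller Lie algebra. -/
theorem exists_avg_succ_eq (hl : l = 0 ∨ l = -1) {n q : ℕ} (hq : q ≤ n)
    {z : ExteriorAlgebra k (Jac A)}
    (hz : z ∈ extSub (levelLie bar ε l s h (n + 1)).toSubmodule q) :
    ∃ u ∈ extSub (levelLie bar ε l s h n).toSubmodule q,
      avg l s (n + 1) z = avg l s (n + 1) u := by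
  refine extSub_induction (levelLie_le_span_isHomog hl (n + 1))
    (P := fun z => ∃ u ∈ extSub (levelLie bar ε l s h n).toSubmodule q,
      avg l s (n + 1) z = avg l s (n + 1) u) ⟨0, zero_mem _, rfl⟩ ?_ ?_ ?_ hz
  · rintro x y ⟨u, hu, hu2⟩ ⟨v, hv, hv2⟩
    exact ⟨u + v, add_mem hu hv, by rw [map_add, map_add, hu2, hv2]⟩
  · rintro c x ⟨u, hu, hu2⟩
    exact ⟨c • u, Submodule.smul_mem _ _ hu, by rw [map_smul, map_smul, hu2]⟩
  · intro v hv
    choose hv1 a b hab using hv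
    -- The interval contains the `n + 1` indices above `l / 2`, while the `q ≤ n` factors provide
    -- only `2q` slots. The central index, present for `l = 0`, is left out because it has no sign
    -- change.
    obtain ⟨c, hcS, hcard⟩ := exists_card_add_card_le_one hq a b
      (S := Finset.Icc (1 + l) (n + 1 + l)) (by rw [Int.card_Icc]; omega)
    rw [Finset.mem_Icc] at hcS
    have hc : l < 2 * c := by omega
    have hcL : c ∈ levelSet l (n + 1) := by rw [mem_levelSet]; push_cast; omega
    obtain ⟨i, hin⟩ : ∃ i : ℤ, i = n + 1 + l := ⟨_, rfl⟩
    have hi : l < 2 * i := by omega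
    have hiL : i ∈ levelSet l (n + 1) := by rw [mem_levelSet]; push_cast; omega
    -- If `c` is unused, exchanging it with the top index `i` brings every factor into level `n`
    -- without altering the average. If `c` occurs once, the sign change at `c` negates the product,
    -- so its average is zero.
    rcases Nat.le_one_iff_eq_zero_or_eq_one.1 hcard with h0 | h1
    · have hne : ∀ t, a t ≠ c ∧ b t ≠ c := by
        intro t
        have h1 : (Finset.univ.filter fun t => a t = c) = ∅ := Finset.card_eq_zero.1 (by omega)
        have h2 : (Finset.univ.filter fun t => b t = c) = ∅ := Finset.card_eq_zero.1 (by omega)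
        constructor <;> intro hh
        · have : t ∈ (Finset.univ.filter fun t => a t = c) := by simp [hh]
          rw [h1] at this
          simp at this
        · have : t ∈ (Finset.univ.filter fun t => b t = c) := by simp [hh]
          rw [h2] at this
          simp at this
      have hrow : ∀ t x y, (v t).mat x y ≠ 0 → x ≠ c ∧ x ≠ l - c := by
        intro t x y hxy
        rw [← not_or, ← absIdx_eq_iff hc]
        rcases hab t x y hxy with ⟨h1, -⟩ | ⟨h1, -⟩ <;> rw [h1]
        · exact (hne t).1
        · exact (hne t).2
      by_cases hic : i = c
      · refine ⟨_, ιMulti_mem_extSub fun t => mem_levelLie_of_succ hin (hv1 t) fun x y hxy => ?_,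
          rfl⟩
        rw [hic]
        exact hrow t x y hxy
      · have hW := swapConj_mem_signedGroup k A h hi hc hic hiL hcL
        refine ⟨extAct (swapConj k A s hi hc hic) (ExteriorAlgebra.ιMulti k q v), ?_,
          (avg_extAct hW _).symm⟩
        rw [extAct_apply, ExteriorAlgebra.map_apply_ιMulti]
        refine ιMulti_mem_extSub fun t => mem_levelLie_of_succ hin
          (swapConj_mem hi hc hic hiL hcL (hv1 t)) fun x y hxy => ?_
        have hxy' : (v t).mat (swapPerm l i c x) (swapPerm l i c y) ≠ 0 := by
          intro h0
          refine hxy ?_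
          change (swapConj k A s hi hc hic (v t)).mat x y = 0
          rw [swapConj_mat, h0, smul_zero]
        have := hrow t _ _ hxy'
        rw [swapPerm_apply hi hc] at this
        constructor
        · rintro rfl
          rw [if_pos rfl] at this
          exact this.1 rfl
        · rintro rfl
          rw [if_neg (by omega), if_neg (by omega), if_pos rfl] at this
          exact this.2 rfl
    · refine ⟨0, zero_mem _, ?_⟩
      have hT := signConj_mem_signedGroup k A s hc hcL
      have e : extAct (signConj k A hc) (ExteriorAlgebra.ιMulti k q v)
          = -ExteriorAlgebra.ιMulti k q v := by
        rw [extAct_apply, map_ιMulti_of_eigen v _ fun t => signConj_of_isHomog (hab t) hc,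
          Finset.prod_mul_distrib, Finset.prod_ite, Finset.prod_ite, Finset.prod_const,
          Finset.prod_const_one, Finset.prod_const, Finset.prod_const_one, mul_one, mul_one,
          ← pow_add, h1, pow_one, neg_one_smul]
      have e2 := avg_extAct hT (ExteriorAlgebra.ιMulti k q v)
      rw [e, map_neg] at e2
      rw [map_zero]
      have e3 : (2 : k) • avg l s (n + 1) (ExteriorAlgebra.ιMulti k q v) = 0 := by
        rw [two_smul]
        nth_rw 1 [← e2]
        exact neg_add_cancel _
      exact (smul_eq_zero.1 e3).resolve_left two_ne_zero

/-- The bound `q + 1 ≤ n` is needed because the chain of degree `q + 1` that bounds `y` must be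
replaced by one of level `n` with the same larger average. -/
theorem levelLie_succ_injective (hl : l = 0 ∨ l = -1) {n q : ℕ} (hq : q + 1 ≤ n)
    {y z : ExteriorAlgebra k (Jac A)} (hy : y ∈ extSub (levelLie bar ε l s h n).toSubmodule q)
    (hz : z ∈ extSub (levelLie bar ε l s h (n + 1)).toSubmodule (q + 1))
    (hzy : ceD k (Jac A) z = y) :
    ∃ u ∈ extSub (levelLie bar ε l s h n).toSubmodule (q + 1), ceD k (Jac A) u = y := by
  have hy0 : ceD k (Jac A) y = 0 := by rw [← hzy, ceD_ceD]
  obtain ⟨u, hu, hzu⟩ := exists_avg_succ_eq hl hq hz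
  -- The larger average of `y - d u` is `d` of the difference of the averages of `z` and `u`, hence
  -- zero; injectivity on invariants descends this to the smaller average.
  have key : avg l s n (y - ceD k (Jac A) u) = 0 := by
    refine eq_zero_of_avg_succ_eq_zero (bar := bar) (h := h) hl
      (avg_mem hl (sub_mem hy (ceD_mem_extSub _ hu))) (avg_avg _ _) ?_
    rw [avg_succ_avg, map_sub, ← ceD_avg, ← hzu, ceD_avg, hzy, sub_self]
  obtain ⟨v, hv, hv2⟩ := exists_ceD_eq_avg_sub hl hy hy0
  refine ⟨avg l s n u - v, sub_mem (avg_mem hl hu) hv, ?_⟩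
  rw [map_sub, sub_eq_zero] at key
  rw [map_sub, hv2, ceD_avg, ← key]
  abel

/-- The cycle `z` is homologous to its larger average, which is also the larger average of the
invariant chain `avg l s n y`. That chain is closed by injectivity on invariants, hence homologous
to its own larger average. -/
theorem levelLie_succ_surjective (hl : l = 0 ∨ l = -1) {n q : ℕ} (hq : q ≤ n)
    {z : ExteriorAlgebra k (Jac A)}
    (hz : z ∈ extSub (levelLie bar ε l s h (n + 1)).toSubmodule q) (hz0 : ceD k (Jac A) z = 0) :
    ∃ y ∈ extSub (levelLie bar ε l s h n).toSubmodule q, ceD k (Jac A) y = 0 ∧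
      ∃ u ∈ extSub (levelLie bar ε l s h (n + 1)).toSubmodule (q + 1),
        ceD k (Jac A) u = z - y := by
  obtain ⟨y, hy, hzy⟩ := exists_avg_succ_eq hl hq hz
  have hle : (levelLie bar ε l s h n).toSubmodule ≤ (levelLie bar ε l s h (n + 1)).toSubmodule :=
    levelLie_mono (Nat.le_succ n)
  have hy0 : ceD k (Jac A) (avg l s n y) = 0 := by
    have h0 : avg l s (n + 1) (ceD k (Jac A) (avg l s n y)) = 0 := by
      rw [← ceD_avg, avg_succ_avg, ← hzy, ceD_avg, hz0, map_zero]
    have hinv : avg l s n (ceD k (Jac A) (avg l s n y)) = ceD k (Jac A) (avg l s n y) := by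
      rw [← ceD_avg, avg_avg]
    -- Injectivity is applied to the differential, which has degree one less; in degree `0` the
    -- differential vanishes outright.
    cases q with
    | zero =>
      refine extSub_induction (S := ((levelLie bar ε l s h n).toSubmodule : Set (Jac A)))
        (P := fun w => ceD k (Jac A) w = 0) (by simp) (map_zero _) ?_ ?_ ?_
        (avg_mem (bar := bar) (h := h) hl hy)
      · intro a b ha hb
        rw [map_add, ha, hb, add_zero]
      · intro c a ha
        rw [map_smul, ha, smul_zero]
      · intro v _
        rw [ExteriorAlgebra.ιMulti_zero_apply, ceD_one]
    | succ q =>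
      exact eq_zero_of_avg_succ_eq_zero (bar := bar) (h := h) hl
        (ceD_mem_extSub _ (avg_mem hl hy)) hinv h0
  have hyn := avg_mem hl hy
  obtain ⟨u, hu, hu2⟩ := exists_ceD_eq_avg_sub hl hz hz0
  obtain ⟨v, hv, hv2⟩ := exists_ceD_eq_avg_sub hl (extSub_mono hle q hyn) hy0
  refine ⟨avg l s n y, hyn, hy0, v - u, sub_mem hv hu, ?_⟩
  rw [map_sub, hu2, hv2, avg_succ_avg, hzy]
  abel

/-- Homological stability. -/
theorem nonempty_lieHomology_levelLie_equiv (hl : l = 0 ∨ l = -1) (U : LieSubalgebra k (Jac A))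
    (hU : ∀ X, X ∈ U ↔ ∃ n, X ∈ levelLie bar ε l s h n) (q : ℕ) :
    Nonempty (LieHomology k (levelLie bar ε l s h (q + 1)) q ≃ₗ[k] LieHomology k U q) := by
  have hle : ∀ n, levelLie bar ε l s h n ≤ U := fun n X hX => (hU X).2 ⟨n, hX⟩
  have hmono : Monotone fun n => (levelLie bar ε l s h n).toSubmodule := fun n m hnm =>
    levelLie_mono hnm
  -- A chain of the union involves finitely many matrices, so it lives at some level, which may be
  -- taken to be at least `q + 1`.
  have hex : ∀ {p : ℕ} {w}, w ∈ extSub U.toSubmodule p →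
      ∃ m, q + 1 ≤ m ∧ w ∈ extSub (levelLie bar ε l s h m).toSubmodule p := by
    intro p w hw
    obtain ⟨m, hm⟩ := exists_mem_extSub_of_iUnion hmono (fun X hX => (hU X).1 hX) hw
    exact ⟨max (q + 1) m, le_max_left _ _, extSub_mono (hmono (le_max_right _ _)) p hm⟩
  -- The bounding chain is lowered one level at a time. Level `q + 1` is where the degree bound of
  -- the injectivity step, `q + 1 ≤ m`, allows the descent to end.
  have hinj : ∀ m, q + 1 ≤ m → ∀ y ∈ extSub (levelLie bar ε l s h (q + 1)).toSubmodule q,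
      ∀ z ∈ extSub (levelLie bar ε l s h m).toSubmodule (q + 1), ceD k (Jac A) z = y →
      ∃ u ∈ extSub (levelLie bar ε l s h (q + 1)).toSubmodule (q + 1), ceD k (Jac A) u = y := by
    intro m hm
    induction m, hm using Nat.le_induction with
    | base => exact fun y _ z hz hzy => ⟨z, hz, hzy⟩
    | succ m hm ih =>
      intro y hy z hz hzy
      obtain ⟨u, hu, huy⟩ := levelLie_succ_injective hl hm (extSub_mono (hmono hm) q hy) hz hzy
      exact ih y hy u hu huy
  have hsurj : ∀ m, q + 1 ≤ m → ∀ z ∈ extSub (levelLie bar ε l s h m).toSubmodule q,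
      ceD k (Jac A) z = 0 → ∃ y ∈ extSub (levelLie bar ε l s h (q + 1)).toSubmodule q,
        ceD k (Jac A) y = 0 ∧ ∃ u ∈ extSub U.toSubmodule (q + 1), ceD k (Jac A) u = z - y := by
    intro m hm
    induction m, hm using Nat.le_induction with
    | base => exact fun z hz hz0 => ⟨z, hz, hz0, 0, zero_mem _, by rw [map_zero, sub_self]⟩
    | succ m hm ih =>
      intro z hz hz0
      obtain ⟨y, hy, hy0, u, hu, huz⟩ := levelLie_succ_surjective hl (by omega) hz hz0
      obtain ⟨x, hx, hx0, v, hv, hvz⟩ := ih y hy hy0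
      refine ⟨x, hx, hx0, u + v, add_mem (extSub_mono (hle _) _ hu) hv, ?_⟩
      rw [map_add, huz, hvz]
      abel
  refine nonempty_lieHomology_equiv_of_le (hle _) q ?_ ?_
  · intro y hy z hz hzy
    obtain ⟨m, hm, hzm⟩ := hex hz
    exact hinj m hm y hy z hzm hzy
  · intro z hz hz0
    obtain ⟨m, hm, hzm⟩ := hex hz
    exact hsurj m hm z hzm hz0

end Stability

/-! ## Banded matrices as finite block matrices with banded entries -/

section Block

/-- Division with remainder, shifted by `N` so that the remainders fill the window `{-N, …, N + l}`
of length `d`, which is stable under `m ↦ l - m`. -/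
theorem exists_block {l : ℤ} {N : ℕ} {d : ℤ} (hd : d = 2 * N + 1 + l) (hd0 : 0 < d) (v : ℤ) :
    ∃ c m : ℤ, m ∈ levelSet l N ∧ v = d * c + m := by
  have h1 := Int.emod_nonneg (v + N) hd0.ne'
  have h2 := Int.emod_lt_of_pos (v + N) hd0
  have h3 := Int.emod_add_mul_ediv (v + N) d
  exact ⟨(v + N) / d, (v + N) % d - N, ⟨by omega, by omega⟩, by omega⟩

theorem block_unique {l : ℤ} {N : ℕ} {d : ℤ} (hd : d = 2 * N + 1 + l) {c c' m m' : ℤ}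
    (hm : m ∈ levelSet l N) (hm' : m' ∈ levelSet l N)
    (h : d * c + m = d * c' + m') : c = c' ∧ m = m' := by
  rw [mem_levelSet] at hm hm'
  have hc : c = c' := by
    rcases lt_trichotomy c c' with hc | hc | hc
    · nlinarith
    · exact hc
    · nlinarith
  subst hc
  exact ⟨rfl, by omega⟩

theorem finsum_block {M : Type*} [AddCommMonoid M] {l : ℤ} {N : ℕ} {d : ℤ}
    (hd : d = 2 * N + 1 + l) (hd0 : 0 < d) (f : ℤ → M) (hf : f.support.Finite) :
    ∑ᶠ v, f v = ∑ m ∈ Finset.Icc (-(N : ℤ)) (N + l), ∑ᶠ c, f (d * c + m) := by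
  let I := Finset.Icc (-(N : ℤ)) (N + l)
  have hI : ∀ m : I, (m : ℤ) ∈ levelSet l N := fun m => by
    rw [mem_levelSet, ← Finset.mem_Icc]; exact m.2
  let e : I × ℤ ≃ ℤ := Equiv.ofBijective (fun p => d * p.2 + p.1) ⟨by
      rintro ⟨m, c⟩ ⟨m', c'⟩ hh
      obtain ⟨h1, h2⟩ := block_unique hd (hI m) (hI m') hh
      exact Prod.ext (Subtype.ext h2) h1, by
      intro v
      obtain ⟨c, m, hm, rfl⟩ := exists_block hd hd0 v
      exact ⟨(⟨m, Finset.mem_Icc.2 hm⟩, c), rfl⟩⟩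
  rw [← finsum_comp_equiv e, finsum_curry, finsum_eq_sum_of_fintype]
  · exact Finset.sum_coe_sort I fun m => ∑ᶠ c, f (d * c + m)
  · exact (hf.preimage e.injective.injOn)

variable {k R : Type*} [Field k] [Ring R] [Algebra k R]

/-- The block of a banded matrix in position `(i, j)`. -/
def blockEntry (Z : Jac R) {d : ℤ} (hd0 : 0 < d) (i j : ℤ) : Jac R :=
  Jac.mk (fun a b => Z.mat (d * a + i) (d * b + j)) (by
    obtain ⟨M, hM⟩ := Z.band
    -- The offset `i - j` can bring the two indices closer by at most its absolute value, and
    -- scaling by `d ≥ 1` does not shrink `a - b`.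
    refine ⟨M + (i - j).natAbs, fun a b hab => hM _ _ ?_⟩
    push_cast at hab
    have h1 : |d * (a - b)| ≥ |a - b| := by
      rw [abs_mul, abs_of_pos hd0]
      nlinarith [abs_nonneg (a - b)]
    have h2 := abs_sub_abs_le_abs_sub (d * (a - b)) (-(i - j))
    rw [abs_neg] at h2
    have h3 : d * (a - b) - -(i - j) = d * a + i - (d * b + j) := by ring
    rw [h3] at h2
    linarith)

@[simp] theorem blockEntry_mat (Z : Jac R) {d : ℤ} (hd0 : 0 < d) (i j a b : ℤ) :
    (blockEntry Z hd0 i j).mat a b = Z.mat (d * a + i) (d * b + j) := rfl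

open Classical in
/-- The finite matrix of blocks of a banded matrix. -/
noncomputable def toBlocks (l : ℤ) (N : ℕ) {d : ℤ} (hd0 : 0 < d) (Z : Jac R) : Jac (Jac R) :=
  Jac.mk (fun i j => if i ∈ levelSet l N ∧ j ∈ levelSet l N then blockEntry Z hd0 i j else 0)
    ⟨2 * N + l.natAbs, fun i j hij => if_neg (by
      rintro ⟨hi, hj⟩
      rw [mem_levelSet] at hi hj
      push_cast at hij
      have h1 := le_abs_self l
      rw [lt_abs] at hij
      omega)⟩

theorem toBlocks_mat {l : ℤ} {N : ℕ} {d : ℤ} (hd0 : 0 < d) (Z : Jac R) {i j : ℤ}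
    (hi : i ∈ levelSet l N) (hj : j ∈ levelSet l N) (a b : ℤ) :
    ((toBlocks l N hd0 Z).mat i j).mat a b = Z.mat (d * a + i) (d * b + j) := by
  rw [toBlocks, Jac.mat_mk, if_pos ⟨hi, hj⟩, blockEntry_mat]

theorem toBlocks_mat_of_not {l : ℤ} {N : ℕ} {d : ℤ} (hd0 : 0 < d) (Z : Jac R) {i j : ℤ}
    (hij : ¬ (i ∈ levelSet l N ∧ j ∈ levelSet l N)) : (toBlocks l N hd0 Z).mat i j = 0 := by
  rw [toBlocks, Jac.mat_mk, if_neg hij]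

theorem toBlocks_ext {l : ℤ} {N : ℕ} {d : ℤ} (hd0 : 0 < d) {Z : Jac R} {X : Jac (Jac R)}
    (h1 : ∀ i ∈ levelSet l N, ∀ j ∈ levelSet l N, ∀ a b,
      Z.mat (d * a + i) (d * b + j) = (X.mat i j).mat a b)
    (h2 : ∀ i j, ¬ (i ∈ levelSet l N ∧ j ∈ levelSet l N) → X.mat i j = 0) :
    toBlocks l N hd0 Z = X := by
  ext i j a b
  by_cases hij : i ∈ levelSet l N ∧ j ∈ levelSet l N
  · rw [toBlocks_mat hd0 Z hij.1 hij.2, h1 i hij.1 j hij.2]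
  · rw [toBlocks_mat_of_not hd0 Z hij, h2 i j hij]

variable (k) in
/-- `toBlocks` as a linear map. -/
noncomputable def toBlocksLin (l : ℤ) (N : ℕ) {d : ℤ} (hd0 : 0 < d) :
    Jac R →ₗ[k] Jac (Jac R) where
  toFun := toBlocks l N hd0
  map_add' Z W := by
    refine toBlocks_ext hd0 (fun i hi j hj a b => ?_) fun i j hij => ?_
    · simp [toBlocks_mat hd0 _ hi hj]
    · simp [toBlocks_mat_of_not hd0 _ hij]
  map_smul' c Z := by
    refine toBlocks_ext hd0 (fun i hi j hj a b => ?_) fun i j hij => ?_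
    · simp [toBlocks_mat hd0 _ hi hj]
    · simp [toBlocks_mat_of_not hd0 _ hij]

theorem finite_support_mul (Z W : Jac R) (i j : ℤ) :
    (fun v => Z.mat i v * W.mat v j).support.Finite := by
  obtain ⟨M, hM⟩ := Z.band
  refine (Set.finite_Icc (i - M) (i + M)).subset fun v hv => ?_
  by_contra hc
  refine hv ?_
  have : (M : ℤ) < |i - v| := by
    rw [Set.mem_Icc] at hc
    rw [lt_abs]
    omega
  change Z.mat i v * W.mat v j = 0
  rw [hM i v this, zero_mul]

/-- In the product the summation index is split as `d * c + m`: the sum over `m` multiplies block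
matrices and the sum over `c` multiplies blocks. -/
theorem toBlocks_mul {l : ℤ} {N : ℕ} {d : ℤ} (hd : d = 2 * N + 1 + l) (hd0 : 0 < d)
    (Z W : Jac R) : toBlocks l N hd0 (Z * W) = toBlocks l N hd0 Z * toBlocks l N hd0 W := by
  have hI : ∀ m, m ∈ Finset.Icc (-(N : ℤ)) (N + l) ↔ m ∈ levelSet l N := fun m => Finset.mem_Icc
  have hmul : ∀ i j, (toBlocks l N hd0 Z * toBlocks l N hd0 W).mat i j
      = ∑ m ∈ Finset.Icc (-(N : ℤ)) (N + l),
        (toBlocks l N hd0 Z).mat i m * (toBlocks l N hd0 W).mat m j := by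
    intro i j
    rw [Jac.mat_mul]
    refine Jac.zmul_eq_sum _ _ _ _ _ fun m hm => ?_
    rw [toBlocks_mat_of_not hd0 Z fun hh => hm ((hI m).2 hh.2), zero_mul]
  refine toBlocks_ext hd0 (fun i hi j hj a b => ?_) fun i j hij => ?_
  · let ev : Jac R →+ R := ⟨⟨fun X => X.mat a b, rfl⟩, fun _ _ => rfl⟩
    rw [hmul]
    change _ = ev _
    rw [map_sum, Jac.mat_mul_apply, finsum_block hd hd0 _ (finite_support_mul _ _ _ _)]
    refine Finset.sum_congr rfl fun m hm => ?_
    change _ = ((toBlocks l N hd0 Z).mat i m * (toBlocks l N hd0 W).mat m j).mat a b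
    rw [Jac.mat_mul_apply]
    refine finsum_congr fun c => ?_
    rw [toBlocks_mat hd0 Z hi ((hI m).1 hm), toBlocks_mat hd0 W ((hI m).1 hm) hj]
  · rw [hmul]
    refine Finset.sum_eq_zero fun m _ => ?_
    rw [not_and_or] at hij
    rcases hij with hi | hj
    · rw [toBlocks_mat_of_not hd0 Z fun hh => hi hh.1, zero_mul]
    · rw [toBlocks_mat_of_not hd0 W fun hh => hj hh.2, mul_zero]

theorem toBlocks_injective {l : ℤ} {N : ℕ} {d : ℤ} (hd : d = 2 * N + 1 + l) (hd0 : 0 < d) :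
    Function.Injective (toBlocks l N hd0 : Jac R → Jac (Jac R)) := by
  intro Z W hZW
  ext u v
  obtain ⟨a, i, hi, rfl⟩ := exists_block hd hd0 u
  obtain ⟨b, j, hj, rfl⟩ := exists_block hd hd0 v
  rw [← toBlocks_mat hd0 Z hi hj, hZW, toBlocks_mat hd0 W hi hj]

theorem exists_toBlocks_eq {l : ℤ} {N : ℕ} {d : ℤ} (hd : d = 2 * N + 1 + l) (hd0 : 0 < d)
    {X : Jac (Jac R)} (hX : ∀ i j, ¬ (i ∈ levelSet l N ∧ j ∈ levelSet l N) → X.mat i j = 0) :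
    ∃ Z : Jac R, toBlocks l N hd0 Z = X := by
  choose c m hm hv using exists_block hd hd0
  choose M hM using fun p : ℤ × ℤ => (X.mat p.1 p.2).band
  let S := Finset.Icc (-(N : ℤ)) (N + l)
  let T : ℕ := (S ×ˢ S).sup M
  have hT : ∀ u v, M (m u, m v) ≤ T := fun u v =>
    Finset.le_sup (f := M) (Finset.mem_product.2 ⟨Finset.mem_Icc.2 (hm u), Finset.mem_Icc.2 (hm v)⟩)
  -- There are finitely many blocks, so `T` bounds all their widths. Indices with quotients at
  -- distance at most `T` differ by at most `d * T + d`, the last term accounting for the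
  -- remainders.
  refine ⟨Jac.mk (fun u v => (X.mat (m u) (m v)).mat (c u) (c v)) ⟨d.toNat * T + d.toNat, ?_⟩, ?_⟩
  · intro u v huv
    refine hM (m u, m v) _ _ ?_
    by_contra hc
    have h1 : |c u - c v| ≤ T := (not_lt.1 hc).trans (by exact_mod_cast hT u v)
    have h2 := hm u
    have h3 := hm v
    rw [mem_levelSet] at h2 h3
    push_cast at huv
    rw [Int.toNat_of_nonneg hd0.le] at huv
    have h4 : |u - v| ≤ d * T + d := by
      have e : u - v = d * (c u - c v) + (m u - m v) := by
        nth_rw 1 [hv u, hv v]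
        ring
      rw [e]
      refine (abs_add_le _ _).trans (add_le_add ?_ ?_)
      · rw [abs_mul, abs_of_pos hd0]
        exact mul_le_mul_of_nonneg_left h1 hd0.le
      · rw [abs_le]
        omega
    omega
  · refine toBlocks_ext hd0 (fun i hi j hj a b => ?_) hX
    obtain ⟨h1, h2⟩ := block_unique hd (hm (d * a + i)) hi (hv _).symm
    obtain ⟨h3, h4⟩ := block_unique hd (hm (d * b + j)) hj (hv _).symm
    rw [Jac.mat_mk, h1, h2, h3, h4]

variable (bar : AntiInvolution k R) {ε : ℤˣ} {l : ℤ} {s : ℤ → ℤˣ} (h : ∀ i, ε * s (l - i) = s i)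

/-- The identity `l - (d * a + i) = d * (-a) + (l - i)` splits the reflection into `i ↦ l - i` on
blocks and `a ↦ -a` inside a block, and the inner reflection is `starJ`. By periodicity the signs
depend on the block index alone. -/
theorem tauOf_toBlocks {N : ℕ} {d : ℤ} (hd0 : 0 < d) (hs : ∀ a i, s (d * a + i) = s i)
    (Z : Jac R) : tauOf (starJ bar) ε l s h (toBlocks l N hd0 Z)
      = toBlocks l N hd0 (tauOf bar ε l s h Z) := by
  symm
  refine toBlocks_ext hd0 (fun i hi j hj a b => ?_) fun i j hij => ?_
  · have hi' : l - i ∈ levelSet l N := by rw [mem_levelSet] at hi ⊢; omega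
    have hj' : l - j ∈ levelSet l N := by rw [mem_levelSet] at hj ⊢; omega
    have zs : ∀ (u : ℤˣ) (X : Jac R) a b, ((u : ℤ) • X).mat a b = (u : ℤ) • X.mat a b := by
      intro u X a b
      exact map_zsmul (⟨⟨fun X : Jac R => X.mat a b, rfl⟩, fun _ _ => rfl⟩ : Jac R →+ R) _ X
    have e1 : l - (d * b + j) = d * (-b) + (l - j) := by ring
    have e2 : l - (d * a + i) = d * (-a) + (l - i) := by ring
    rw [tauOf_mat, tauOf_mat, zs, starJ_apply, toBlocks_mat hd0 Z hj' hi', e1, e2, hs, hs]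
  · rw [tauOf_mat, toBlocks_mat_of_not hd0, AntiInvolution.map_zero, smul_zero]
    simp only [mem_levelSet] at hij ⊢
    omega

/-- The skew banded matrices over `R` are the skew `d × d` matrices over the banded matrices. -/
theorem nonempty_skew_lieEquiv_levelLie {N : ℕ} {d : ℤ} (hd : d = 2 * N + 1 + l) (hd0 : 0 < d)
    (hs : ∀ a i, s (d * a + i) = s i) :
    Nonempty ((tauOf bar ε l s h).skew ≃ₗ⁅k⁆ levelLie (starJ bar) ε l s h N) := by
  have hneg : ∀ Z : Jac R, toBlocks l N hd0 (-Z) = -toBlocks l N hd0 Z := fun Z =>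
    map_neg (toBlocksLin k l N hd0) Z
  have hmem : ∀ Z : Jac R, Z ∈ (tauOf bar ε l s h).skew →
      toBlocks l N hd0 Z ∈ levelLie (starJ bar) ε l s h N := by
    intro Z hZ
    rw [AntiInvolution.mem_skew] at hZ
    rw [mem_levelLie, tauOf_toBlocks bar h hd0 hs, hZ, hneg]
    refine ⟨rfl, fun a b hab => ?_⟩
    by_contra ha
    exact hab (toBlocks_mat_of_not hd0 Z fun hh => ha hh.1)
  let f : (tauOf bar ε l s h).skew →ₗ⁅k⁆ levelLie (starJ bar) ε l s h N :=
    { toFun := fun Z => ⟨toBlocks l N hd0 Z.1, hmem Z.1 Z.2⟩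
      map_add' := fun Z W => Subtype.ext (map_add (toBlocksLin k l N hd0) Z.1 W.1)
      map_smul' := fun c Z => Subtype.ext (map_smul (toBlocksLin k l N hd0) c Z.1)
      map_lie' := by
        intro Z W
        refine Subtype.ext ?_
        change toBlocks l N hd0 ⁅Z.1, W.1⁆ = ⁅toBlocks l N hd0 Z.1, toBlocks l N hd0 W.1⁆
        rw [Ring.lie_def, Ring.lie_def, ← toBlocks_mul hd hd0, ← toBlocks_mul hd hd0]
        exact map_sub (toBlocksLin k l N hd0) _ _ }
  refine ⟨LieEquiv.ofBijective f ⟨?_, ?_⟩⟩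
  · intro Z W hZW
    exact Subtype.ext (toBlocks_injective hd hd0 (congrArg Subtype.val hZW))
  · rintro ⟨X, hX⟩
    obtain ⟨Z, rfl⟩ := exists_toBlocks_eq hd hd0 fun i j hij => mat_eq_zero_of_mem_levelLie hX hij
    refine ⟨⟨Z, ?_⟩, rfl⟩
    rw [AntiInvolution.mem_skew]
    refine toBlocks_injective hd hd0 ?_
    rw [← tauOf_toBlocks bar h hd0 hs, hneg]
    exact (mem_levelLie.1 hX).1

end Block

/-! ### The classical Lie algebras as levels -/

section Comparison

variable {k A : Type*} [Field k] [Ring A] [Algebra k A] {bar : AntiInvolution k A}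
  {ε : ℤˣ} {l : ℤ} {s : ℤ → ℤˣ} {h : ∀ i, ε * s (l - i) = s i}

theorem mul_unit_add_unit_mul_eq_zero_iff (u v : ℤˣ) (x y : A) :
    x * ((v : ℤ) : A) + ((u : ℤ) : A) * y = 0 ↔ ((u * v : ℤˣ) : ℤ) • x = -y := by
  rcases Int.units_eq_one_or u with rfl | rfl <;> rcases Int.units_eq_one_or v with rfl | rfl <;>
    simp [← sub_eq_add_neg, sub_eq_zero, add_eq_zero_iff_eq_neg, neg_eq_iff_eq_neg]

/-- The form has a single unit entry in each row and column, so its equation in position `(l - i,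
j)` is the skewness condition in position `(i, j)`, the signs agreeing by `ε * s i = s (l - i)`. -/
theorem mem_map_formSkew_iff {n : ℕ} {I : Finset ℤ} (hI : ∀ i, i ∈ I ↔ i ∈ levelSet l n)
    (X : Jac A) : X ∈ (formSkew bar I (formMat A I l s)).map (incl k I)
      ↔ X ∈ levelLie bar ε l s h n := by
  have hII : ∀ i ∈ I, l - i ∈ I := by
    intro i
    rw [hI, hI, mem_levelSet, mem_levelSet]
    omega
  have key : ∀ Y : Matrix I I A, Y ∈ formSkew bar I (formMat A I l s) ↔
      tauOf bar ε l s h (incl k I Y) = -incl k I Y := by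
    intro Y
    have e : ∀ i, ε * s i = s (l - i) := fun i => by
      rw [← h i, ← mul_assoc, Int.units_mul_self, one_mul]
    rw [mem_formSkew_iff bar I l s hII]
    constructor
    · intro hY
      ext i j
      have := hY (l - i) j
      rw [mul_unit_add_unit_mul_eq_zero_iff, sub_sub_cancel] at this
      rw [tauOf_mat, e]
      exact this
    · intro hY i j
      have := congrArg (fun Z : Jac A => Z.mat (l - i) j) hY
      simp only [tauOf_mat, e, sub_sub_cancel] at this
      rw [mul_unit_add_unit_mul_eq_zero_iff]
      exact this
  rw [LieSubalgebra.mem_map]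
  constructor
  · rintro ⟨Y, hY, rfl⟩
    rw [mem_levelLie]
    refine ⟨(key Y).1 hY, fun a b hab => ?_⟩
    by_contra ha
    exact hab (zeroExt_of_not I Y fun hh => ha ((hI a).1 hh.1))
  · intro hX
    have e : incl k I (Matrix.of fun i j : I => X.mat i j) = X := by
      ext i j
      rw [incl_mat]
      by_cases hij : i ∈ I ∧ j ∈ I
      · simp [zeroExt, hij]
      · rw [zeroExt_of_not _ _ hij, mat_eq_zero_of_mem_levelLie hX]
        rwa [← hI, ← hI]
    refine ⟨_, ?_, e⟩
    rw [key, e]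
    exact (mem_levelLie.1 hX).1

end Comparison

/-- The homology of the skew banded matrices over `R` is the stable homology of the skew finite
matrices over the algebra of banded matrices. -/
theorem nonempty_lieHomology_skew_equiv {k R : Type*} [Field k] [CharZero k] [Ring R] [Algebra k R]
    (bar : AntiInvolution k R) {ε : ℤˣ} {l : ℤ} {s : ℤ → ℤˣ} (h : ∀ i, ε * s (l - i) = s i)
    (hl : l = 0 ∨ l = -1) (hs : ∀ (N : ℕ) (a i : ℤ), s ((2 * N + 1 + l) * a + i) = s i)
    (U : LieSubalgebra k (Jac (Jac R)))
    (hU : ∀ X, X ∈ U ↔ ∃ n, X ∈ levelLie (starJ bar) ε l s h n) (q : ℕ) :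
    Nonempty (LieHomology k (tauOf bar ε l s h).skew q ≃ₗ[k] LieHomology k U q) := by
  -- Any block size is available, so it is adapted to the degree: level `q + 1` lies in the stable
  -- range for degree `q`.
  obtain ⟨e⟩ := nonempty_skew_lieEquiv_levelLie bar h (N := q + 1) rfl
    (by push_cast; omega) (hs (q + 1))
  obtain ⟨e1⟩ := nonempty_lieHomology_equiv_of_lieEquiv e q
  obtain ⟨e2⟩ := nonempty_lieHomology_levelLie_equiv hl U hU q
  exact ⟨e1.trans e2⟩

end JacobiLie

theorem corollary3p3 {k : Type*} [Field k] [CharZero k] {R : Type*} [Ring R] [Algebra k R]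
    (bar : JacobiLie.AntiInvolution k R) :
    (∀ n : ℕ, Nonempty (JacobiLie.LieHomology k (JacobiLie.oJOdd bar) n ≃ₗ[k]
        JacobiLie.LieHomology k (JacobiLie.oOdd (JacobiLie.starJ bar)) n)) ∧
    (∀ n : ℕ, Nonempty (JacobiLie.LieHomology k (JacobiLie.spJ bar) n ≃ₗ[k]
        JacobiLie.LieHomology k (JacobiLie.spStable (JacobiLie.starJ bar)) n)) ∧
    (∀ n : ℕ, Nonempty (JacobiLie.LieHomology k (JacobiLie.oJEven bar) n ≃ₗ[k]
        JacobiLie.LieHomology k (JacobiLie.oEven (JacobiLie.starJ bar)) n)) := by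
  refine ⟨fun q => ?_, fun q => ?_, fun q => ?_⟩
  · refine JacobiLie.nonempty_lieHomology_skew_equiv (ε := 1) (l := 0) (s := fun _ => 1) bar
      (fun _ => rfl) (Or.inl rfl) (fun _ _ _ => rfl) _ (fun X => ?_) q
    refine exists_congr fun n => JacobiLie.mem_map_formSkew_iff (fun i => ?_) X
    rw [JacobiLie.idxOdd, Finset.mem_Icc, JacobiLie.mem_levelSet, add_zero]
  · refine JacobiLie.nonempty_lieHomology_skew_equiv (ε := (-1 : ℤ).negOnePow) (l := -1)
      (s := Int.negOnePow) bar _ (Or.inr rfl) (fun N a i => ?_) _ (fun X => ?_) q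
    -- For `l = -1` the block size `2 * N + 1 + l` equals `2 * N`, which is even, so the alternating
    -- signs are periodic with respect to it.
    · rw [Int.negOnePow_add, Int.negOnePow_even _ (by
        rw [add_neg_cancel_right, mul_assoc]; exact even_two_mul _), one_mul]
    · refine exists_congr fun n => JacobiLie.mem_map_formSkew_iff (fun i => ?_) X
      rw [JacobiLie.idxEven, Finset.mem_Ico, JacobiLie.mem_levelSet]
      omega
  · refine JacobiLie.nonempty_lieHomology_skew_equiv (ε := 1) (l := -1) (s := fun _ => 1) bar
      (fun _ => rfl) (Or.inr rfl) (fun _ _ _ => rfl) _ (fun X => ?_) q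
    refine exists_congr fun n => JacobiLie.mem_map_formSkew_iff (fun i => ?_) X
    rw [JacobiLie.idxEven, Finset.mem_Ico, JacobiLie.mem_levelSet]
    omega
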